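/- Let $k,n$ be positive integers, let $m_1,\dots,m_n$ be positive integers, $z_1,\dots,z_n\in\mathbb C$ pairwise distinct, and $\kappa\in\mathbb C\setminus\{0\}$. Consider in $\mathbb C^k$, with coordinates $t_1,\dots,t_k$, the hyperplanes $t_i=t_l$ and $t_i=z_j$, with weights $2/\kappa$ and $-m_j/\kappa$. Let $X$ be the minimal resolution of this arrangement with the divisors of the nonresonant dense edges deleted (the resonant dense edges are $X^j_I=\{t_i=z_j,\ i\in I\}$ with $|I|=m_j+1\le k$), and let $D\subset X$ be the union of the divisors of the resonant ones, a divisor with normal crossings. For $\mathbf j=\{j_1<\dots<j_p\}\subset\{1,\dots,n\}$ with $s_{\mathbf j}=\sum_{j\in\mathbf j}(m_j+1)\le k$, $p\ge 0$, put $e(\mathbf j)=k-s_{\mathbf j}$. The connected components $C^{\mathbf j}_{\mathbf I}$ of the locus where exactly $p$ components of $D$ meet are labelled by such $\mathbf j$ and families $\mathbf I=(I_j)_{j\in\mathbf j}$ of pairwise disjoint subsets of $\{1,\dots,k\}$ with $|I_j|=m_j+1$; $C^{\mathbf j}_{\mathbf I}$ is the locus lying on the divisors of the edges $X^j_{I_j}$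 $(j\in\mathbf j)$ and on no others. It has the coordinates $u_{i_l}=(t_{i_l}-z_j)/(t_{i_0}-z_j)$, $l=1,\dots,m_j$, for every $I_j=\{i_0<\dots<i_{m_j}\}$ (functions on $X$ near $C^{\mathbf j}_{\mathbf I}$, restricted to it), and $t_i$ for $i\notin\bigcup I_j$. Put $\mu_{I_j}=d\log u_{i_1}\wedge\dots\wedge d\log u_{i_{m_j}}$. Let $\mathbf I^0$ consist of the consecutive intervals $I^0_{j_1},\dots,I^0_{j_p}$ of lengths $m_{j_1}+1,\dots,m_{j_p}+1$ that make up $\{1,\dots,s_{\mathbf j}\}$. For $K=(k_1,\dots,k_n)\in\mathbb Z_{\ge0}^n$ with $|K|=k_1+\dots+k_n\in\{e(\mathbf j),e(\mathbf j)-1\}$ and $l_i=k_1+\dots+k_i$, let $$\eta^{\mathbf j}_{K,i}=d\log(t_{s_{\mathbf j}+l_{i-1}+1}-z_i)\wedge\dots\wedge d\log(t_{s_{\mathbf j}+l_i}-z_i),$$ $$\alpha^{\mathbf j}_K=\frac{(-1)^{d_{\mathbf j}}}{\prod_{j\in\mathbf j}(m_j+1)!\,\prod_{i=1}^n k_i!},\qquad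 d_{\mathbf j}=\sum_{i=1}^{p-1}(p-i)(m_{j_i}+1).$$ Extend the form $\alpha^{\mathbf j}_K\,\mu_{I^0_{j_1}}\wedge\dots\wedge\mu_{I^0_{j_p}}\wedge\eta^{\mathbf j}_{K,1}\wedge\dots\wedge\eta^{\mathbf j}_{K,n}$ on $C^{\mathbf j}_{\mathbf I^0}$ by zero to $\bigcup_{\mathbf I}C^{\mathbf j}_{\mathbf I}$, multiply it by $\kappa^{-k}$ if $|K|=e(\mathbf j)$ and by $(-1)^{k-p}\kappa^{-(k-1)}$ if $|K|=e(\mathbf j)-1$, and let $\omega^{\mathbf j}_K=\sum_{\sigma\in S_k}(-1)^{|\sigma|}\sigma(\cdot)$ be the skew-symmetrization of the result, a form on $\bigcup_{\mathbf I}C^{\mathbf j}_{\mathbf I}$. Let $J\notin\mathbf j$, $\tilde{\mathbf j}=\mathbf j\cup\{J\}$ with $s_{\tilde{\mathbf j}}\le k$, and let $q$ be the number of elements of $\mathbf j$ that are smaller than $J$ (so $J=\tilde j_{q+1}$). Let $\operatorname{res}_{\mathbf j}^{\tilde{\mathbf j}}$ be the residue from $\bigcup_{\mathbf I}C^{\mathbf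 j}_{\mathbf I}$ to $\bigcup_{\tilde{\mathbf I}}C^{\tilde{\mathbf j}}_{\tilde{\mathbf I}}$, normalized by $\operatorname{res}\big(\tfrac{dr}{r}\wedge\beta+\gamma\big)=\beta|_{r=0}$, where $r=0$ is a local equation of the divisor and $\beta,\gamma$ are holomorphic. Let $|K|\in\{e(\mathbf j),e(\mathbf j)-1\}$ and let $\tilde K$ be $K$ with $k_J$ replaced by $k_J-m_J-1$. Then: 1. if $k_J<m_J+1$, then $\operatorname{res}_{\mathbf j}^{\tilde{\mathbf j}}\omega^{\mathbf j}_K=0$; 2. if $k_J\ge m_J+1$, then $\operatorname{res}_{\mathbf j}^{\tilde{\mathbf j}}\omega^{\mathbf j}_K=(-1)^q\,\omega^{\tilde{\mathbf j}}_{\tilde K}$ for $|K|=e(\mathbf j)$, and $\operatorname{res}_{\mathbf j}^{\tilde{\mathbf j}}\omega^{\mathbf j}_K=(-1)^{q+1}\,\omega^{\tilde{\mathbf j}}_{\tilde K}$ for $|K|=e(\mathbf j)-1$. -/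

import Mathlib

open Finset Filter Topology
open scoped LinearAlgebra.Projectivization

noncomputable section

namespace SkewRes

/-! ## Holomorphic differential forms on charts -/

section Forms

variable {E F : Type*} [NormedAddCommGroup E] [NormedSpace ℂ E]
  [NormedAddCommGroup F] [NormedSpace ℂ F]

/-- Differential `d`-forms of type `(d,0)` on a complex vector space `E`. -/
abbrev DForm (E : Type*) [NormedAddCommGroup E] [NormedSpace ℂ E] (d : ℕ) : Type _ :=
  E → E [⋀^Fin d]→L[ℂ] ℂ

/-- The pullback `f^* ω`. -/
def pullback {d : ℕ} (f : E → F) (ω : DForm F d) : DForm E d :=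
  fun x => (ω (f x)).compContinuousLinearMap (fderiv ℂ f x)

/-- The exterior product `a ∧ b` of a covector and an alternating form:
`(a ∧ b)(v₀,…,v_d) = ∑ᵢ (-1)^i a(vᵢ) b(v₀,…,v̂ᵢ,…,v_d)`. -/
def wedgeOne {d : ℕ} (a : E →L[ℂ] ℂ) (b : E [⋀^Fin d]→L[ℂ] ℂ) : E [⋀^Fin (d + 1)]→L[ℂ] ℂ :=
  ContinuousAlternatingMap.alternatizeUncurryFin (a.smulRight b)

/-- The component of degree `d` of the exterior product `a₁ ∧ ⋯ ∧ a_r` of a list of covectors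
(which is the whole product if `d = r`, and `0` otherwise). -/
def wedgeList : List (E →L[ℂ] ℂ) → (d : ℕ) → E [⋀^Fin d]→L[ℂ] ℂ
  | [], 0 => ContinuousAlternatingMap.constOfIsEmpty ℂ E (Fin 0) 1
  | [], _ + 1 => 0
  | _ :: _, 0 => 0
  | a :: l, d + 1 => wedgeOne a (wedgeList l d)

/-- `d log f = df / f` at the point `x`. -/
def dlog (f : E → ℂ) (x : E) : E →L[ℂ] ℂ := (f x)⁻¹ • fderiv ℂ f x

end Forms

/-! ## Labels of the components of the strata, and their affine charts -/

/-- The components `C_I^S` of the stratum of codimension `|S|` are labelled by families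
`I = (I_j)_{j ∈ S}` of pairwise disjoint subsets of the set of indices of the coordinates
`t_1, …, t_k`, with `|I_j| = m_j + 1`. (For `j ∉ S` we put `I_j = ∅`.) -/
structure Label {n : ℕ} (k : ℕ) (m : Fin n → ℕ) (S : Finset (Fin n)) where
  /-- the sets `I_j` -/
  I : Fin n → Finset (Fin k)
  card_eq : ∀ j ∈ S, (I j).card = m j + 1
  eq_empty : ∀ j, j ∉ S → I j = ∅
  disj : ∀ i j, i ≠ j → Disjoint (I i) (I j)

namespace Label

variable {n k : ℕ} {m : Fin n → ℕ} {S : Finset (Fin n)}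

/-- `i` belongs to one of the sets `I_j`. -/
abbrev InBlock (L : Label k m S) (i : Fin k) : Prop := ∃ j, i ∈ L.I j

/-- The smallest element `i_0` of `I_j` if `i ∈ I_j`, and `i` itself if `i` is in none of the
sets `I_j`. -/
def leader (L : Label k m S) (i : Fin k) : Fin k :=
  (univ.filter fun l => l = i ∨ ∃ j, i ∈ L.I j ∧ l ∈ L.I j).min' ⟨i, by simp⟩

/-- `i` is the smallest element of one of the sets `I_j`. -/
abbrev IsBase (L : Label k m S) (i : Fin k) : Prop := L.InBlock i ∧ L.leader i = i

/-- The affine space of the chart of `C_I^S`, a component of dimension `k - |S|`. The coordinates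
are `u_{i_1}, …, u_{i_{m_j}}` for every `I_j = {i_0 < ⋯ < i_{m_j}}` (coordinates on an affine
chart of the projective space of dimension `m_j`) and `t_i` for `i ∉ ⋃ I_j`. -/
abbrev Chart (L : Label k m S) : Type := {i : Fin k // ¬ L.IsBase i} → ℂ

/-- Homogeneous coordinates of a point of the chart: the affine coordinates `u_i`, `t_i`,
completed by `u_{i_0} = 1`. -/
def hom (L : Label k m S) (y : L.Chart) : Fin k → ℂ :=
  fun i => if h : L.IsBase i then 1 else y ⟨i, h⟩

/-- From homogeneous to affine coordinates: `u_i = x_i / x_{i_0}`, `t_i = x_i`. -/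
def aff (L : Label k m S) (x : Fin k → ℂ) : L.Chart :=
  fun i => if L.InBlock i.1 then x i.1 / x (L.leader i.1) else x i.1

/-- The image of `C_I^S` in its chart: the complement of the product of the arrangements
`u_i = 0`, `u_i = 1`, `u_i = u_l` (`i, l ∈ I_j`) and of the discriminantal arrangement
`t_i = t_l`, `t_i = z_l`. -/
def compl (z : Fin n → ℂ) (L : Label k m S) : Set L.Chart :=
  {y | (∀ i, L.InBlock i → L.hom y i ≠ 0) ∧
    (∀ j, ∀ i ∈ L.I j, ∀ l ∈ L.I j, i ≠ l → L.hom y i ≠ L.hom y l) ∧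
    (∀ i l, ¬ L.InBlock i → ¬ L.InBlock l → i ≠ l → L.hom y i ≠ L.hom y l) ∧
    (∀ i, ¬ L.InBlock i → ∀ j, L.hom y i ≠ z j)}

/-- The family `σ⁻¹ I = (σ⁻¹ I_j)_j`. -/
def pull (σ : Equiv.Perm (Fin k)) (L : Label k m S) : Label k m S where
  I j := (L.I j).map σ.symm.toEmbedding
  card_eq j hj := by simpa using L.card_eq j hj
  eq_empty j hj := by simpa using L.eq_empty j hj
  disj i j hij := by simpa using L.disj i j hij

/-- The map `σ⁻¹ : C_I^S → C_{σ⁻¹ I}^S` in the charts. Here `σ` permutes the coordinates,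
`(σ x)_{σ(i)} = x_i`. -/
def permMap (σ : Equiv.Perm (Fin k)) (L : Label k m S) (y : L.Chart) : (L.pull σ).Chart :=
  (L.pull σ).aff fun i => L.hom y (σ i)

/-- If `I` is a label for `S ∪ {J}`, then `(I_j)_{j ∈ S}` is the label of the only component for
`S` whose closure contains the component labelled by `I`. -/
def face (J : Fin n) (L : Label k m (insert J S)) : Label k m S where
  I j := if j ∈ S then L.I j else ∅
  card_eq j hj := by simpa [hj] using L.card_eq j (mem_insert_of_mem hj)
  eq_empty j hj := by simp [hj]
  disj i j hij := by
    by_cases hi : i ∈ S <;> by_cases hj : j ∈ S <;> simp [hi, hj, L.disj i j hij]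

/-- The blow-up in coordinates. Near the component `C_I^{S ∪ {J}}`, the closure of
`C_{face I}^S` has coordinates `(r, y)`, with `y` the coordinates of `C_I^{S ∪ {J}}`, related to
the coordinates of `C_{face I}^S` by `t_{i_0} = z_J + r` and `t_i = z_J + r u_i` for `i ∈ I_J`
(`i_0 = min I_J`), all other coordinates being the same; the exceptional divisor is `r = 0`. -/
def blowMap (z : Fin n → ℂ) (J : Fin n) (L : Label k m (insert J S)) (w : ℂ × L.Chart) :
    (L.face J).Chart :=
  (L.face J).aff fun i => if i ∈ L.I J then z J + w.1 * L.hom w.2 i else L.hom w.2 i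

end Label

/-! ## The resolution and its strata -/

/-- A point of the simultaneous blow-up of `ℂ^k` along the edges
`X_I^j = {t_i = z_j for i ∈ I}`, `|I| = m_j + 1`: a point `t` of `ℂ^k` with, for all `j` and `I`, a
line in the normal space `ℂ^I` of `X_I^j` that contains `(t_i - z_j)_{i ∈ I}`. -/
structure BlowupPoint {n : ℕ} (k : ℕ) (m : Fin n → ℕ) (z : Fin n → ℂ) where
  /-- the image in `ℂ^k` -/
  t : Fin k → ℂ
  /-- the lines in the normal spaces -/
  line : ∀ (j : Fin n) (I : {I : Finset (Fin k) // I.card = m j + 1}), ℙ ℂ (I.1 → ℂ)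
  incid : ∀ j I, (fun i : I.1 => t i - z j) ∈ (line j I).submodule

namespace BlowupPoint

variable {n k : ℕ} {m : Fin n → ℕ} {z : Fin n → ℂ}

/-- The set of `i` with `t_i = z_j`. -/
def zeros (p : BlowupPoint k m z) (j : Fin n) : Finset (Fin k) := univ.filter fun i => p.t i = z j

/-- The manifold `X`, that is, the minimal resolution of the arrangement `t_i = t_l`, `t_i = z_j`
without the divisors of its nonresonant dense edges. Over `X`, the only edges that contain `t` are
those contained in edges `X_I^j` with `I = {i : t_i = z_j}`, `|I| = m_j + 1`, and the line in
`ℂ^I` avoids the (strict transforms of the) hyperplanes `t_i = z_j` and `t_i = t_l`, `i, l ∈ I`. -/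
def X (k : ℕ) (m : Fin n → ℕ) (z : Fin n → ℂ) : Set (BlowupPoint k m z) :=
  {p | (∀ j, p.zeros j = ∅ ∨ (p.zeros j).card = m j + 1) ∧
    (∀ i l, i ≠ l → p.t i = p.t l → ∃ j, p.t i = z j) ∧
    (∀ j (h : (p.zeros j).card = m j + 1),
      (∀ i, (p.line j ⟨p.zeros j, h⟩).rep i ≠ 0) ∧
        Function.Injective (p.line j ⟨p.zeros j, h⟩).rep)}

/-- The component `C_I^S`: the points of `X` that lie on the exceptional divisors over the edges
`X_{I_j}^j`, `j ∈ S`, and on no other. -/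
def stratum {S : Finset (Fin n)} (z : Fin n → ℂ) (L : Label k m S) : Set (BlowupPoint k m z) :=
  {p | p ∈ X k m z ∧ ∀ j, p.zeros j = L.I j}

/-- Homogeneous coordinates of the line of `p` in `ℂ^{I_j}`, and the coordinates `t_i` of `p` for
`i ∉ ⋃ I_j`. -/
def homCoord {S : Finset (Fin n)} (L : Label k m S) (p : BlowupPoint k m z) (i : Fin k) : ℂ :=
  if h : ∃ j, j ∈ S ∧ i ∈ L.I j then
    (p.line h.choose ⟨L.I h.choose, L.card_eq _ h.choose_spec.1⟩).rep ⟨i, h.choose_spec.2⟩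
  else p.t i

/-- The affine coordinates `u_i` (the ratios of the homogeneous coordinates) and `t_i` near
`C_I^S`. -/
def coord {S : Finset (Fin n)} (L : Label k m S) (p : BlowupPoint k m z) : L.Chart :=
  L.aff (p.homCoord L)

end BlowupPoint

/-! ## The charts are those of the resolution -/

namespace Label

variable {n k : ℕ} {m : Fin n → ℕ} {S : Finset (Fin n)}

lemma mem_S (L : Label k m S) {i : Fin k} {j : Fin n} (h : i ∈ L.I j) : j ∈ S := by
  by_contra hj
  simp [L.eq_empty j hj] at h

lemma unique (L : Label k m S) {i : Fin k} {j l : Fin n} (h : i ∈ L.I j) (h' : i ∈ L.I l) :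
    j = l := by
  by_contra hne
  exact Finset.disjoint_left.mp (L.disj j l hne) h h'

lemma leader_mem (L : Label k m S) {i : Fin k} {j : Fin n} (h : i ∈ L.I j) :
    L.leader i ∈ L.I j := by
  have := Finset.min'_mem (univ.filter fun l => l = i ∨ ∃ j, i ∈ L.I j ∧ l ∈ L.I j)
    ⟨i, by simp⟩
  rcases (Finset.mem_filter.mp this).2 with e | ⟨j', h1, h2⟩
  · rw [Label.leader, e]; exact h
  · rw [L.unique h h1]; exact h2

lemma leader_le (L : Label k m S) {i l : Fin k} {j : Fin n} (h : i ∈ L.I j) (hl : l ∈ L.I j) :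
    L.leader i ≤ l :=
  Finset.min'_le _ _ (by simpa using Or.inr ⟨j, h, hl⟩)

lemma leader_eq (L : Label k m S) {i l : Fin k} {j : Fin n} (h : i ∈ L.I j) (hl : l ∈ L.I j) :
    L.leader i = L.leader l :=
  le_antisymm (L.leader_le h (L.leader_mem hl)) (L.leader_le hl (L.leader_mem h))

lemma isBase_leader (L : Label k m S) {i : Fin k} (h : L.InBlock i) : L.IsBase (L.leader i) := by
  obtain ⟨j, hj⟩ := h
  exact ⟨⟨j, L.leader_mem hj⟩, (L.leader_eq hj (L.leader_mem hj)).symm⟩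

lemma hom_of_isBase (L : Label k m S) (y : L.Chart) {i : Fin k} (h : L.IsBase i) :
    L.hom y i = 1 := by
  simp only [hom, dif_pos h]

lemma aff_hom (L : Label k m S) (y : L.Chart) : L.aff (L.hom y) = y := by
  funext ⟨i, hi⟩
  by_cases h : L.InBlock i
  · simp only [aff, if_pos h, L.hom_of_isBase y (L.isBase_leader h), div_one]
    simp only [hom, dif_neg hi]
  · simp only [aff, if_neg h, hom, dif_neg hi]

lemma hom_aff_of_inBlock (L : Label k m S) (x : Fin k → ℂ) {i : Fin k} (h : L.InBlock i)
    (hx : x (L.leader i) ≠ 0) : L.hom (L.aff x) i = x i / x (L.leader i) := by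
  by_cases hb : L.IsBase i
  · rw [L.hom_of_isBase _ hb, hb.2, div_self]
    rwa [hb.2] at hx
  · simp only [hom, dif_neg hb, aff, if_pos h]

lemma hom_aff_of_not_inBlock (L : Label k m S) (x : Fin k → ℂ) {i : Fin k}
    (h : ¬ L.InBlock i) : L.hom (L.aff x) i = x i := by
  have hb : ¬ L.IsBase i := fun hb => h hb.1
  simp only [hom, dif_neg hb, aff, if_neg h]

end Label

namespace BlowupPoint

variable {n k : ℕ} {m : Fin n → ℕ} {z : Fin n → ℂ} {S : Finset (Fin n)}

lemma homCoord_of_mem (L : Label k m S) (p : BlowupPoint k m z) {j : Fin n} (hj : j ∈ S)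
    {i : Fin k} (hi : i ∈ L.I j) :
    p.homCoord L i = (p.line j ⟨L.I j, L.card_eq j hj⟩).rep ⟨i, hi⟩ := by
  have key : ∀ j' (h : j' ∈ S ∧ i ∈ L.I j'),
      (p.line j' ⟨L.I j', L.card_eq j' h.1⟩).rep ⟨i, h.2⟩ =
        (p.line j ⟨L.I j, L.card_eq j hj⟩).rep ⟨i, hi⟩ := by
    intro j' h
    obtain rfl := L.unique h.2 hi
    rfl
  have h : ∃ j, j ∈ S ∧ i ∈ L.I j := ⟨j, hj, hi⟩
  rw [homCoord, dif_pos h]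
  exact key _ h.choose_spec

lemma homCoord_of_not (L : Label k m S) (p : BlowupPoint k m z) {i : Fin k}
    (hi : ¬ L.InBlock i) : p.homCoord L i = p.t i := by
  rw [homCoord, dif_neg]
  rintro ⟨j, -, h⟩
  exact hi ⟨j, h⟩

lemma rep_stratum {L : Label k m S} {p : BlowupPoint k m z} (hp : p ∈ stratum z L) {j : Fin n}
    (hj : j ∈ S) :
    (∀ i, (p.line j ⟨L.I j, L.card_eq j hj⟩).rep i ≠ 0) ∧
      Function.Injective (p.line j ⟨L.I j, L.card_eq j hj⟩).rep := by
  have := hp.1.2.2 j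
  rw [hp.2 j] at this
  exact this (L.card_eq j hj)

lemma t_eq_iff {L : Label k m S} {p : BlowupPoint k m z} (hp : p ∈ stratum z L) (i : Fin k)
    (j : Fin n) : p.t i = z j ↔ i ∈ L.I j := by
  rw [← hp.2 j]
  simp [zeros]

lemma homCoord_ne_zero {L : Label k m S} {p : BlowupPoint k m z} (hp : p ∈ stratum z L)
    {i : Fin k} (hi : L.InBlock i) : p.homCoord L i ≠ 0 := by
  obtain ⟨j, hj⟩ := hi
  rw [homCoord_of_mem L p (L.mem_S hj) hj]
  exact (rep_stratum hp (L.mem_S hj)).1 _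

lemma hom_coord_of_mem {L : Label k m S} {p : BlowupPoint k m z} (hp : p ∈ stratum z L)
    {i : Fin k} (hi : L.InBlock i) :
    L.hom (p.coord L) i = p.homCoord L i / p.homCoord L (L.leader i) :=
  L.hom_aff_of_inBlock _ hi (homCoord_ne_zero hp (L.isBase_leader hi).1)

lemma hom_coord_of_not {L : Label k m S} {p : BlowupPoint k m z} {i : Fin k}
    (hi : ¬ L.InBlock i) : L.hom (p.coord L) i = p.t i := by
  rw [coord, L.hom_aff_of_not_inBlock _ hi, homCoord_of_not L p hi]

lemma coord_mem_compl {L : Label k m S} {p : BlowupPoint k m z} (hp : p ∈ stratum z L) :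
    p.coord L ∈ L.compl z := by
  refine ⟨fun i hi => ?_, fun j i hi l hl hil => ?_, fun i l hi hl hil => ?_, fun i hi j => ?_⟩
  · rw [hom_coord_of_mem hp hi]
    exact div_ne_zero (homCoord_ne_zero hp hi) (homCoord_ne_zero hp (L.isBase_leader hi).1)
  · rw [hom_coord_of_mem hp ⟨j, hi⟩, hom_coord_of_mem hp ⟨j, hl⟩, L.leader_eq hl hi]
    intro h
    have h0 := homCoord_ne_zero hp (L.isBase_leader ⟨j, hi⟩).1
    rw [div_left_inj' h0, homCoord_of_mem L p (L.mem_S hi) hi,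
      homCoord_of_mem L p (L.mem_S hi) hl] at h
    exact hil (congrArg Subtype.val ((rep_stratum hp (L.mem_S hi)).2 h))
  · rw [hom_coord_of_not hi, hom_coord_of_not hl]
    intro h
    obtain ⟨j, hj⟩ := hp.1.2.1 i l hil h
    exact hi ⟨j, (t_eq_iff hp i j).mp hj⟩
  · rw [hom_coord_of_not hi]
    exact fun h => hi ⟨j, (t_eq_iff hp i j).mp h⟩

lemma line_eq_mk {ι : Type*} (ℓ : ℙ ℂ (ι → ℂ)) {v : ι → ℂ} (hv : v ≠ 0) (h : v ∈ ℓ.submodule) :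
    ℓ = Projectivization.mk ℂ v hv := by
  rw [Projectivization.submodule_eq, Submodule.mem_span_singleton] at h
  obtain ⟨a, ha⟩ := h
  conv_lhs => rw [← ℓ.mk_rep]
  refine ((Projectivization.mk_eq_mk_iff' ℂ _ _ hv ℓ.rep_nonzero).mpr ⟨a, ha⟩).symm

lemma coord_injOn (L : Label k m S) : Set.InjOn (coord L) (stratum z L) := by
  intro p hp p' hp' h
  have ht : p.t = p'.t := by
    funext i
    by_cases hi : L.InBlock i
    · obtain ⟨j, hj⟩ := hi
      rw [(t_eq_iff hp i j).mpr hj, (t_eq_iff hp' i j).mpr hj]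
    · rw [← hom_coord_of_not (p := p) hi, ← hom_coord_of_not (p := p') hi, h]
  have hline : p.line = p'.line := by
    funext j I
    by_cases hv : (fun i : I.1 => p.t i - z j) = 0
    · have hsub : I.1 ⊆ L.I j := fun i hi =>
        (t_eq_iff hp i j).mp (sub_eq_zero.mp (congrFun hv ⟨i, hi⟩))
      have hjS : j ∈ S := by
        obtain ⟨i, hi⟩ : I.1.Nonempty := Finset.card_pos.mp (by rw [I.2]; omega)
        exact L.mem_S (hsub hi)
      obtain ⟨I, hI⟩ := I
      obtain rfl : I = L.I j := Finset.eq_of_subset_of_card_le hsub (by rw [hI, L.card_eq j hjS])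
      obtain ⟨i₀, hi₀⟩ : (L.I j).Nonempty := Finset.card_pos.mp (by rw [hI]; omega)
      have hlead := L.leader_mem hi₀
      rw [← (p.line j ⟨L.I j, hI⟩).mk_rep, ← (p'.line j ⟨L.I j, hI⟩).mk_rep,
        Projectivization.mk_eq_mk_iff']
      refine ⟨(p.line j ⟨L.I j, hI⟩).rep ⟨_, hlead⟩ / (p'.line j ⟨L.I j, hI⟩).rep ⟨_, hlead⟩, ?_⟩
      funext ⟨i, hi⟩
      have e : L.hom (p.coord L) i = L.hom (p'.coord L) i := by rw [h]
      rw [hom_coord_of_mem hp ⟨j, hi⟩, hom_coord_of_mem hp' ⟨j, hi⟩, L.leader_eq hi hi₀,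
        homCoord_of_mem L p hjS hi, homCoord_of_mem L p' hjS hi,
        homCoord_of_mem L p hjS hlead, homCoord_of_mem L p' hjS hlead] at e
      have h1 := (rep_stratum hp hjS).1 ⟨_, hlead⟩
      have h2 := (rep_stratum hp' hjS).1 ⟨_, hlead⟩
      simp only [Pi.smul_apply, smul_eq_mul]
      field_simp at e ⊢
      linear_combination -e
    · rw [line_eq_mk _ hv (p.incid j I)]
      refine (line_eq_mk _ hv ?_).symm
      rw [ht]
      exact p'.incid j I
  cases p
  cases p'
  simp_all

/-- Every point of the complement is the coordinate vector of a point of `C_I^S`. -/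
lemma coord_surjOn (hz : Function.Injective z) (L : Label k m S) :
    Set.SurjOn (coord L) (stratum z L) (L.compl z) := by
  classical
  intro y hy
  obtain ⟨h0, hinj, hfree, hfreez⟩ := hy
  obtain ⟨t, ht1, ht2⟩ : ∃ t : Fin k → ℂ, (∀ i j, i ∈ L.I j → t i = z j) ∧
      ∀ i, ¬ L.InBlock i → t i = L.hom y i := by
    refine ⟨fun i => if h : L.InBlock i then z h.choose else L.hom y i, fun i j hi => ?_,
      fun i hi => by simp only [dif_neg hi]⟩
    have h : L.InBlock i := ⟨j, hi⟩
    simp only [dif_pos h]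
    rw [L.unique h.choose_spec hi]
  have ht : ∀ i j, t i = z j ↔ i ∈ L.I j := by
    refine fun i j => ⟨fun h => ?_, ht1 i j⟩
    by_cases hi : L.InBlock i
    · obtain ⟨l, hl⟩ := hi
      rw [ht1 i l hl] at h
      rwa [← hz h]
    · exact absurd ((ht2 i hi).symm.trans h) (hfreez i hi j)
  have hne : ∀ (j : Fin n) (I : {I : Finset (Fin k) // I.card = m j + 1}),
      (fun i : I.1 => t i - z j) = 0 → (fun i : I.1 => L.hom y i) ≠ 0 := by
    intro j I hv h
    obtain ⟨i, hi⟩ : I.1.Nonempty := Finset.card_pos.mp (by rw [I.2]; omega)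
    exact h0 i ⟨j, (ht i j).mp (sub_eq_zero.mp (congrFun hv ⟨i, hi⟩))⟩ (congrFun h ⟨i, hi⟩)
  let p : BlowupPoint k m z :=
    { t := t
      line := fun j I => if h : (fun i : I.1 => t i - z j) = 0 then
        Projectivization.mk ℂ (fun i : I.1 => L.hom y i) (hne j I h)
        else Projectivization.mk ℂ (fun i : I.1 => t i - z j) h
      incid := by
        intro j I
        by_cases h : (fun i : I.1 => t i - z j) = 0
        · have hall : ∀ ℓ : ℙ ℂ (I.1 → ℂ), (fun i : I.1 => t i - z j) ∈ ℓ.submodule := by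
            intro ℓ
            rw [h]
            exact Submodule.zero_mem _
          exact hall _
        · rw [dif_neg h, Projectivization.submodule_mk]
          exact Submodule.mem_span_singleton_self _ }
  have hzeros : ∀ j, p.zeros j = L.I j := by
    intro j
    ext i
    simp only [zeros, Finset.mem_filter, Finset.mem_univ, true_and]
    exact ht i j
  have hrep : ∀ j (h : (L.I j).card = m j + 1), ∃ a : ℂ, a ≠ 0 ∧ ∀ i : L.I j,
      (p.line j ⟨L.I j, h⟩).rep i = a * L.hom y i := by
    intro j h
    have hv : (fun i : L.I j => t i - z j) = 0 := by
      funext i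
      exact sub_eq_zero.mpr (ht1 i j i.2)
    have hl : p.line j ⟨L.I j, h⟩ =
        Projectivization.mk ℂ (fun i : L.I j => L.hom y i) (hne j ⟨L.I j, h⟩ hv) := dif_pos hv
    obtain ⟨a, ha⟩ := Projectivization.exists_smul_eq_mk_rep ℂ _ (hne j ⟨L.I j, h⟩ hv)
    refine ⟨a, a.ne_zero, fun i => ?_⟩
    rw [hl, ← ha]
    rfl
  have hp : p ∈ stratum z L := by
    refine ⟨⟨fun j => ?_, fun i l hil hti => ?_, fun j => ?_⟩, hzeros⟩
    · rw [hzeros j]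
      by_cases hj : j ∈ S
      · exact Or.inr (L.card_eq j hj)
      · exact Or.inl (L.eq_empty j hj)
    · by_contra hcon
      push Not at hcon
      have hi : ¬ L.InBlock i := fun ⟨j, hj⟩ => hcon j (ht1 i j hj)
      have hl : ¬ L.InBlock l := fun ⟨j, hj⟩ => hcon j (hti.trans (ht1 l j hj))
      exact hfree i l hi hl hil ((ht2 i hi).symm.trans (hti.trans (ht2 l hl)))
    · rw [hzeros j]
      intro h
      obtain ⟨a, ha, hr⟩ := hrep j h
      refine ⟨fun i => ?_, fun i l hil => ?_⟩
      · rw [hr i]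
        exact mul_ne_zero ha (h0 i ⟨j, i.2⟩)
      · rw [hr i, hr l] at hil
        by_contra hne'
        exact hinj j i i.2 l l.2 (fun e => hne' (Subtype.ext e)) (mul_left_cancel₀ ha hil)
  refine ⟨p, hp, ?_⟩
  rw [← L.aff_hom y, ← L.aff_hom (p.coord L)]
  congr 1
  funext i
  by_cases hi : L.InBlock i
  · have hb := L.isBase_leader hi
    rw [hom_coord_of_mem hp hi]
    obtain ⟨j, hj⟩ := hi
    have hjS := L.mem_S hj
    obtain ⟨a, ha, hr⟩ := hrep j (L.card_eq j hjS)
    rw [homCoord_of_mem L p hjS hj, homCoord_of_mem L p hjS (L.leader_mem hj), hr, hr,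
      L.hom_of_isBase y hb, mul_one, mul_div_cancel_left₀ _ ha]
  · rw [hom_coord_of_not hi]
    exact ht2 i hi

/-- The affine coordinates identify `C_I^S` with the complement of the product arrangement. -/
theorem coord_bijOn (hz : Function.Injective z) (L : Label k m S) :
    Set.BijOn (coord L) (stratum z L) (L.compl z) :=
  ⟨fun _ hp => coord_mem_compl hp, coord_injOn L, coord_surjOn hz L⟩

/-- `X` is the union of the components `C_I^S`. -/
theorem mem_X_iff (hz : Function.Injective z) (p : BlowupPoint k m z) :
    p ∈ X k m z ↔ ∃ (S : Finset (Fin n)) (L : Label k m S), p ∈ stratum z L := by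
  classical
  refine ⟨fun hp => ?_, fun ⟨S, L, h⟩ => h.1⟩
  refine ⟨univ.filter fun j => (p.zeros j).Nonempty, ⟨p.zeros, fun j hj => ?_, fun j hj => ?_,
    fun i j hij => ?_⟩, hp, fun j => rfl⟩
  · exact (hp.1 j).resolve_left (Finset.nonempty_iff_ne_empty.mp (by simpa using hj))
  · simpa [Finset.not_nonempty_iff_eq_empty] using hj
  · rw [Finset.disjoint_left]
    intro a ha hb
    simp only [zeros, Finset.mem_filter, Finset.mem_univ, true_and] at ha hb
    exact hij (hz (ha.symm.trans hb))

/-- A point of `C_{face I}^S` at which the homogeneous coordinates of the line over `X_{I_J}^J` do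
not vanish has coordinates `blowMap (r, y)`, where `r = t_{i_0} - z_J`, `i_0 = min I_J`, and `y`
are its coordinates near `C_I^{S ∪ {J}}`. -/
theorem coord_face {J : Fin n} (hJ : J ∉ S) (L : Label k m (insert J S))
    {p : BlowupPoint k m z} (hp : p ∈ stratum z (L.face J)) {i₀ : Fin k} (hi₀ : i₀ ∈ L.I J)
    (hne : ∀ i ∈ L.I J, p.homCoord L i ≠ 0) :
    p.coord (L.face J) = L.blowMap z J (p.t (L.leader i₀) - z J, p.coord L) := by
  have hface : ∀ i j, i ∈ (L.face J).I j ↔ j ∈ S ∧ i ∈ L.I j := by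
    intro i j
    by_cases hj : j ∈ S <;> simp [Label.face, hj]
  have hin : ∀ i, (L.face J).InBlock i ↔ L.InBlock i ∧ i ∉ L.I J := by
    intro i
    constructor
    · rintro ⟨j, hj⟩
      obtain ⟨h1, h2⟩ := (hface i j).mp hj
      exact ⟨⟨j, h2⟩, fun h => hJ (L.unique h2 h ▸ h1)⟩
    · rintro ⟨⟨j, hj⟩, h⟩
      refine ⟨j, (hface i j).mpr ⟨?_, hj⟩⟩
      rcases Finset.mem_insert.mp (L.mem_S hj) with rfl | h'
      · exact absurd hj h
      · exact h'
  have hhom : ∀ i, (L.face J).InBlock i → p.homCoord (L.face J) i = p.homCoord L i := by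
    rintro i ⟨j, hj⟩
    obtain ⟨h1, h2⟩ := (hface i j).mp hj
    rw [homCoord_of_mem _ p h1 hj, homCoord_of_mem L p (mem_insert_of_mem h1) h2]
    have e : (L.face J).I j = L.I j := by simp [Label.face, h1]
    have gen : ∀ (A B : Finset (Fin k)) (hA : A.card = m j + 1) (hB : B.card = m j + 1)
        (iA : i ∈ A) (iB : i ∈ B), A = B →
        (p.line j ⟨A, hA⟩).rep ⟨i, iA⟩ = (p.line j ⟨B, hB⟩).rep ⟨i, iB⟩ := by
      intro A B hA hB iA iB hAB
      subst hAB
      rfl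
    exact gen _ _ _ _ _ _ e
  have hall : ∀ i, L.InBlock i → p.homCoord L i ≠ 0 := by
    intro i hi
    by_cases h : i ∈ L.I J
    · exact hne i h
    · rw [← hhom i ((hin i).mpr ⟨hi, h⟩)]
      exact homCoord_ne_zero hp ((hin i).mpr ⟨hi, h⟩)
  have hlead : ∀ i, (L.face J).InBlock i → (L.face J).leader i = L.leader i := by
    rintro i ⟨j, hj⟩
    obtain ⟨h1, h2⟩ := (hface i j).mp hj
    exact le_antisymm ((L.face J).leader_le hj ((hface _ j).mpr ⟨h1, L.leader_mem h2⟩))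
      (L.leader_le h2 ((hface _ j).mp ((L.face J).leader_mem hj)).2)
  have hcL : ∀ i, L.InBlock i →
      L.hom (p.coord L) i = p.homCoord L i / p.homCoord L (L.leader i) := fun i hi =>
    L.hom_aff_of_inBlock _ hi (hall _ (L.isBase_leader hi).1)
  funext ⟨i, hi⟩
  by_cases hb : (L.face J).InBlock i
  · have hbl := ((L.face J).isBase_leader hb).1
    have h1 := (hin _).mp hb
    have h2 := (hin _).mp hbl
    have hl := hlead i hb
    rw [hl] at h2
    simp only [coord, Label.blowMap, Label.aff, if_pos hb, hl, if_neg h1.2, if_neg h2.2]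
    rw [hhom i hb, ← hl, hhom _ hbl, hl]
    have e1 := hcL i h1.1
    rw [coord] at e1
    change _ = L.hom (p.coord L) i / L.hom (p.coord L) (L.leader i)
    rw [L.hom_of_isBase _ (L.isBase_leader h1.1), hcL i h1.1, div_one]
  · simp only [coord, Label.blowMap, Label.aff, if_neg hb]
    rw [homCoord_of_not _ p hb]
    by_cases h : i ∈ L.I J
    · rw [if_pos h]
      change _ = z J + (p.t (L.leader i₀) - z J) * L.hom (p.coord L) i
      rw [hcL i ⟨J, h⟩, ← L.leader_eq h hi₀]
      have hJ' : J ∈ insert J S := mem_insert_self J S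
      have hm := p.incid J ⟨L.I J, L.card_eq J hJ'⟩
      rw [Projectivization.submodule_eq, Submodule.mem_span_singleton] at hm
      obtain ⟨a, ha⟩ := hm
      have e1 := congrFun ha ⟨i, h⟩
      have e2 := congrFun ha ⟨_, L.leader_mem h⟩
      simp only [Pi.smul_apply, smul_eq_mul] at e1 e2
      rw [← homCoord_of_mem L p hJ' h] at e1
      rw [← homCoord_of_mem L p hJ' (L.leader_mem h)] at e2
      have h3 := hne _ (L.leader_mem h)
      rw [← e2]
      field_simp
      rw [e1]
      ring
    · rw [if_neg h]
      have hL : ¬ L.InBlock i := fun hc => hb ((hin i).mpr ⟨hc, h⟩)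
      exact (hom_coord_of_not (p := p) hL).symm

/-- The action of `σ⁻¹` on the blow-up, which permutes the coordinates `t_i` and the homogeneous
coordinates of the lines. -/
def permPull (σ : Equiv.Perm (Fin k)) (p : BlowupPoint k m z) : BlowupPoint k m z where
  t i := p.t (σ i)
  line j I := Projectivization.map
    (LinearMap.funLeft ℂ ℂ fun i : I.1 =>
      (⟨σ i, mem_map_of_mem _ i.2⟩ : {l // l ∈ I.1.map σ.toEmbedding}))
    (LinearMap.funLeft_injective_of_surjective ℂ ℂ _ (by
      rintro ⟨l, hl⟩
      obtain ⟨i, hi, rfl⟩ := Finset.mem_map.mp hl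
      exact ⟨⟨i, hi⟩, rfl⟩))
    (p.line j ⟨I.1.map σ.toEmbedding, by rw [card_map, I.2]⟩)
  incid j I := by
    have h := p.incid j ⟨I.1.map σ.toEmbedding, by rw [card_map, I.2]⟩
    rw [Projectivization.submodule_eq, Submodule.mem_span_singleton] at h
    obtain ⟨a, ha⟩ := h
    rw [← (p.line j ⟨I.1.map σ.toEmbedding, _⟩).mk_rep, Projectivization.map_mk,
      Projectivization.submodule_mk, Submodule.mem_span_singleton]
    refine ⟨a, ?_⟩
    funext i
    exact congrFun ha ⟨σ i, mem_map_of_mem _ i.2⟩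

/-- In the affine coordinates the action of `σ⁻¹` is the map `permMap`. -/
theorem coord_permPull (σ : Equiv.Perm (Fin k)) (L : Label k m S) {p : BlowupPoint k m z}
    (hp : p ∈ stratum z L) :
    (p.permPull σ).coord (L.pull σ) = L.permMap σ (p.coord L) := by
  have hmem : ∀ i j, i ∈ (L.pull σ).I j ↔ σ i ∈ L.I j := by
    intro i j
    simp only [Label.pull, Finset.mem_map_equiv, Equiv.symm_symm]
  have hin : ∀ i, (L.pull σ).InBlock i ↔ L.InBlock (σ i) := fun i =>
    exists_congr fun j => hmem i j
  have hscale : ∀ j, j ∈ S → ∃ a : ℂ, a ≠ 0 ∧ ∀ i ∈ (L.pull σ).I j,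
      (p.permPull σ).homCoord (L.pull σ) i = a * p.homCoord L (σ i) := by
    intro j hj
    have e : ((L.pull σ).I j).map σ.toEmbedding = L.I j := by
      ext i
      rw [Finset.mem_map_equiv, hmem, Equiv.apply_symm_apply]
    have gen : ∀ (A B : Finset (Fin k)) (hA : A.card = m j + 1) (hB : B.card = m j + 1)
        (i : Fin k) (iA : i ∈ A) (iB : i ∈ B), A = B →
        (p.line j ⟨A, hA⟩).rep ⟨i, iA⟩ = (p.line j ⟨B, hB⟩).rep ⟨i, iB⟩ := by
      intro A B hA hB i iA iB hAB
      subst hAB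
      rfl
    have hc : (((L.pull σ).I j).map σ.toEmbedding).card = m j + 1 := by rw [e, L.card_eq j hj]
    set f := LinearMap.funLeft ℂ ℂ fun i : {i // i ∈ (L.pull σ).I j} =>
      (⟨σ i, mem_map_of_mem _ i.2⟩ : {l // l ∈ ((L.pull σ).I j).map σ.toEmbedding}) with hf
    have hfinj : Function.Injective f :=
      LinearMap.funLeft_injective_of_surjective ℂ ℂ _ (by
        rintro ⟨l, hl⟩
        obtain ⟨i, hi, rfl⟩ := Finset.mem_map.mp hl
        exact ⟨⟨i, hi⟩, rfl⟩)
    set v := (p.line j ⟨((L.pull σ).I j).map σ.toEmbedding, hc⟩).rep with hv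
    have hv0 : v ≠ 0 := Projectivization.rep_nonzero _
    have hfv : f v ≠ 0 := fun h => hv0 (hfinj (h.trans (map_zero f).symm))
    have hl : (p.permPull σ).line j ⟨(L.pull σ).I j, (L.pull σ).card_eq j hj⟩ =
        Projectivization.mk ℂ (f v) hfv := by
      change Projectivization.map f hfinj (p.line j ⟨((L.pull σ).I j).map σ.toEmbedding, hc⟩) = _
      rw [← (p.line j ⟨((L.pull σ).I j).map σ.toEmbedding, hc⟩).mk_rep, Projectivization.map_mk]
    obtain ⟨a, ha⟩ := Projectivization.exists_smul_eq_mk_rep ℂ _ hfv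
    refine ⟨a, a.ne_zero, fun i hi => ?_⟩
    rw [homCoord_of_mem _ _ hj hi, homCoord_of_mem L p hj ((hmem i j).mp hi), hl, ← ha,
      ← gen _ _ hc (L.card_eq j hj) (σ i) (mem_map_of_mem _ hi) _ e]
    rfl
  funext ⟨i, hi⟩
  by_cases hb : (L.pull σ).InBlock i
  · simp only [coord, Label.permMap, Label.aff, if_pos hb]
    change _ = L.hom (p.coord L) (σ i) / L.hom (p.coord L) (σ ((L.pull σ).leader i))
    obtain ⟨j, hj⟩ := hb
    have hl := (L.pull σ).leader_mem hj
    have hj' := (hmem _ _).mp hj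
    have hl' := (hmem _ _).mp hl
    obtain ⟨a, ha, hs⟩ := hscale j (L.mem_S hj')
    rw [hs _ hj, hs _ hl, hom_coord_of_mem hp ⟨j, hj'⟩, hom_coord_of_mem hp ⟨j, hl'⟩,
      L.leader_eq hl' hj', mul_div_mul_left _ _ ha, div_div_div_cancel_right₀]
    exact homCoord_ne_zero hp ⟨j, L.leader_mem hj'⟩
  · simp only [coord, Label.permMap, Label.aff, if_neg hb]
    rw [homCoord_of_not _ _ hb]
    exact (hom_coord_of_not (p := p) fun h => hb ((hin i).mpr h)).symm

end BlowupPoint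

/-! ## Forms on the orbits of components -/

section Orbit

variable {n k : ℕ} {m : Fin n → ℕ} {S : Finset (Fin n)}

/-- A `d`-form on `⋃_I C_I^S`: a form on every component, written in its chart. -/
abbrev OrbitForm {n : ℕ} (k : ℕ) (m : Fin n → ℕ) (S : Finset (Fin n)) (d : ℕ) : Type :=
  ∀ L : Label k m S, DForm L.Chart d

/-- Skew-symmetrization `∑_σ (-1)^|σ| σ η` over the symmetric group, with
`σ η = (σ⁻¹)^* η`. -/
def skew {d : ℕ} (η : OrbitForm k m S d) : OrbitForm k m S d :=
  fun L => ∑ σ : Equiv.Perm (Fin k),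
    ((Equiv.Perm.sign σ : ℤ) : ℂ) • pullback (L.permMap σ) (η (L.pull σ))

/-- `s = ∑_{j ∈ S} (m_j + 1)`, so that the affine factor of `C_I^S` has dimension `k - s`. -/
def blockSum (m : Fin n → ℕ) (S : Finset (Fin n)) : ℕ := ∑ j ∈ S, (m j + 1)

/-- The standard label `I⁰`: the first `s` indices, cut into consecutive intervals of lengths
`m_j + 1`, `j ∈ S`, in increasing order of `j`. (Indices start at `0`.) -/
def IsStandard (L : Label k m S) : Prop :=
  ∀ j ∈ S, L.I j = univ.filter fun i : Fin k =>
    blockSum m (S.filter (· < j)) ≤ i ∧ (i : ℕ) < blockSum m (S.filter (· < j)) + (m j + 1)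

/-- The factors of `μ_{I_j} = d log u_{i_1} ∧ ⋯ ∧ d log u_{i_{m_j}}`. -/
def muFactors (L : Label k m S) (j : Fin n) : List (L.Chart → ℂ) :=
  (L.I j).sort.tail.map fun i y => L.hom y i

/-- The factors of `η_{K,i} = d log (t_{s+l+1} - z_i) ∧ ⋯ ∧ d log (t_{s+l+k_i} - z_i)`, where
`l = k_1 + ⋯ + k_{i-1}`. (Indices of `t` start at `0` here.) -/
def etaFactors (z : Fin n → ℂ) (K : Fin n → ℕ) (L : Label k m S) (i : Fin n) :
    List (L.Chart → ℂ) :=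
  ((List.finRange k).filter fun a : Fin k =>
    blockSum m S + ∑ l ∈ univ.filter (· < i), K l ≤ a ∧
      (a : ℕ) < blockSum m S + ∑ l ∈ univ.filter (· < i), K l + K i).map
    fun a y => L.hom y a - z i

open Classical in
/-- The form `μ_{I_{j_1}} ∧ ⋯ ∧ μ_{I_{j_p}} ∧ η_{K,1} ∧ ⋯ ∧ η_{K,n}`, `S = {j_1 < ⋯ < j_p}`, on the
component of the standard label, extended by zero to the other components (its component of
degree `d`, which is everything if `d = ∑_{j ∈ S} m_j + |K|`). -/
def baseForm (z : Fin n → ℂ) (S : Finset (Fin n)) (K : Fin n → ℕ) (d : ℕ) : OrbitForm k m S d :=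
  fun L y =>
    if IsStandard L then
      wedgeList ((S.sort.flatMap (muFactors L) ++
        (List.finRange n).flatMap (etaFactors z K L)).map fun f => dlog f y) d
    else 0

/-- The sign exponent `∑_{i=1}^{p-1} (p - i) (m_{j_i} + 1)`, `S = {j_1 < ⋯ < j_p}`. -/
def signExp (m : Fin n → ℕ) (S : Finset (Fin n)) : ℕ :=
  ∑ j ∈ S, (S.filter (j < ·)).card * (m j + 1)

/-- `α_K = (-1)^(sign exponent) / (∏_{j ∈ S} (m_j + 1)! ∏_i k_i!)`. -/
def alpha (m : Fin n → ℕ) (S : Finset (Fin n)) (K : Fin n → ℕ) : ℂ :=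
  (-1) ^ signExp m S *
    ((∏ j ∈ S, ((m j + 1).factorial : ℂ)) * ∏ i, ((K i).factorial : ℂ))⁻¹

/-- The form `ω_K^S`: the skew-symmetrization of the base form times `κ^{-k} α_K` if
`|K| = e`, and times `(-1)^{k-p} κ^{-(k-1)} α_K` if `|K| = e - 1`, where `p = |S|` and
`e = k - ∑_{j ∈ S} (m_j + 1)`. -/
def omega (z : Fin n → ℂ) (κ : ℂ) (S : Finset (Fin n)) (K : Fin n → ℕ) (d : ℕ) :
    OrbitForm k m S d :=
  skew fun L =>
    ((if blockSum m S + ∑ i, K i = k then (κ ^ k)⁻¹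
      else (-1) ^ (k - S.card) * (κ ^ (k - 1))⁻¹) * alpha m S K) • baseForm z S K d L

end Orbit

/-! ## Residues -/

section Residue

variable {n k : ℕ} {m : Fin n → ℕ} {S : Finset (Fin n)}

/-- `ρ` is the residue along the component `C_I^{S ∪ {J}}` of the form `ω` on the component
`C_{face I}^S`: near every point of the divisor, in the coordinates `(r, y)` in which the divisor
is `r = 0`, one has `ω = (dr / r) ∧ β + γ` off the divisor, with `β` and `γ` holomorphic, and
`ρ` is the restriction of `β` to the divisor. -/
def HasResidue (z : Fin n → ℂ) (J : Fin n) (L : Label k m (insert J S)) {d : ℕ}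
    (ω : DForm (L.face J).Chart (d + 1)) (ρ : DForm L.Chart d) : Prop :=
  ∀ q ∈ BlowupPoint.stratum z L,
    ∃ (β : DForm (ℂ × L.Chart) d) (γ : DForm (ℂ × L.Chart) (d + 1)),
      AnalyticAt ℂ β (0, q.coord L) ∧ AnalyticAt ℂ γ (0, q.coord L) ∧
      (∀ᶠ w in 𝓝 ((0 : ℂ), q.coord L), w.1 ≠ 0 →
        pullback (L.blowMap z J) ω w =
          w.1⁻¹ • wedgeOne (ContinuousLinearMap.fst ℂ ℂ L.Chart) (β w) + γ w) ∧
      ρ (q.coord L) = pullback (fun y : L.Chart => ((0 : ℂ), y)) β (q.coord L)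

/-- The form `ρ` on `⋃_I C_I^{S ∪ {J}}` is the residue of the form `ω` on `⋃_I C_I^S`. -/
def HasOrbitResidue (z : Fin n → ℂ) (J : Fin n) {d : ℕ}
    (ω : OrbitForm k m S (d + 1)) (ρ : OrbitForm k m (insert J S) d) : Prop :=
  ∀ L : Label k m (insert J S), HasResidue z J L (ω (L.face J)) (ρ L)

end Residue

end SkewRes

end

/-! The special role of the smallest index of each block is removed by adding formal directions. For
each block j let e_j be a new covector, and let x_i be the homogeneous coordinates. Contracting the
product of all e_j + d log x_i, i ∈ I_j, with the direction dual to e_j leaves the product of the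
differences d log x_i - d log x_{i_0}, which is μ_{I_j}. If |K| = e - 1, one position is left over,
and it receives a formal covector of its own. Each term of the skew-symmetrization thus becomes a
product of exactly k rows, one for each position, and ω is obtained by contracting ∑_σ (-1)^|σ| ⋀_a
R(f a)(σ a) with the formal columns, where f a is the kind of the position a. Such a sum
(`skewWedge`) depends only on the number of positions of each kind (`skewWedge_eq_of_card_fiber`).
Contracting the blocks from the last to the first produces the sign (-1)^{d_𝐣}, which the sign in α
cancels (`evalCols_ιMulti_slots`, `skew_baseForm_apply`).

Near the new divisor t_i - z_J = r u_i for i ∈ I_J, so d log (t_i - z_J) = dr/r + d log u_i. With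
dr/r in the role of e_J, taking the residue is contraction with the column of J, and the row of a
factor with pole z_J is the sum of the corresponding factor row and block row of the next stratum.
All other rows restrict to those of the next stratum; in particular t_i - z_l with i ∈ I_J, l ≠ J
becomes constant (`exists_residue_term`, `exists_residue_skew`).

Multilinear expansion gives a sum over the sets A of J-factors that are turned into block positions
(`evalCols_skewWedge_split`). A nonzero product needs σ(A) ⊆ I_J, and the elements of I_J outside
σ(A) can only sit at the left-over position. So |A| is m_J + 1 or m_J, and the second case cancels
in pairs: the left-over element of I_J may be exchanged with the one evaluated in the column of J
(`evalCols_skewWedge_eq_zero`). Nothing survives if k_J < m_J + 1. Otherwise there are binom(k_J,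
m_J + 1) equal terms, and this binomial coefficient is the ratio of the α's up to their signs
(`signed_alpha_update`). Moving the column of J to its place among the blocks costs (-1)^q
(`evalCols_residueRow`). The additional sign for |K| = e - 1 comes from (-1)^{k-p}, whose exponent
drops by one when p grows by one. -/

namespace SkewRes

noncomputable section

/-! ### Exterior products of rows, evaluated by contraction with columns. -/

section EvalCols

variable {ι κ : Type*}

/-- Evaluation of an element of the exterior algebra of `ι → ℂ` at a list of coordinates: the
element is contracted with the coordinate functionals one after the other. -/
def evalCols : List ι → (ExteriorAlgebra ℂ (ι → ℂ) →ₗ[ℂ] ℂ)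
  | [] => ExteriorAlgebra.algebraMapInv.toLinearMap
  | e :: w => (evalCols w).comp (CliffordAlgebra.contractLeft (LinearMap.proj e))

/-- The exterior product of a list of rows. -/
def wedgeRows (l : List (ι → ℂ)) : ExteriorAlgebra ℂ (ι → ℂ) :=
  (l.map (ExteriorAlgebra.ι ℂ)).prod

/-- Contraction with the coordinate `e`. -/
abbrev contr (e : ι) : ExteriorAlgebra ℂ (ι → ℂ) →ₗ[ℂ] ExteriorAlgebra ℂ (ι → ℂ) :=
  CliffordAlgebra.contractLeft (Q := (0 : QuadraticForm ℂ (ι → ℂ))) (LinearMap.proj e)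

lemma contr_ι_mul (e : ι) (a : ι → ℂ) (x : ExteriorAlgebra ℂ (ι → ℂ)) :
    contr e (ExteriorAlgebra.ι ℂ a * x) = a e • x - ExteriorAlgebra.ι ℂ a * contr e x :=
  CliffordAlgebra.contractLeft_ι_mul _ a x

lemma contr_one (e : ι) : contr e 1 = 0 := CliffordAlgebra.contractLeft_one _ _

@[simp] lemma evalCols_cons (e : ι) (w : List ι) (x : ExteriorAlgebra ℂ (ι → ℂ)) :
    evalCols (e :: w) x = evalCols w (contr e x) := rfl

@[simp] lemma evalCols_nil (x : ExteriorAlgebra ℂ (ι → ℂ)) :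
    evalCols [] x = ExteriorAlgebra.algebraMapInv x := rfl

@[simp] lemma wedgeRows_nil : wedgeRows ([] : List (ι → ℂ)) = 1 := rfl

@[simp] lemma wedgeRows_cons (a : ι → ℂ) (l : List (ι → ℂ)) :
    wedgeRows (a :: l) = ExteriorAlgebra.ι ℂ a * wedgeRows l := by
  simp [wedgeRows]

@[simp] lemma wedgeRows_append (l l' : List (ι → ℂ)) :
    wedgeRows (l ++ l') = wedgeRows l * wedgeRows l' := by
  simp [wedgeRows]

lemma evalCols_one_cons (e : ι) (w : List ι) : evalCols (e :: w) 1 = 0 := by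
  rw [evalCols_cons, contr_one, map_zero]

lemma evalCols_nil_ι_mul (a : ι → ℂ) (x : ExteriorAlgebra ℂ (ι → ℂ)) :
    evalCols [] (ExteriorAlgebra.ι ℂ a * x) = 0 := by
  simp [ExteriorAlgebra.algebraMapInv]

/-- Expansion along the first row. -/
lemma evalCols_ofFn_ι_mul (a : ι → ℂ) : ∀ {d : ℕ} (w : Fin (d + 1) → ι)
    (x : ExteriorAlgebra ℂ (ι → ℂ)),
    evalCols (List.ofFn w) (ExteriorAlgebra.ι ℂ a * x) =
      ∑ i : Fin (d + 1), (-1 : ℂ) ^ (i : ℕ) * a (w i) * evalCols (List.ofFn fun j => w (i.succAbove j)) x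
  | 0, w, x => by
    rw [List.ofFn_succ, List.ofFn_zero, evalCols_cons, contr_ι_mul, map_sub, map_smul,
      evalCols_nil_ι_mul]
    simp
  | d + 1, w, x => by
    rw [List.ofFn_succ, evalCols_cons, contr_ι_mul, map_sub, map_smul,
      evalCols_ofFn_ι_mul a (fun i => w i.succ) (contr (w 0) x), sub_eq_add_neg,
      ← Finset.sum_neg_distrib]
    refine Eq.trans ?_ (Fin.sum_univ_succ _).symm
    congr 1
    · simp
    · refine Finset.sum_congr rfl fun i _ => ?_
      rw [List.ofFn_succ (f := fun j => w (i.succ.succAbove j)), evalCols_cons]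
      simp only [Fin.succ_succAbove_zero, Fin.succ_succAbove_succ, Fin.val_succ, pow_succ]
      ring

lemma wedgeOne_apply {E : Type*} [NormedAddCommGroup E] [NormedSpace ℂ E] {d : ℕ}
    (a : E →L[ℂ] ℂ) (b : E [⋀^Fin d]→L[ℂ] ℂ) (v : Fin (d + 1) → E) :
    wedgeOne a b v = ∑ i : Fin (d + 1), (-1 : ℂ) ^ (i : ℕ) * a (v i) * b (fun j => v (i.succAbove j)) := by
  rw [wedgeOne, ContinuousAlternatingMap.alternatizeUncurryFin_apply]
  refine Finset.sum_congr rfl fun i _ => ?_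
  simp only [ContinuousLinearMap.smulRight_apply, ContinuousAlternatingMap.smul_apply,
    smul_eq_mul, zsmul_eq_mul, Int.cast_pow, Int.cast_neg, Int.cast_one, mul_assoc]
  rfl

lemma wedgeOne_apply_eq {E : Type*} [NormedAddCommGroup E] [NormedSpace ℂ E] {d : ℕ}
    (a : E →L[ℂ] ℂ) (b : E [⋀^Fin d]→L[ℂ] ℂ) (x : ExteriorAlgebra ℂ (E → ℂ))
    (hb : ∀ v, b v = evalCols (List.ofFn v) x) (v : Fin (d + 1) → E) :
    wedgeOne a b v = evalCols (List.ofFn v) (ExteriorAlgebra.ι ℂ (a : E → ℂ) * x) := by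
  rw [wedgeOne_apply, evalCols_ofFn_ι_mul]
  exact Finset.sum_congr rfl fun i _ => by rw [hb]

/-- Covectors are treated as arbitrary functions on `E`, and the vectors of `E` serve as the
columns. Forgetting linearity lets formal columns be added later as a direct summand of the index
type. -/
lemma wedgeList_apply {E : Type*} [NormedAddCommGroup E] [NormedSpace ℂ E] :
    ∀ (l : List (E →L[ℂ] ℂ)) (d : ℕ) (v : Fin d → E),
    wedgeList l d v = evalCols (List.ofFn v) (wedgeRows (l.map fun a : E →L[ℂ] ℂ => (a : E → ℂ)))
  | [], 0, v => by simp [wedgeList]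
  | [], d + 1, v => by
    rw [List.ofFn_succ, List.map_nil, wedgeRows_nil, evalCols_one_cons]
    rfl
  | a :: l, 0, v => by
    rw [List.ofFn_zero, List.map_cons, wedgeRows_cons, evalCols_nil_ι_mul]
    rfl
  | a :: l, d + 1, v => by
    rw [List.map_cons, wedgeRows_cons]
    exact wedgeOne_apply_eq a _ _ (wedgeList_apply l d) v

/-- Contraction is natural. -/
lemma contr_map (g : ι → κ) (e : ι) (x : ExteriorAlgebra ℂ (κ → ℂ)) :
    contr e (ExteriorAlgebra.map (LinearMap.funLeft ℂ ℂ g) x) =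
      ExteriorAlgebra.map (LinearMap.funLeft ℂ ℂ g) (contr (g e) x) := by
  induction x using CliffordAlgebra.left_induction with
  | algebraMap r =>
    rw [AlgHom.commutes]
    exact (CliffordAlgebra.contractLeft_algebraMap _ _ r).trans
      (by erw [CliffordAlgebra.contractLeft_algebraMap _ _ r]; rw [map_zero])
  | add x y hx hy => simp only [map_add, hx, hy]
  | ι_mul x m hx =>
    change contr e (ExteriorAlgebra.map _ (ExteriorAlgebra.ι ℂ m * x)) =
      ExteriorAlgebra.map _ (contr (g e) (ExteriorAlgebra.ι ℂ m * x))
    rw [map_mul, ExteriorAlgebra.map_apply_ι, contr_ι_mul, contr_ι_mul, hx, map_sub, map_mul,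
      ExteriorAlgebra.map_apply_ι, map_smul]
    rfl

/-- It serves both for composing forms with linear maps and for discarding the formal columns once
they have been contracted, with `g` the inclusion of the vectors among all columns. -/
lemma evalCols_map (g : ι → κ) : ∀ (w : List ι) (x : ExteriorAlgebra ℂ (κ → ℂ)),
    evalCols w (ExteriorAlgebra.map (LinearMap.funLeft ℂ ℂ g) x) = evalCols (w.map g) x
  | [], x => by
    have : (ExteriorAlgebra.algebraMapInv (R := ℂ)).comp
        (ExteriorAlgebra.map (LinearMap.funLeft ℂ ℂ g)) = ExteriorAlgebra.algebraMapInv := by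
      ext m
      simp [ExteriorAlgebra.algebraMapInv]
    exact DFunLike.congr_fun this x
  | e :: w, x => by
    rw [evalCols_cons, contr_map, evalCols_map g w, List.map_cons, evalCols_cons]

lemma map_wedgeRows (g : ι → κ) (l : List (κ → ℂ)) :
    ExteriorAlgebra.map (LinearMap.funLeft ℂ ℂ g) (wedgeRows l) =
      wedgeRows (l.map fun a => a ∘ g) := by
  induction l with
  | nil => simp
  | cons a l ih =>
    rw [wedgeRows_cons, map_mul, ih, ExteriorAlgebra.map_apply_ι, List.map_cons, wedgeRows_cons]
    rfl

lemma evalCols_wedgeRows_comp (g : ι → κ) (w : List ι) (l : List (κ → ℂ)) :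
    evalCols w (wedgeRows (l.map fun a => a ∘ g)) = evalCols (w.map g) (wedgeRows l) := by
  rw [← map_wedgeRows, evalCols_map]

lemma wedgeRows_ofFn {d : ℕ} (r : Fin d → ι → ℂ) :
    wedgeRows (List.ofFn r) = ExteriorAlgebra.ιMulti ℂ d r := by
  rw [ExteriorAlgebra.ιMulti_apply, wedgeRows, List.map_ofFn]
  rfl

/-- Contraction and the Laplace expansion along the first row obey the same recursion. The Leibniz
formula for this determinant makes the pairwise cancellation below possible. -/
lemma evalCols_ofFn_wedgeRows_ofFn : ∀ {d : ℕ} (r : Fin d → ι → ℂ) (w : Fin d → ι),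
    evalCols (List.ofFn w) (wedgeRows (List.ofFn r)) = (Matrix.of fun a b => r a (w b)).det
  | 0, r, w => by simp
  | d + 1, r, w => by
    rw [List.ofFn_succ (f := r), wedgeRows_cons, evalCols_ofFn_ι_mul, Matrix.det_succ_row_zero]
    refine Finset.sum_congr rfl fun i _ => ?_
    rw [evalCols_ofFn_wedgeRows_ofFn]
    rfl

lemma evalCols_wedgeRows_of_length_ne : ∀ (l : List (ι → ℂ)) (w : List ι), l.length ≠ w.length →
    evalCols w (wedgeRows l) = 0
  | [], [], h => absurd rfl h
  | [], e :: w, _ => evalCols_one_cons e w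
  | a :: l, [], _ => by rw [wedgeRows_cons, evalCols_nil_ι_mul]
  | a :: l, e :: w, h => by
    obtain ⟨d, u, hu⟩ : ∃ (d : ℕ) (u : Fin (d + 1) → ι), e :: w = List.ofFn u :=
      ⟨w.length, (e :: w).get, (List.ofFn_get _).symm⟩
    rw [hu, wedgeRows_cons, evalCols_ofFn_ι_mul]
    refine Finset.sum_eq_zero fun i _ => ?_
    rw [evalCols_wedgeRows_of_length_ne l, mul_zero]
    rw [hu] at h
    simpa using h

/-- Rows vanishing at `e` are passed by the contraction with `e`. -/
lemma contr_wedgeRows_mul (e : ι) (l : List (ι → ℂ)) (hl : ∀ a ∈ l, a e = 0)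
    (x : ExteriorAlgebra ℂ (ι → ℂ)) :
    contr e (wedgeRows l * x) = (-1 : ℂ) ^ l.length • (wedgeRows l * contr e x) := by
  induction l with
  | nil => simp
  | cons a l ih =>
    rw [wedgeRows_cons, mul_assoc, contr_ι_mul, hl a (by simp), zero_smul, zero_sub,
      ih fun b hb => hl b (List.mem_cons_of_mem _ hb), List.length_cons, pow_succ]
    simp [mul_assoc]

lemma contr_wedgeRows (e : ι) (l : List (ι → ℂ)) (hl : ∀ a ∈ l, a e = 0) :
    contr e (wedgeRows l) = 0 := by
  have := contr_wedgeRows_mul e l hl 1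
  rwa [mul_one, contr_one, mul_zero, smul_zero] at this

/-- Each correction term contains `a` twice and vanishes, since ι(a)² = 0. -/
lemma ι_mul_wedgeRows_sub (a : ι → ℂ) (B : List (ι → ℂ)) :
    ExteriorAlgebra.ι ℂ a * wedgeRows (B.map (· - a)) = ExteriorAlgebra.ι ℂ a * wedgeRows B := by
  induction B with
  | nil => simp
  | cons b B ih =>
    have h : ∀ x : ExteriorAlgebra ℂ (ι → ℂ), ExteriorAlgebra.ι ℂ a *
        (ExteriorAlgebra.ι ℂ b * x) = - (ExteriorAlgebra.ι ℂ b * (ExteriorAlgebra.ι ℂ a * x)) := by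
      intro x
      rw [← mul_assoc, ← mul_assoc, eq_neg_of_add_eq_zero_left
        (ExteriorAlgebra.ι_add_mul_swap (R := ℂ) a b), neg_mul]
    have h0 : ∀ x : ExteriorAlgebra ℂ (ι → ℂ), ExteriorAlgebra.ι ℂ a *
        (ExteriorAlgebra.ι ℂ a * x) = 0 := by
      intro x
      rw [← mul_assoc, ExteriorAlgebra.ι_sq_zero, zero_mul]
    rw [List.map_cons, wedgeRows_cons, wedgeRows_cons, map_sub, sub_mul, mul_sub, h0, sub_zero, h,
      ih, ← h]

/-- Contraction of a block of rows with value `1` at `e`. -/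
lemma contr_wedgeRows_block (e : ι) (pre B rest : List (ι → ℂ)) (a : ι → ℂ)
    (hpre : ∀ b ∈ pre, b e = 0) (hrest : ∀ b ∈ rest, b e = 0) (ha : a e = 1)
    (hB : ∀ b ∈ B, b e = 1) :
    contr e (wedgeRows (pre ++ (a :: B) ++ rest)) =
      (-1 : ℂ) ^ pre.length • wedgeRows (pre ++ B.map (· - a) ++ rest) := by
  have hB' : ∀ b ∈ B.map (· - a) ++ rest, b e = 0 := by
    intro b hb
    rcases List.mem_append.mp hb with hb | hb
    · obtain ⟨c, hc, rfl⟩ := List.mem_map.mp hb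
      simp [hB c hc, ha]
    · exact hrest b hb
  rw [wedgeRows_append, wedgeRows_append, mul_assoc, contr_wedgeRows_mul e pre hpre,
    wedgeRows_cons, ← ι_mul_wedgeRows_sub, mul_assoc, ← wedgeRows_append, contr_ι_mul, ha,
    one_smul, contr_wedgeRows e _ hB', mul_zero, sub_zero, List.append_assoc,
    wedgeRows_append pre]

/-- The rows of a block, reduced by subtraction of the first one. -/
def reduceBlock : List (ι → ℂ) → List (ι → ℂ)
  | [] => []
  | a :: B => B.map (· - a)

/-- The exponent `∑_i |B_i| · #{l > i}` for a list of blocks. -/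
def blockSign {α : Type*} (B : α → List (ι → ℂ)) : List α → ℕ
  | [] => 0
  | j :: js => (B j).length * js.length + blockSign B js

/-- The reversed list contracts the last block first, while all earlier blocks still have their full
length. The contraction of a block therefore passes `pre` and all the unreduced blocks before it,
which gives the exponent. The rows `pre` are there for the induction: the head block joins them
while the tail is contracted. -/
lemma evalCols_blocks {α : Type*} (B : α → List (ι → ℂ)) (e : α → ι) (rest : List (ι → ℂ))
    (w : List ι) : ∀ (js : List α) (pre : List (ι → ℂ)), js.Nodup →
    (∀ j ∈ js, B j ≠ []) → (∀ j ∈ js, ∀ b ∈ B j, b (e j) = 1) →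
    (∀ j ∈ js, ∀ i ∈ js, i ≠ j → ∀ b ∈ B i, b (e j) = 0) → (∀ j ∈ js, ∀ b ∈ rest, b (e j) = 0) →
    (∀ j ∈ js, ∀ b ∈ pre, b (e j) = 0) →
    evalCols (js.reverse.map e ++ w) (wedgeRows (pre ++ js.flatMap B ++ rest)) =
      (-1 : ℂ) ^ (pre.length * js.length + blockSign B js) *
        evalCols w (wedgeRows (pre ++ js.flatMap (fun j => reduceBlock (B j)) ++ rest))
  | [], pre, _, _, _, _, _, _ => by simp [blockSign]
  | j :: js, pre, hnd, hne, h1, h0, hr, hp => by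
    obtain ⟨hj, hnd'⟩ := List.nodup_cons.mp hnd
    have e1 : (j :: js).reverse.map e ++ w = js.reverse.map e ++ (e j :: w) := by simp
    have e2 : pre ++ (j :: js).flatMap B ++ rest = (pre ++ B j) ++ js.flatMap B ++ rest := by simp
    obtain ⟨a, C, haC⟩ := List.exists_cons_of_ne_nil (hne j (by simp))
    rw [e1, e2, evalCols_blocks B e rest (e j :: w) js (pre ++ B j) hnd'
      (fun i hi => hne i (List.mem_cons_of_mem _ hi))
      (fun i hi => h1 i (List.mem_cons_of_mem _ hi))
      (fun i hi l hl => h0 i (List.mem_cons_of_mem _ hi) l (List.mem_cons_of_mem _ hl))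
      (fun i hi => hr i (List.mem_cons_of_mem _ hi)) ?_, evalCols_cons]
    · have e3 : pre ++ B j ++ js.flatMap (fun j => reduceBlock (B j)) ++ rest =
          pre ++ (a :: C) ++ (js.flatMap (fun j => reduceBlock (B j)) ++ rest) := by simp [haC]
      have hz : ∀ i ∈ js, ∀ b ∈ reduceBlock (B i), b (e j) = 0 := by
        intro i hi b hb
        have hij : i ≠ j := fun h => hj (h ▸ hi)
        obtain ⟨a', C', h'⟩ := List.exists_cons_of_ne_nil (hne i (List.mem_cons_of_mem _ hi))
        have := h0 j (by simp) i (List.mem_cons_of_mem _ hi) hij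
        rw [h'] at hb this
        obtain ⟨c, hc, rfl⟩ := List.mem_map.mp hb
        simp [this c (List.mem_cons_of_mem _ hc), this a' (by simp)]
      rw [e3, contr_wedgeRows_block (e j) pre C _ a (hp j (by simp)), map_smul, smul_eq_mul,
        ← mul_assoc, ← pow_add]
      · congr 2
        · simp only [List.length_append, List.length_cons, blockSign]
          ring
        · simp [haC, reduceBlock]
      · intro b hb
        rcases List.mem_append.mp hb with hb | hb
        · obtain ⟨i, hi, hb⟩ := List.mem_flatMap.mp hb
          exact hz i hi b hb
        · exact hr j (by simp) b hb
      · exact h1 j (by simp) a (by simp [haC])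
      · exact fun b hb => h1 j (by simp) b (by simp [haC, hb])
    · intro i hi b hb
      rcases List.mem_append.mp hb with hb | hb
      · exact hp i (List.mem_cons_of_mem _ hi) b hb
      · exact h0 i (List.mem_cons_of_mem _ hi) j (by simp) (fun h => hj (h ▸ hi)) b hb

/-- Moving a column to the left past a list of columns. -/
lemma evalCols_move (w₁ w₂ w₃ : List ι) (e : ι) (x : ExteriorAlgebra ℂ (ι → ℂ)) :
    evalCols (w₁ ++ e :: (w₂ ++ w₃)) x =
      (-1 : ℂ) ^ w₂.length * evalCols (w₁ ++ (w₂ ++ e :: w₃)) x := by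
  induction w₁ generalizing x with
  | cons a w ih => exact ih (contr a x)
  | nil =>
    induction w₂ generalizing x with
    | nil => simp
    | cons a w ih =>
      have h := ih (contr a x)
      simp only [List.nil_append, List.cons_append, evalCols_cons] at h ⊢
      rw [CliffordAlgebra.contractLeft_comm, map_neg, h, List.length_cons, pow_succ]
      ring

end EvalCols

/-! ### Skew-symmetrized products whose rows depend on the kind of the position. -/

section SkewWedge

/-- The kinds of positions in a product of blocks and of logarithmic factors. -/
inductive SlotKind (n : ℕ) : Type
  | block (j : Fin n)
  | factor (l : Fin n)
  | unused
  deriving DecidableEq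

lemma exists_perm_of_card_fiber {α β : Type*} [Fintype α] [DecidableEq β] (f g : α → β)
    (h : ∀ b, (univ.filter fun a => f a = b).card = (univ.filter fun a => g a = b).card) :
    ∃ π : Equiv.Perm α, g ∘ π = f := by
  have e : ∀ b, Nonempty ({a // f a = b} ≃ {a // g a = b}) := fun b =>
    ⟨Fintype.equivOfCardEq (by rw [Fintype.card_subtype, Fintype.card_subtype, h b])⟩
  refine ⟨(Equiv.sigmaFiberEquiv f).symm.trans
    ((Equiv.sigmaCongrRight fun b => (e b).some).trans (Equiv.sigmaFiberEquiv g)), ?_⟩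
  funext a
  exact ((e (f a)).some ⟨a, rfl⟩).2

variable {ι T : Type*} {k : ℕ}

/-- The skew-symmetrized exterior product `∑_σ (-1)^|σ| ⋀_a R (f a) (σ a)`. -/
def skewWedge (R : T → Fin k → ι → ℂ) (f : Fin k → T) : ExteriorAlgebra ℂ (ι → ℂ) :=
  ∑ σ : Equiv.Perm (Fin k), ((Equiv.Perm.sign σ : ℤ) : ℂ) •
    ExteriorAlgebra.ιMulti ℂ k fun a => R (f a) (σ a)

/-- Reindexing the sum by σ ↦ σπ multiplies the coefficient by the sign of π, and permuting the
factors of the exterior product multiplies by the same sign. -/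
lemma skewWedge_comp_perm (R : T → Fin k → ι → ℂ) (f : Fin k → T) (π : Equiv.Perm (Fin k)) :
    skewWedge R (f ∘ π) = skewWedge R f := by
  rw [skewWedge, skewWedge, ← Equiv.sum_comp (Equiv.mulRight π)]
  refine Finset.sum_congr rfl fun σ _ => ?_
  have h := (ExteriorAlgebra.ιMulti ℂ k).map_perm (fun a => R (f a) (σ a)) π
  simp only [Equiv.coe_mulRight, Equiv.Perm.coe_mul, Function.comp_def, map_mul, Units.val_mul,
    Int.cast_mul] at h ⊢
  rw [h, Units.smul_def, ← Int.cast_smul_eq_zsmul ℂ, smul_smul, mul_assoc, ← Int.cast_mul,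
    ← Units.val_mul, Int.units_mul_self, Units.val_one, Int.cast_one, mul_one]

lemma skewWedge_eq_of_card_fiber [DecidableEq T] (R : T → Fin k → ι → ℂ) (f g : Fin k → T)
    (h : ∀ b, (univ.filter fun a => f a = b).card = (univ.filter fun a => g a = b).card) :
    skewWedge R f = skewWedge R g := by
  obtain ⟨π, rfl⟩ := exists_perm_of_card_fiber f g h
  exact skewWedge_comp_perm R g π

lemma skewWedge_eq_zero (R : T → Fin k → ι → ℂ) (f : Fin k → T)
    (h : ∀ σ : Equiv.Perm (Fin k), ∃ a, R (f a) (σ a) = 0) : skewWedge R f = 0 := by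
  refine Finset.sum_eq_zero fun σ _ => ?_
  obtain ⟨a, ha⟩ := h σ
  rw [(ExteriorAlgebra.ιMulti ℂ k).map_coord_zero a ha, smul_zero]

/-- Replacing the kind of the slots in `A` by `t`. -/
def replaceOn (f : Fin k → T) (A : Finset (Fin k)) (t : T) : Fin k → T :=
  fun a => if a ∈ A then t else f a

/-- Multilinearity: each position of the kind `s` chooses one of the two summands of its row, and
`A` is the set of those that choose `t`. -/
lemma skewWedge_split [DecidableEq T] (R R' : T → Fin k → ι → ℂ) (f : Fin k → T) (s t : T)
    (hs : ∀ i, R' s i = R s i + R t i) (hR : ∀ u, u ≠ s → R' u = R u) :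
    skewWedge R' f =
      ∑ A ∈ (univ.filter fun a => f a = s).powerset, skewWedge R (replaceOn f A t) := by
  simp only [skewWedge]
  rw [Finset.sum_comm]
  refine Finset.sum_congr rfl fun σ _ => ?_
  rw [← Finset.smul_sum]
  congr 1
  have h : (fun a => R' (f a) (σ a)) =
      (fun a => if f a = s then R t (σ a) else 0) + fun a => R (f a) (σ a) := by
    funext a
    by_cases ha : f a = s
    · simp only [ha, hs, if_pos, Pi.add_apply]
      exact add_comm _ _
    · simp only [hR _ ha, if_neg ha, Pi.add_apply, zero_add]
  have h2 := (ExteriorAlgebra.ιMulti ℂ k (M := ι → ℂ)).toMultilinearMap.map_add_univ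
    (fun a => if f a = s then R t (σ a) else 0) (fun a => R (f a) (σ a))
  simp only [AlternatingMap.coe_multilinearMap] at h2
  rw [h, h2]
  symm
  -- The general expansion runs over all subsets; one that contains a position not of the kind `s`
  -- has a zero row there.
  rw [← Finset.sum_subset (Finset.subset_univ (univ.filter fun a => f a = s).powerset)]
  · refine Finset.sum_congr rfl fun A hA => ?_
    congr 1
    funext a
    by_cases ha : a ∈ A
    · have := (Finset.mem_filter.mp (Finset.mem_powerset.mp hA ha)).2
      simp [ha, replaceOn, this]
    · simp [ha, replaceOn]
  · intro A _ hA
    rw [Finset.mem_powerset, Finset.subset_iff] at hA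
    push Not at hA
    obtain ⟨a, ha, ha'⟩ := hA
    refine (ExteriorAlgebra.ιMulti ℂ k).map_coord_zero a ?_
    simp only [Finset.mem_filter, mem_univ, true_and] at ha'
    simp [ha, ha']



/-- If an unused slot occurs together with a contraction which does not distinguish the elements
of a block, then the skew-symmetrization vanishes. -/
lemma evalCols_skewWedge_eq_zero [DecidableEq T] (R : T → Fin k → ι → ℂ) (f : Fin k → T)
    (s t : T) (D : Finset (Fin k)) (cs ct : ι)
    (hs : ∀ i, R s i cs = 1) (hs' : ∀ u, u ≠ s → ∀ i, R u i cs = 0)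
    (ht : ∀ i ∈ D, R t i ct = 1) (ht0 : ∀ i, i ∉ D → R t i = 0)
    (ht' : ∀ u, u ≠ t → ∀ i, R u i ct = 0)
    (hD : ∀ σ : Equiv.Perm (Fin k), (∀ a, R (f a) (σ a) ≠ 0) → ∀ a, f a = s → σ a ∈ D)
    (w : List ι) (hw : ct ∈ w) : evalCols (cs :: w) (skewWedge R f) = 0 := by
  -- With a number of columns different from the number `k` of rows, every evaluation vanishes.
  by_cases hlen : (cs :: w).length = k
  swap
  · rw [skewWedge, map_sum]
    refine Finset.sum_eq_zero fun σ _ => ?_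
    rw [map_smul, ← wedgeRows_ofFn, evalCols_wedgeRows_of_length_ne _ _ (by simpa using Ne.symm hlen),
      smul_zero]
  obtain ⟨u, hu, b₀, b₁, hb, hu₀, hu₁⟩ : ∃ u : Fin k → ι, cs :: w = List.ofFn u ∧
      ∃ b₀ b₁ : Fin k, b₀ ≠ b₁ ∧ u b₀ = cs ∧ u b₁ = ct := by
    subst hlen
    obtain ⟨b, hb⟩ := List.mem_iff_get.mp hw
    refine ⟨(cs :: w).get, (List.ofFn_get _).symm, ⟨0, by simp⟩, b.succ, ?_, rfl, ?_⟩
    · exact (Fin.succ_ne_zero b).symm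
    · simpa using hb
  rw [hu, skewWedge, map_sum]
  have hdet : ∀ σ : Equiv.Perm (Fin k), evalCols (List.ofFn u)
      (((Equiv.Perm.sign σ : ℤ) : ℂ) • ExteriorAlgebra.ιMulti ℂ k fun a => R (f a) (σ a)) =
      ∑ τ : Equiv.Perm (Fin k), ((Equiv.Perm.sign σ : ℤ) : ℂ) * (((Equiv.Perm.sign τ : ℤ) : ℂ) *
        ∏ b, R (f (τ b)) (σ (τ b)) (u b)) := by
    intro σ
    rw [map_smul, ← wedgeRows_ofFn, evalCols_ofFn_wedgeRows_ofFn, Matrix.det_apply', smul_eq_mul,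
      Finset.mul_sum]
    rfl
  simp only [hdet]
  -- The assignment τ of positions to columns is fixed, and the cancellation takes place in the sum
  -- over σ.
  rw [Finset.sum_comm]
  refine Finset.sum_eq_zero fun τ _ => ?_
  -- In a nonzero product the columns `cs` and `ct` are served by positions of the kinds `s` and
  -- `t`, both sent into `D`. Both entries equal 1 for every index in `D`, so exchanging the two
  -- indices changes nothing but the sign of σ.
  have key : ∀ σ : Equiv.Perm (Fin k), (∏ b, R (f (τ b)) (σ (τ b)) (u b)) ≠ 0 →
      ∏ b, R (f (τ b)) ((σ * Equiv.swap (τ b₀) (τ b₁)) (τ b)) (u b) =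
        ∏ b, R (f (τ b)) (σ (τ b)) (u b) := by
    intro σ hσ
    have hne := fun b => (Finset.prod_ne_zero_iff.mp hσ) b (mem_univ b)
    have e0 : f (τ b₀) = s := by
      by_contra h
      exact hne b₀ (by rw [hu₀]; exact hs' _ h _)
    have e1 : f (τ b₁) = t := by
      by_contra h
      exact hne b₁ (by rw [hu₁]; exact ht' _ h _)
    have d0 : σ (τ b₀) ∈ D := by
      refine hD σ (fun a h => hne (τ.symm a) ?_) _ e0
      rw [Equiv.apply_symm_apply, h]
      rfl
    have d1 : σ (τ b₁) ∈ D := by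
      by_contra h
      exact hne b₁ (by rw [e1, ht0 _ h]; rfl)
    refine Finset.prod_congr rfl fun b _ => ?_
    by_cases h0 : b = b₀
    · subst h0
      rw [hu₀, e0, hs, hs]
    by_cases h1 : b = b₁
    · subst h1
      rw [hu₁, e1, ht _ d1, Equiv.Perm.mul_apply, Equiv.swap_apply_right, ht _ d0]
    · rw [Equiv.Perm.mul_apply, Equiv.swap_apply_of_ne_of_ne (fun h => h0 (τ.injective h))
        (fun h => h1 (τ.injective h))]
  have hne' : τ b₀ ≠ τ b₁ := fun h => hb (τ.injective h)
  refine Finset.sum_involution (fun σ _ => σ * Equiv.swap (τ b₀) (τ b₁)) ?_ ?_ ?_ ?_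
  · intro σ _
    have hP : ∏ b, R (f (τ b)) ((σ * Equiv.swap (τ b₀) (τ b₁)) (τ b)) (u b) =
        ∏ b, R (f (τ b)) (σ (τ b)) (u b) := by
      -- If the product for σ is zero, so is the one for its partner: otherwise `key` applied to the
      -- partner would lead back to σ.
      by_cases hσ : (∏ b, R (f (τ b)) (σ (τ b)) (u b)) = 0
      · by_contra h
        have := key (σ * Equiv.swap (τ b₀) (τ b₁)) (by rwa [hσ] at h)
        rw [mul_assoc, Equiv.swap_mul_self, mul_one] at this
        exact h this.symm
      · exact key σ hσ
    rw [hP, Equiv.Perm.sign_mul, Equiv.Perm.sign_swap hne']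
    simp
  · intro σ _ _ h
    exact hne' (Equiv.swap_eq_one_iff.mp (mul_eq_left.mp h))
  · intro σ _
    exact mem_univ _
  · intro σ _
    simp [mul_assoc]

/-- The main identity: slots of the kind `s`, whose rows are a sum of rows of the kinds `s` and
`t`, contribute by the choices of `D.card` of them, turned into slots of the kind `t`. -/
theorem evalCols_skewWedge_split [DecidableEq T] (R R' : T → Fin k → ι → ℂ) (f : Fin k → T)
    (s t u : T) (hst : s ≠ t) (hut : u ≠ t) (D : Finset (Fin k)) (cu ct : ι)
    (hs : ∀ i, R' s i = R s i + R t i) (hR : ∀ v, v ≠ s → R' v = R v)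
    (hu : ∀ i, R u i cu = 1) (hu' : ∀ v, v ≠ u → ∀ i, R v i cu = 0)
    (ht : ∀ i ∈ D, R t i ct = 1) (ht0 : ∀ i, i ∉ D → R t i = 0)
    (ht' : ∀ v, v ≠ t → ∀ i, R v i ct = 0)
    (hD0 : ∀ v, v ≠ t → v ≠ u → ∀ i ∈ D, R v i = 0)
    (hft : ∀ a, f a ≠ t) (hfu : (univ.filter fun a => f a = u).card ≤ 1) (w : List ι)
    (hw : (∃ a, f a = u) → ∃ w', w = cu :: w' ∧ ct ∈ w') :
    ((univ.filter fun a => f a = s).card < D.card → evalCols w (skewWedge R' f) = 0) ∧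
    ∀ g : Fin k → T, (univ.filter fun a => f a = s).card =
        (univ.filter fun a => g a = s).card + D.card → (univ.filter fun a => g a = t).card = D.card →
      (∀ v, v ≠ s → v ≠ t → (univ.filter fun a => f a = v).card =
        (univ.filter fun a => g a = v).card) →
      evalCols w (skewWedge R' f) = ((univ.filter fun a => f a = s).card.choose D.card : ℂ) *
        evalCols w (skewWedge R g) := by
  have hfib : ∀ A ⊆ univ.filter (fun a => f a = s),
      (univ.filter fun a => replaceOn f A t a = t) = A := by
    intro A _
    ext a
    by_cases ha : a ∈ A <;> simp [replaceOn, ha, hft a]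
  have hfib' : ∀ A ⊆ univ.filter (fun a => f a = s), ∀ v, v ≠ t → v ≠ s →
      (univ.filter fun a => replaceOn f A t a = v) = univ.filter fun a => f a = v := by
    intro A hA v hvt hvs
    ext a
    simp only [Finset.mem_filter, mem_univ, true_and]
    by_cases ha : a ∈ A
    · have := (Finset.mem_filter.mp (hA ha)).2
      simp [replaceOn, ha, this, hvt.symm, hvs.symm]
    · simp [replaceOn, ha]
  -- Only sets with `D.card` elements contribute: a larger `A` does not fit injectively into `D`,
  -- and a smaller one leaves elements of `D` to an unused position.
  have hzero : ∀ A ⊆ univ.filter (fun a => f a = s), A.card ≠ D.card →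
      evalCols w (skewWedge R (replaceOn f A t)) = 0 := by
    intro A hA hcard
    by_cases hz : ∀ σ : Equiv.Perm (Fin k), ∃ a, R (replaceOn f A t a) (σ a) = 0
    · rw [skewWedge_eq_zero R _ hz, map_zero]
    have hsub : ∀ σ : Equiv.Perm (Fin k), (∀ a, R (replaceOn f A t a) (σ a) ≠ 0) →
        A.map σ.toEmbedding ⊆ D ∧
          D ⊆ A.map σ.toEmbedding ∪ (univ.filter fun a => f a = u).map σ.toEmbedding := by
      intro σ hσ
      constructor
      · intro i hi
        obtain ⟨a, ha, rfl⟩ := Finset.mem_map.mp hi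
        by_contra h
        exact hσ a (by simp only [replaceOn, if_pos ha]; exact ht0 _ h)
      -- An element of `D` must be placed at a position of the kind `t` or `u`, since the rows of
      -- all other kinds vanish on `D`.
      · intro i hi
        by_contra h
        simp only [Finset.mem_union, Finset.mem_map_equiv, not_or, Finset.mem_filter,
          mem_univ, true_and] at h
        refine hσ (σ.symm i) ?_
        simp only [replaceOn, if_neg h.1, Equiv.apply_symm_apply]
        exact hD0 _ (hft _) h.2 i hi
    push Not at hz
    obtain ⟨σ₀, hσ₀⟩ := hz
    obtain ⟨h1, h2⟩ := hsub σ₀ hσ₀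
    have c1 := Finset.card_le_card h1
    have c2 := (Finset.card_le_card h2).trans (Finset.card_union_le _ _)
    rw [Finset.card_map] at c1 c2
    rw [Finset.card_map] at c2
    -- Without an unused position the two inclusions would force |A| = |D|.
    have hex : ∃ a, f a = u := by
      by_contra h
      push Not at h
      rw [Finset.filter_false_of_mem fun a _ => h a, card_empty] at c2
      omega
    obtain ⟨w', rfl, hw'⟩ := hw hex
    refine evalCols_skewWedge_eq_zero R _ u t D cu ct hu hu' ht ht0 ht' ?_ w' hw'
    intro σ hσ a ha
    obtain ⟨h1, h2⟩ := hsub σ hσ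
    -- If the only unused position were sent outside `D`, the set `A` would have to cover all of
    -- `D`, which its cardinality forbids.
    by_contra hna
    have : D ⊆ A.map σ.toEmbedding := by
      intro i hi
      rcases Finset.mem_union.mp (h2 hi) with h | h
      · exact h
      · obtain ⟨b, hb, rfl⟩ := Finset.mem_map.mp h
        have hau : f a = u := by
          by_cases haA : a ∈ A
          · simp only [replaceOn, if_pos haA] at ha
            exact absurd ha.symm hut
          · simpa only [replaceOn, if_neg haA] using ha
        have := Finset.card_le_one.mp hfu b hb a (by simpa using hau)
        subst this
        exact absurd hi hna
    have := Finset.card_le_card this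
    rw [Finset.card_map] at this
    omega
  rw [skewWedge_split R R' f s t hs hR, map_sum]
  refine ⟨fun hlt => Finset.sum_eq_zero fun A hA => ?_, fun g hgs hgt hg => ?_⟩
  · have hA := Finset.mem_powerset.mp hA
    exact hzero A hA (by have := Finset.card_le_card hA; omega)
  · rw [← Finset.sum_subset (s₁ := (univ.filter fun a => f a = s).powersetCard D.card)
      (fun A hA => Finset.mem_powerset.mpr (Finset.mem_powersetCard.mp hA).1)]
    · rw [Finset.sum_congr rfl (g := fun _ => evalCols w (skewWedge R g)), Finset.sum_const,
        Finset.card_powersetCard, nsmul_eq_mul]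
      intro A hA
      obtain ⟨hA, hAc⟩ := Finset.mem_powersetCard.mp hA
      -- All choices of `A` give the same numbers of positions of each kind as `g`, hence the same
      -- value; their number is the binomial coefficient.
      rw [skewWedge_eq_of_card_fiber R _ g]
      intro v
      by_cases hvt : v = t
      · rw [hvt, hfib A hA, hAc, hgt]
      by_cases hvs : v = s
      · have : (univ.filter fun a => replaceOn f A t a = s) =
            (univ.filter fun a => f a = s) \ A := by
          ext a
          simp only [Finset.mem_filter, mem_univ, true_and, Finset.mem_sdiff]
          by_cases ha : a ∈ A <;> simp [replaceOn, ha, hst.symm]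
        rw [hvs, this, Finset.card_sdiff_of_subset hA, hgs, hAc]
        omega
      · rw [hfib' A hA v hvt hvs, hg v hvs hvt]
    · intro A hA hA'
      rw [Finset.mem_powerset] at hA
      exact hzero A hA fun h => hA' (Finset.mem_powersetCard.mpr ⟨hA, h⟩)

end SkewWedge

/-! ### Residues of products of logarithmic forms. -/

section LogResidue

variable {E F : Type*} [NormedAddCommGroup E] [NormedSpace ℂ E]
  [NormedAddCommGroup F] [NormedSpace ℂ F]

lemma wedgeOne_add_right {d : ℕ} (a : E →L[ℂ] ℂ) (b c : E [⋀^Fin d]→L[ℂ] ℂ) :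
    wedgeOne a (b + c) = wedgeOne a b + wedgeOne a c := by
  ext v
  simp [wedgeOne_apply, mul_add, Finset.sum_add_distrib]

lemma wedgeOne_smul_left {d : ℕ} (r : ℂ) (a : E →L[ℂ] ℂ) (b : E [⋀^Fin d]→L[ℂ] ℂ) :
    wedgeOne (r • a) b = r • wedgeOne a b := by
  ext v
  simp [wedgeOne_apply, Finset.mul_sum, mul_assoc, mul_left_comm]

lemma wedgeOne_smul_right {d : ℕ} (r : ℂ) (a : E →L[ℂ] ℂ) (b : E [⋀^Fin d]→L[ℂ] ℂ) :
    wedgeOne a (r • b) = r • wedgeOne a b := by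
  ext v
  simp [wedgeOne_apply, Finset.mul_sum, mul_left_comm]

lemma wedgeOne_zero_right {d : ℕ} (a : E →L[ℂ] ℂ) :
    wedgeOne a (0 : E [⋀^Fin d]→L[ℂ] ℂ) = 0 := by
  ext v
  simp [wedgeOne_apply]

lemma wedgeOne_sum_right {d : ℕ} {α : Type*} (s : Finset α) (a : E →L[ℂ] ℂ)
    (b : α → E [⋀^Fin d]→L[ℂ] ℂ) : wedgeOne a (∑ i ∈ s, b i) = ∑ i ∈ s, wedgeOne a (b i) := by
  classical
  induction s using Finset.induction_on with
  | empty => simp [wedgeOne_zero_right]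
  | insert i s hi ih => rw [Finset.sum_insert hi, Finset.sum_insert hi, wedgeOne_add_right, ih]

lemma analyticAt_smulRight {G : Type*} [NormedAddCommGroup G] [NormedSpace ℂ G]
    {a : F → E →L[ℂ] ℂ} {b : F → G} {p : F} (ha : AnalyticAt ℂ a p) (hb : AnalyticAt ℂ b p) :
    AnalyticAt ℂ (fun w => (a w).smulRight (b w)) p :=
  ((ContinuousLinearMap.smulRightL ℂ E G).analyticAt_bilinear (a p, b p)).comp₂ ha hb

lemma analyticAt_wedgeOne {d : ℕ} {a : F → E →L[ℂ] ℂ} {b : F → E [⋀^Fin d]→L[ℂ] ℂ} {p : F}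
    (ha : AnalyticAt ℂ a p) (hb : AnalyticAt ℂ b p) :
    AnalyticAt ℂ (fun w => wedgeOne (a w) (b w)) p := by
  have h1 : AnalyticAt ℂ (fun w => (a w).smulRight (b w)) p := analyticAt_smulRight ha hb
  exact ((ContinuousAlternatingMap.alternatizeUncurryFinCLM ℂ E ℂ).analyticAt _).comp h1

lemma analyticAt_wedgeList {p : F} : ∀ (l : List (F → E →L[ℂ] ℂ)) (d : ℕ),
    (∀ a ∈ l, AnalyticAt ℂ a p) → AnalyticAt ℂ (fun w => wedgeList (l.map fun a => a w) d) p
  | [], 0, _ => analyticAt_const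
  | [], _ + 1, _ => analyticAt_const
  | _ :: _, 0, _ => analyticAt_const
  | a :: l, d + 1, h => analyticAt_wedgeOne (h a (by simp))
      (analyticAt_wedgeList l d fun b hb => h b (List.mem_cons_of_mem _ hb))

/-- The factor `β` in `⋀ (ε_i δ + c_i) = δ ∧ β + ⋀ c_i`. -/
def resForm : List (ℂ × (E →L[ℂ] ℂ)) → (d : ℕ) → E [⋀^Fin d]→L[ℂ] ℂ
  | [], _ => 0
  | p :: l, 0 => p.1 • wedgeList (l.map Prod.snd) 0
  | p :: l, d + 1 => p.1 • wedgeList (l.map Prod.snd) (d + 1) - wedgeOne p.2 (resForm l d)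

lemma analyticAt_resForm {p : F} : ∀ (l : List (ℂ × (F → E →L[ℂ] ℂ))) (d : ℕ),
    (∀ a ∈ l, AnalyticAt ℂ a.2 p) →
    AnalyticAt ℂ (fun w => resForm (l.map fun a => (a.1, a.2 w)) d) p
  | [], d, _ => by
    simp only [List.map_nil, resForm]
    exact analyticAt_const
  | a :: l, 0, h => by
    simp only [List.map_cons, resForm, List.map_map]
    refine AnalyticAt.fun_smul (f := fun _ => a.1) analyticAt_const ?_
    have := analyticAt_wedgeList (l.map Prod.snd) 0 (p := p) (by
      rintro _ hb'
      obtain ⟨b, hb, rfl⟩ := List.mem_map.mp hb'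
      exact h b (List.mem_cons_of_mem _ hb))
    simpa only [List.map_map, Function.comp_def] using this
  | a :: l, d + 1, h => by
    simp only [List.map_cons, resForm, List.map_map]
    refine (AnalyticAt.fun_smul (f := fun _ => a.1) analyticAt_const ?_).fun_sub
      (analyticAt_wedgeOne (h a (by simp))
      (analyticAt_resForm l d fun b hb => h b (List.mem_cons_of_mem _ hb)))
    have := analyticAt_wedgeList (l.map Prod.snd) (d + 1) (p := p) (by
      rintro _ hb'
      obtain ⟨b, hb, rfl⟩ := List.mem_map.mp hb'
      exact h b (List.mem_cons_of_mem _ hb))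
    simpa only [List.map_map, Function.comp_def] using this

/-- The same as `resForm` in the exterior algebra. -/
def resExt {ι : Type*} : List (ℂ × (ι → ℂ)) → ExteriorAlgebra ℂ (ι → ℂ)
  | [] => 0
  | p :: l => p.1 • wedgeRows (l.map Prod.snd) - ExteriorAlgebra.ι ℂ p.2 * resExt l

/-- Since δ ∧ δ = 0, at most one factor contributes δ. Moving it to the front past `p.2` accounts
for the minus sign in the recursion of `resExt`. -/
lemma wedgeRows_eq_resExt {ι : Type*} (δ : ι → ℂ) (l : List (ℂ × (ι → ℂ))) :
    wedgeRows (l.map fun p => p.1 • δ + p.2) =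
      ExteriorAlgebra.ι ℂ δ * resExt l + wedgeRows (l.map Prod.snd) := by
  induction l with
  | nil => simp [resExt]
  | cons p l ih =>
    have h : ∀ x : ExteriorAlgebra ℂ (ι → ℂ), ExteriorAlgebra.ι ℂ p.2 *
        (ExteriorAlgebra.ι ℂ δ * x) = - (ExteriorAlgebra.ι ℂ δ * (ExteriorAlgebra.ι ℂ p.2 * x)) := by
      intro x
      rw [← mul_assoc, ← mul_assoc, eq_neg_of_add_eq_zero_left
        (ExteriorAlgebra.ι_add_mul_swap (R := ℂ) p.2 δ), neg_mul]
    have h0 : ∀ x : ExteriorAlgebra ℂ (ι → ℂ), ExteriorAlgebra.ι ℂ δ *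
        (ExteriorAlgebra.ι ℂ δ * x) = 0 := by
      intro x
      rw [← mul_assoc, ExteriorAlgebra.ι_sq_zero, zero_mul]
    rw [List.map_cons, wedgeRows_cons, ih, List.map_cons, wedgeRows_cons, resExt, map_add,
      map_smul, add_mul, mul_add, mul_add, smul_mul_assoc, smul_mul_assoc, h0, h, mul_sub,
      mul_smul_comm]
    simp only [smul_zero, zero_add]
    abel

lemma resForm_apply : ∀ (l : List (ℂ × (E →L[ℂ] ℂ))) (d : ℕ) (v : Fin d → E),
    resForm l d v = evalCols (List.ofFn v) (resExt (l.map fun p => (p.1, (p.2 : E → ℂ))))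
  | [], d, v => by simp [resForm, resExt]
  | p :: l, 0, v => by
    have h := wedgeList_apply (l.map Prod.snd) 0 v
    simp only [resForm, resExt, List.map_cons, List.map_map, Function.comp_def] at h ⊢
    rw [map_sub, map_smul, List.ofFn_zero, evalCols_nil_ι_mul, sub_zero]
    rw [List.ofFn_zero] at h
    rw [← h]
    rfl
  | p :: l, d + 1, v => by
    have h := wedgeList_apply (l.map Prod.snd) (d + 1) v
    simp only [resForm, resExt, List.map_cons, List.map_map, Function.comp_def] at h ⊢
    rw [map_sub, map_smul, ← h, ← wedgeOne_apply_eq p.2 _ _ (resForm_apply l d) v]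
    rfl

lemma wedgeList_eq_resForm (δ : E →L[ℂ] ℂ) (l : List (ℂ × (E →L[ℂ] ℂ))) (d : ℕ) :
    wedgeList (l.map fun p => p.1 • δ + p.2) (d + 1) =
      wedgeOne δ (resForm l d) + wedgeList (l.map Prod.snd) (d + 1) := by
  ext v
  have h := wedgeRows_eq_resExt (δ : E → ℂ) (l.map fun p => (p.1, (p.2 : E → ℂ)))
  simp only [List.map_map, Function.comp_def] at h
  rw [ContinuousAlternatingMap.add_apply, wedgeOne_apply_eq δ _ _ (resForm_apply l d),
    wedgeList_apply, wedgeList_apply, ← map_add]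
  simp only [List.map_map, Function.comp_def]
  rw [← h]
  rfl

lemma map_resExt {ι κ : Type*} (g : ι → κ) (l : List (ℂ × (κ → ℂ))) :
    ExteriorAlgebra.map (LinearMap.funLeft ℂ ℂ g) (resExt l) =
      resExt (l.map fun p => (p.1, p.2 ∘ g)) := by
  induction l with
  | nil => simp [resExt]
  | cons p l ih =>
    have := map_wedgeRows g (l.map Prod.snd)
    rw [List.map_map] at this
    rw [resExt, map_sub, map_smul, map_mul, ih, ExteriorAlgebra.map_apply_ι, this, List.map_cons,
      resExt, List.map_map]
    rfl

omit [NormedAddCommGroup E] [NormedSpace ℂ E] in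
/-- A row with the value `ε` in the column `c`, and a covector in the columns of vectors. -/
def logRow {κ : Type*} [DecidableEq κ] (c : κ) (ε : ℂ) (a : E → ℂ) : κ ⊕ E → ℂ :=
  Sum.elim (Pi.single c ε) a

-- The unit vector of the column `c` plays the part of δ = dr/r. The remaining rows vanish in that
-- column, so the contraction picks out the cofactor of δ: taking the residue becomes contraction
-- with a formal column.
omit [NormedAddCommGroup E] [NormedSpace ℂ E] in
lemma contr_logRows {κ : Type*} [DecidableEq κ] (c : κ) (l : List (ℂ × (E → ℂ))) :
    contr (Sum.inl c) (wedgeRows (l.map fun p => logRow c p.1 p.2)) =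
      resExt (l.map fun p => (p.1, logRow c 0 p.2)) := by
  have hrow : ∀ p : ℂ × (E → ℂ), logRow c p.1 p.2 =
      p.1 • logRow c 1 (0 : E → ℂ) + logRow c 0 p.2 := by
    intro p
    funext x
    rcases x with x | x
    · by_cases h : x = c
      · subst h
        simp [logRow]
      · simp [logRow, h]
    · simp [logRow]
  have hres : ∀ l : List (ℂ × (κ ⊕ E → ℂ)), (∀ p ∈ l, p.2 (Sum.inl c) = 0) →
      contr (Sum.inl c) (resExt l) = 0 := by
    intro l hl
    induction l with
    | nil => simp [resExt]
    | cons p l ih =>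
      rw [resExt, map_sub, map_smul, contr_ι_mul, hl p (by simp),
        ih fun q hq => hl q (List.mem_cons_of_mem _ hq), contr_wedgeRows]
      · simp
      · intro b hb
        obtain ⟨q, hq, rfl⟩ := List.mem_map.mp hb
        exact hl q (List.mem_cons_of_mem _ hq)
  have h := wedgeRows_eq_resExt (logRow c 1 (0 : E → ℂ)) (l.map fun p => (p.1, logRow c 0 p.2))
  simp only [List.map_map, Function.comp_def, ← hrow] at h
  rw [h, map_add, contr_ι_mul, contr_wedgeRows, hres]
  · simp [logRow]
  · intro q hq
    obtain ⟨p, hp, rfl⟩ := List.mem_map.mp hq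
    simp [logRow]
  · intro q hq
    obtain ⟨p, hp, rfl⟩ := List.mem_map.mp hq
    simp [logRow]

omit [NormedAddCommGroup E] [NormedSpace ℂ E] in
lemma evalCols_logRows {κ : Type*} [DecidableEq κ] (c : κ) (l : List (ℂ × (E → ℂ)))
    (w : List E) :
    evalCols (Sum.inl c :: w.map Sum.inr) (wedgeRows (l.map fun p => logRow c p.1 p.2)) =
      evalCols w (resExt l) := by
  rw [evalCols_cons, contr_logRows, ← evalCols_map, map_resExt, List.map_map]
  congr 2
  exact List.map_id _

/-- The logarithmic derivative of `r^ε g`. -/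
lemma dlog_fst_pow_mul (ε : ℕ) (g : ℂ × E → ℂ) (w : ℂ × E) (hw : w.1 ≠ 0) (hg : g w ≠ 0)
    (hd : DifferentiableAt ℂ g w) :
    dlog (fun w : ℂ × E => w.1 ^ ε * g w) w =
      (ε : ℂ) • (w.1⁻¹ • ContinuousLinearMap.fst ℂ ℂ E) + dlog g w := by
  have h1 : HasFDerivAt (fun w : ℂ × E => w.1 ^ ε)
      (((ε : ℂ) * w.1 ^ (ε - 1)) • ContinuousLinearMap.fst ℂ ℂ E) w := by
    simpa using (hasFDerivAt_fst (𝕜 := ℂ) (p := w)).pow ε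
  have h2 := (h1.mul hd.hasFDerivAt).fderiv
  ext v <;> simp only [dlog]
  all_goals
    erw [h2]
    rcases Nat.eq_zero_or_pos ε with rfl | hε
    · simp
    · obtain ⟨e, rfl⟩ : ∃ e, ε = e + 1 := ⟨ε - 1, by omega⟩
      have hp : w.1 ^ e ≠ 0 := pow_ne_zero _ hw
      simp
      field_simp
      try ring

/-- The residue of a product of logarithmic forms `d log (r^ε g)`. -/
theorem exists_logResidue {κ α : Type*} [DecidableEq κ] (c : κ) (X : List α)
    (f g : α → ℂ × E → ℂ) (ε : α → ℕ) (y₀ : E) (d : ℕ)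
    (hfg : ∀ x ∈ X, ∀ᶠ w in 𝓝 ((0 : ℂ), y₀), f x w = w.1 ^ ε x * g x w)
    (hg : ∀ x ∈ X, AnalyticAt ℂ (g x) (0, y₀)) (hg0 : ∀ x ∈ X, g x (0, y₀) ≠ 0) :
    ∃ (β : DForm (ℂ × E) d) (γ : DForm (ℂ × E) (d + 1)),
      AnalyticAt ℂ β (0, y₀) ∧ AnalyticAt ℂ γ (0, y₀) ∧
      (∀ᶠ w in 𝓝 ((0 : ℂ), y₀), w.1 ≠ 0 → wedgeList (X.map fun x => dlog (f x) w) (d + 1) =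
          w.1⁻¹ • wedgeOne (ContinuousLinearMap.fst ℂ ℂ E) (β w) + γ w) ∧
      ∀ v : Fin d → E, pullback (fun y : E => ((0 : ℂ), y)) β y₀ v =
        evalCols (Sum.inl c :: (List.ofFn v).map Sum.inr)
          (wedgeRows (X.map fun x => logRow c (ε x : ℂ) (dlog (fun y => g x (0, y)) y₀))) := by
  have hdl : ∀ x ∈ X, AnalyticAt ℂ (dlog (g x)) (0, y₀) := fun x hx =>
    ((hg x hx).inv (hg0 x hx)).fun_smul (hg x hx).fderiv
  -- The coefficients `ε` are constant and the forms d log g are analytic because g does not vanish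
  -- at the point; so the cofactor of dr/r and the remainder are analytic across the divisor.
  refine ⟨fun w => resForm (X.map fun x => ((ε x : ℂ), dlog (g x) w)) d,
    fun w => wedgeList (X.map fun x => dlog (g x) w) (d + 1), ?_, ?_, ?_, ?_⟩
  · have := analyticAt_resForm (p := ((0 : ℂ), y₀)) (X.map fun x => ((ε x : ℂ), dlog (g x))) d (by
      intro b hb
      obtain ⟨x, hx, rfl⟩ := List.mem_map.mp hb
      exact hdl x hx)
    simpa only [List.map_map, Function.comp_def] using this
  · have := analyticAt_wedgeList (p := ((0 : ℂ), y₀)) (X.map fun x => dlog (g x)) (d + 1) (by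
      intro b hb
      obtain ⟨x, hx, rfl⟩ := List.mem_map.mp hb
      exact hdl x hx)
    simpa only [List.map_map, Function.comp_def] using this
  · have hev : ∀ᶠ w in 𝓝 ((0 : ℂ), y₀), ∀ x ∈ X, w.1 ≠ 0 → dlog (f x) w =
        (ε x : ℂ) • (w.1⁻¹ • ContinuousLinearMap.fst ℂ ℂ E) + dlog (g x) w := by
      -- Sublists are used so that an induction yields one neighbourhood on which the finitely many
      -- factorizations all hold.
      have hall : ∀ X' : List α, (∀ x ∈ X', x ∈ X) → ∀ᶠ w in 𝓝 ((0 : ℂ), y₀), ∀ x ∈ X',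
          w.1 ≠ 0 → dlog (f x) w =
            (ε x : ℂ) • (w.1⁻¹ • ContinuousLinearMap.fst ℂ ℂ E) + dlog (g x) w := by
        intro X'
        induction X' with
        | nil => simp
        | cons x X' ih =>
          intro h
          have hx := h x (by simp)
          filter_upwards [ih fun y hy => h y (List.mem_cons_of_mem _ hy),
            (hfg x hx).eventually_nhds, (hg x hx).eventually_analyticAt,
            (hg x hx).continuousAt.eventually_ne (hg0 x hx)] with w h1 h2 h3 h4 y hy
          rcases List.mem_cons.mp hy with rfl | hy
          · intro hw
            rw [← dlog_fst_pow_mul (ε y) (g y) w hw h4 h3.differentiableAt]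
            unfold dlog
            rw [Filter.EventuallyEq.fderiv_eq h2, h2.self_of_nhds]
          · exact h1 y hy
      exact hall X fun x hx => hx
    filter_upwards [hev] with w hw hr
    have := wedgeList_eq_resForm (w.1⁻¹ • ContinuousLinearMap.fst ℂ ℂ E)
      (X.map fun x => ((ε x : ℂ), dlog (g x) w)) d
    rw [wedgeOne_smul_left] at this
    simp only [List.map_map, Function.comp_def] at this
    rw [← this]
    congr 1
    exact List.map_congr_left fun x hx => hw x hx hr
  · intro v
    have hfd : fderiv ℂ (fun y : E => ((0 : ℂ), y)) y₀ = ContinuousLinearMap.inr ℂ ℂ E :=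
      (ContinuousLinearMap.inr ℂ ℂ E).fderiv
    have hrow : ∀ x ∈ X, (dlog (fun y => g x (0, y)) y₀ : E → ℂ) =
        (dlog (g x) (0, y₀) : ℂ × E → ℂ) ∘ fun y : E => ((0 : ℂ), y) := by
      intro x hx
      have : HasFDerivAt (fun y => g x (0, y))
          ((fderiv ℂ (g x) (0, y₀)).comp (ContinuousLinearMap.inr ℂ ℂ E)) y₀ :=
        HasFDerivAt.comp y₀ (hg x hx).differentiableAt.hasFDerivAt
          (ContinuousLinearMap.inr ℂ ℂ E).hasFDerivAt
      unfold dlog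
      rw [this.fderiv]
      funext y
      simp
    have e : (X.map fun x => logRow c (ε x : ℂ) (dlog (fun y => g x (0, y)) y₀)) =
        (X.map fun x => ((ε x : ℂ), (dlog (fun y => g x (0, y)) y₀ : E → ℂ))).map
          fun p => logRow c p.1 p.2 := by
      rw [List.map_map]
      rfl
    rw [e, evalCols_logRows]
    change resForm _ d (fderiv ℂ (fun y : E => ((0 : ℂ), y)) y₀ ∘ v) = _
    rw [hfd, resForm_apply, List.map_map]
    have e2 : (X.map fun x => ((ε x : ℂ), (dlog (fun y => g x (0, y)) y₀ : E → ℂ))) =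
        (X.map fun x => ((ε x : ℂ), (dlog (g x) (0, y₀) : ℂ × E → ℂ))).map
          fun p => (p.1, p.2 ∘ fun y : E => ((0 : ℂ), y)) := by
      rw [List.map_map]
      exact List.map_congr_left fun x hx => by rw [hrow x hx]; rfl
    -- Restriction to r = 0 replaces the vector v by (0, v), which is a relabelling of columns.
    rw [e2, ← map_resExt, evalCols_map, List.map_ofFn]
    rfl

end LogResidue

/-! ### The positions 1, …, k of the standard product and their kinds. -/

section Slots

variable {n k : ℕ} (m : Fin n → ℕ) (S : Finset (Fin n)) (K : Fin n → ℕ)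

lemma sum_filter_lt_add_le {c : Fin n → ℕ} {j l : Fin n} (hj : j ∈ S) (h : j < l) :
    ∑ i ∈ S.filter (· < j), c i + c j ≤ ∑ i ∈ S.filter (· < l), c i := by
  rw [add_comm, ← Finset.sum_insert (s := S.filter (· < j)) (by simp)]
  refine Finset.sum_le_sum_of_subset fun i hi => ?_
  rcases Finset.mem_insert.mp hi with rfl | hi
  · simp [hj, h]
  · have := Finset.mem_filter.mp hi
    simp [this.1, this.2.trans h]

lemma sum_filter_lt_add_le_sum {c : Fin n → ℕ} {j : Fin n} (hj : j ∈ S) :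
    ∑ i ∈ S.filter (· < j), c i + c j ≤ ∑ i ∈ S, c i := by
  rw [add_comm, ← Finset.sum_insert (s := S.filter (· < j)) (by simp)]
  refine Finset.sum_le_sum_of_subset fun i hi => ?_
  rcases Finset.mem_insert.mp hi with rfl | hi
  · exact hj
  · exact (Finset.mem_filter.mp hi).1

/-- The interval of the block `j` in the standard label. -/
def stdBlock (k : ℕ) (j : Fin n) : Finset (Fin k) :=
  univ.filter fun i : Fin k =>
    blockSum m (S.filter (· < j)) ≤ i ∧ (i : ℕ) < blockSum m (S.filter (· < j)) + (m j + 1)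

/-- The positions of the logarithmic factors with the pole `z_l`. -/
def factorList (k : ℕ) (l : Fin n) : List (Fin k) :=
  (List.finRange k).filter fun a : Fin k =>
    blockSum m S + ∑ i ∈ univ.filter (· < l), K i ≤ a ∧
      (a : ℕ) < blockSum m S + ∑ i ∈ univ.filter (· < l), K i + K l

/-- The positions of the logarithmic factors, with their kinds. -/
def factorSlots (k : ℕ) : List (SlotKind n × Fin k) :=
  (List.finRange n).flatMap fun l => (factorList m S K k l).map fun a => (.factor l, a)

/-- All positions in use, with their kinds. -/
def fullSlots (k : ℕ) : List (SlotKind n × Fin k) :=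
  (S.sort.flatMap fun j => (stdBlock m S k j).sort.map fun a => (.block j, a)) ++
    factorSlots m S K k

/-- The positions without the first ones of the blocks. -/
def reducedSlots (k : ℕ) : List (SlotKind n × Fin k) :=
  (S.sort.flatMap fun j => (stdBlock m S k j).sort.tail.map fun a => (.block j, a)) ++
    factorSlots m S K k

variable {m S K}

lemma mem_stdBlock {j : Fin n} {a : Fin k} : a ∈ stdBlock m S k j ↔
    blockSum m (S.filter (· < j)) ≤ a ∧ (a : ℕ) < blockSum m (S.filter (· < j)) + (m j + 1) := by
  simp [stdBlock]

lemma mem_factorList {l : Fin n} {a : Fin k} : a ∈ factorList m S K k l ↔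
    blockSum m S + ∑ i ∈ univ.filter (· < l), K i ≤ a ∧
      (a : ℕ) < blockSum m S + ∑ i ∈ univ.filter (· < l), K i + K l := by
  simp [factorList]

lemma block_mem_fullSlots {j : Fin n} {a : Fin k} :
    (SlotKind.block j, a) ∈ fullSlots m S K k ↔ j ∈ S ∧ a ∈ stdBlock m S k j := by
  simp [fullSlots, factorSlots]

lemma factor_mem_fullSlots {l : Fin n} {a : Fin k} :
    (SlotKind.factor l, a) ∈ fullSlots m S K k ↔ a ∈ factorList m S K k l := by
  simp [fullSlots, factorSlots]

lemma unused_mem_fullSlots {a : Fin k} : (SlotKind.unused, a) ∉ fullSlots m S K k := by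
  simp [fullSlots, factorSlots]

lemma stdBlock_lt_blockSum {j : Fin n} (hj : j ∈ S) {a : Fin k} (h : a ∈ stdBlock m S k j) :
    (a : ℕ) < blockSum m S :=
  (mem_stdBlock.mp h).2.trans_le (sum_filter_lt_add_le_sum S (c := fun j => m j + 1) hj)

lemma stdBlock_lt {i j : Fin n} (hi : i ∈ S) (hij : i < j) {a b : Fin k}
    (ha : a ∈ stdBlock m S k i) (hb : b ∈ stdBlock m S k j) : a < b := by
  have := sum_filter_lt_add_le S (c := fun j => m j + 1) hi hij
  have h1 := (mem_stdBlock.mp ha).2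
  have h2 := (mem_stdBlock.mp hb).1
  simp only [blockSum] at h1 h2
  exact Fin.lt_def.mpr (by omega)

lemma factorList_lt {i j : Fin n} (hij : i < j) {a b : Fin k}
    (ha : a ∈ factorList m S K k i) (hb : b ∈ factorList m S K k j) : a < b := by
  have := sum_filter_lt_add_le univ (c := K) (mem_univ i) hij
  have h1 := (mem_factorList.mp ha).2
  have h2 := (mem_factorList.mp hb).1
  exact Fin.lt_def.mpr (by omega)

lemma not_mem_stdBlock_of_mem_factorList {l j : Fin n} {a : Fin k}
    (ha : a ∈ factorList m S K k l) (hj : j ∈ S) : a ∉ stdBlock m S k j := by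
  intro h
  have h1 := stdBlock_lt_blockSum hj h
  have h2 := (mem_factorList.mp ha).1
  omega

lemma card_stdBlock (hk : blockSum m S ≤ k) {j : Fin n} (hj : j ∈ S) :
    (stdBlock m S k j).card = m j + 1 := by
  have h := sum_filter_lt_add_le_sum S (c := fun j => m j + 1) hj
  have : (stdBlock m S k j).map Fin.valEmbedding =
      Finset.Ico (blockSum m (S.filter (· < j))) (blockSum m (S.filter (· < j)) + (m j + 1)) := by
    ext a
    simp only [Finset.mem_map, mem_stdBlock, Fin.valEmbedding_apply, Finset.mem_Ico]
    constructor
    · rintro ⟨b, hb, rfl⟩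
      exact hb
    · intro hb
      have : a < k := by
        simp only [blockSum] at *
        omega
      exact ⟨⟨a, this⟩, hb, rfl⟩
  rw [← Finset.card_map Fin.valEmbedding, this, Nat.card_Ico]
  omega

lemma card_factorList (hk : blockSum m S + ∑ i, K i ≤ k) (l : Fin n) :
    (univ.filter fun a => a ∈ factorList m S K k l).card = K l := by
  have h := sum_filter_lt_add_le_sum univ (c := K) (mem_univ l)
  have : (univ.filter fun a => a ∈ factorList m S K k l).map Fin.valEmbedding =
      Finset.Ico (blockSum m S + ∑ i ∈ univ.filter (· < l), K i)
        (blockSum m S + ∑ i ∈ univ.filter (· < l), K i + K l) := by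
    ext a
    simp only [Finset.mem_map, Finset.mem_filter, mem_univ, true_and, mem_factorList,
      Fin.valEmbedding_apply, Finset.mem_Ico]
    constructor
    · rintro ⟨b, hb, rfl⟩
      exact hb
    · intro hb
      exact ⟨⟨a, by omega⟩, hb, rfl⟩
  rw [← Finset.card_map Fin.valEmbedding, this, Nat.card_Ico]
  omega

/-- The standard blocks and the groups of factors are consecutive disjoint intervals, listed in
increasing order. Hence the order of the exterior product is the order of the positions, and no
sorting sign arises. -/
lemma pairwise_fullSlots : (fullSlots m S K k).Pairwise fun x y => x.2 < y.2 := by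
  rw [fullSlots, List.pairwise_append]
  refine ⟨?_, ?_, ?_⟩
  · rw [List.pairwise_flatMap]
    refine ⟨fun j _ => ?_, ?_⟩
    · rw [List.pairwise_map]
      exact (Finset.sortedLT_sort _).pairwise
    · refine (Finset.sortedLT_sort S).pairwise.imp_of_mem ?_
      intro i j hi _ hij x hx y hy
      obtain ⟨a, ha, rfl⟩ := List.mem_map.mp hx
      obtain ⟨b, hb, rfl⟩ := List.mem_map.mp hy
      rw [Finset.mem_sort] at ha hb hi
      exact stdBlock_lt hi hij ha hb
  · rw [factorSlots, List.pairwise_flatMap]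
    refine ⟨fun j _ => ?_, ?_⟩
    · rw [List.pairwise_map]
      exact (List.pairwise_lt_finRange k).filter _
    · refine (List.pairwise_lt_finRange n).imp_of_mem ?_
      intro i j _ _ hij x hx y hy
      obtain ⟨a, ha, rfl⟩ := List.mem_map.mp hx
      obtain ⟨b, hb, rfl⟩ := List.mem_map.mp hy
      exact factorList_lt hij ha hb
  · intro x hx y hy
    obtain ⟨j, hj, hx⟩ := List.mem_flatMap.mp hx
    obtain ⟨a, ha, rfl⟩ := List.mem_map.mp hx
    obtain ⟨l, -, hy⟩ := List.mem_flatMap.mp hy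
    obtain ⟨b, hb, rfl⟩ := List.mem_map.mp hy
    rw [Finset.mem_sort] at ha hj
    have h1 := stdBlock_lt_blockSum hj ha
    have h2 := (mem_factorList.mp hb).1
    exact Fin.lt_def.mpr (by simp only; omega)

lemma fullSlots_inj {s t : SlotKind n} {a : Fin k} (hs : (s, a) ∈ fullSlots m S K k)
    (ht : (t, a) ∈ fullSlots m S K k) : s = t := by
  by_contra hne
  obtain ⟨i, hi, hi'⟩ := List.mem_iff_getElem.mp hs
  obtain ⟨j, hj, hj'⟩ := List.mem_iff_getElem.mp ht
  have hp := List.pairwise_iff_getElem.mp (pairwise_fullSlots (m := m) (S := S) (K := K) (k := k))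
  rcases lt_trichotomy i j with hij | rfl | hij
  · have := hp i j hi hj hij
    rw [hi', hj'] at this
    exact lt_irrefl _ this
  · rw [hi'] at hj'
    exact hne (congrArg Prod.fst hj')
  · have := hp j i hj hi hij
    rw [hi', hj'] at this
    exact lt_irrefl _ this

open Classical in
/-- The kind of a position. -/
def slotKind (m : Fin n → ℕ) (S : Finset (Fin n)) (K : Fin n → ℕ) (a : Fin k) : SlotKind n :=
  if h : ∃ t, (t, a) ∈ fullSlots m S K k then h.choose else .unused

lemma slotKind_of_mem {t : SlotKind n} {a : Fin k} (h : (t, a) ∈ fullSlots m S K k) :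
    slotKind m S K a = t := by
  have hex : ∃ t, (t, a) ∈ fullSlots m S K k := ⟨t, h⟩
  rw [slotKind, dif_pos hex]
  exact fullSlots_inj hex.choose_spec h

lemma slotKind_eq_iff {t : SlotKind n} (ht : t ≠ .unused) {a : Fin k} :
    slotKind m S K a = t ↔ (t, a) ∈ fullSlots m S K k := by
  refine ⟨fun h => ?_, slotKind_of_mem⟩
  by_cases hex : ∃ t, (t, a) ∈ fullSlots m S K k
  · rw [slotKind, dif_pos hex] at h
    exact h ▸ hex.choose_spec
  · rw [slotKind, dif_neg hex] at h
    exact absurd h.symm ht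

lemma slotKind_eq_block_iff {j : Fin n} {a : Fin k} :
    slotKind m S K a = .block j ↔ j ∈ S ∧ a ∈ stdBlock m S k j := by
  rw [slotKind_eq_iff (by simp), block_mem_fullSlots]

lemma slotKind_eq_factor_iff {l : Fin n} {a : Fin k} :
    slotKind m S K a = .factor l ↔ a ∈ factorList m S K k l := by
  rw [slotKind_eq_iff (by simp), factor_mem_fullSlots]

lemma card_slotKind_block (hk : blockSum m S ≤ k) (j : Fin n) :
    (univ.filter fun a : Fin k => slotKind m S K a = .block j).card =
      if j ∈ S then m j + 1 else 0 := by
  simp only [slotKind_eq_block_iff]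
  by_cases hj : j ∈ S
  · simp [hj, card_stdBlock hk hj]
  · simp [hj]

lemma card_slotKind_factor (hk : blockSum m S + ∑ i, K i ≤ k) (l : Fin n) :
    (univ.filter fun a : Fin k => slotKind m S K a = .factor l).card = K l := by
  simp only [slotKind_eq_factor_iff]
  exact card_factorList hk l

lemma mem_fullSlots_lt {x : SlotKind n × Fin k} (hx : x ∈ fullSlots m S K k) :
    (x.2 : ℕ) < blockSum m S + ∑ i, K i := by
  obtain ⟨t, a⟩ := x
  cases t with
  | block j =>
    obtain ⟨hj, ha⟩ := block_mem_fullSlots.mp hx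
    have := stdBlock_lt_blockSum hj ha
    exact this.trans_le (Nat.le_add_right _ _)
  | factor l =>
    have h1 := (mem_factorList.mp (factor_mem_fullSlots.mp hx)).2
    have h2 := sum_filter_lt_add_le_sum univ (c := K) (mem_univ l)
    simp only
    omega
  | unused => exact absurd hx unused_mem_fullSlots

lemma card_slotKind_unused (hk : blockSum m S + ∑ i, K i ≤ k) :
    (univ.filter fun a : Fin k => slotKind m S K a = .unused).card =
      k - (blockSum m S + ∑ i, K i) := by
  have h1 : (univ.filter fun a : Fin k => slotKind m S K a ≠ .unused).card =
      blockSum m S + ∑ i, K i := by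
    have : (univ.filter fun a : Fin k => slotKind m S K a ≠ .unused) =
        (univ.biUnion fun j => univ.filter fun a : Fin k => slotKind m S K a = .block j) ∪
        (univ.biUnion fun l => univ.filter fun a : Fin k => slotKind m S K a = .factor l) := by
      ext a
      simp only [Finset.mem_filter, mem_univ, true_and, Finset.mem_union, Finset.mem_biUnion]
      cases slotKind m S K a <;> simp
    rw [this, Finset.card_union_of_disjoint, Finset.card_biUnion, Finset.card_biUnion]
    · simp only [card_slotKind_factor hk, card_slotKind_block ((Nat.le_add_right _ _).trans hk)]
      rw [blockSum, Finset.sum_ite_mem, Finset.univ_inter]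
    · intro i _ j _ hij
      rw [Function.onFun, Finset.disjoint_left]
      intro a ha hb
      simp only [Finset.mem_filter, mem_univ, true_and] at ha hb
      rw [ha] at hb
      exact hij (by simpa using hb)
    · intro i _ j _ hij
      rw [Function.onFun, Finset.disjoint_left]
      intro a ha hb
      simp only [Finset.mem_filter, mem_univ, true_and] at ha hb
      rw [ha] at hb
      exact hij (by simpa using hb)
    · rw [Finset.disjoint_left]
      intro a ha hb
      simp only [Finset.mem_filter, mem_univ, true_and, Finset.mem_biUnion] at ha hb
      obtain ⟨i, hi⟩ := ha
      obtain ⟨j, hj⟩ := hb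
      rw [hi] at hj
      simp at hj
  have h2 := Finset.card_filter_add_card_filter_not (s := (univ : Finset (Fin k)))
    fun a => slotKind m S K a = .unused
  rw [Finset.card_univ, Fintype.card_fin] at h2
  simp only [ne_eq] at h1
  omega

/-- No position is unused, so the second entries of `fullSlots` form a strictly increasing list of
all positions, which determines the list. -/
lemma map_slotKind_finRange (hk : blockSum m S + ∑ i, K i = k) :
    (List.finRange k).map (fun a => (slotKind m S K a, a)) = fullSlots m S K k := by
  have h0 := card_slotKind_unused (m := m) (S := S) (K := K) hk.le
  have h1 : (fullSlots m S K k).map Prod.snd = List.finRange k := by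
    have hp : ((fullSlots m S K k).map Prod.snd).Pairwise (· < ·) :=
      List.pairwise_map.mpr pairwise_fullSlots
    refine List.Perm.eq_of_pairwise (le := (· < ·)) (fun a b _ _ h h' => absurd h' h.asymm)
      hp (List.pairwise_lt_finRange k) ?_
    rw [List.perm_ext_iff_of_nodup (hp.imp fun h => h.ne) (List.nodup_finRange k)]
    intro a
    simp only [List.mem_finRange, iff_true, List.mem_map]
    have : slotKind m S K a ≠ .unused := by
      intro h
      rw [hk, Nat.sub_self, Finset.card_eq_zero] at h0
      exact Finset.notMem_empty a (h0 ▸ by simpa using h)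
    exact ⟨_, (slotKind_eq_iff this).mp rfl, rfl⟩
  rw [← h1, List.map_map]
  conv_rhs => rw [← List.map_id (fullSlots m S K k)]
  refine List.map_congr_left fun x hx => ?_
  exact Prod.ext (slotKind_of_mem hx) rfl

/-- The positions in use fill an initial segment, so the only unused one is the last. -/
lemma map_slotKind_finRange_of_succ (hk : blockSum m S + ∑ i, K i + 1 = k) :
    ∃ a, (List.finRange k).map (fun a => (slotKind m S K a, a)) =
      fullSlots m S K k ++ [(.unused, a)] := by
  subst hk
  set N := blockSum m S + ∑ i, K i with hN
  have h0 := card_slotKind_unused (m := m) (S := S) (K := K) (k := N + 1) (Nat.le_succ _)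
  have hlast : slotKind m S K (Fin.last N) = .unused := by
    by_contra h
    have := mem_fullSlots_lt ((slotKind_eq_iff h).mp rfl)
    simp [hN] at this
  have h1 : (fullSlots m S K (N + 1)).map Prod.snd ++ [Fin.last N] = List.finRange (N + 1) := by
    have hp : ((fullSlots m S K (N + 1)).map Prod.snd ++ [Fin.last N]).Pairwise (· < ·) := by
      rw [List.pairwise_append]
      refine ⟨List.pairwise_map.mpr pairwise_fullSlots, by simp, ?_⟩
      intro a ha b hb
      obtain ⟨x, hx, rfl⟩ := List.mem_map.mp ha
      obtain rfl := List.mem_singleton.mp hb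
      exact Fin.lt_def.mpr (mem_fullSlots_lt hx)
    refine List.Perm.eq_of_pairwise (le := (· < ·)) (fun a b _ _ h h' => absurd h' h.asymm)
      hp (List.pairwise_lt_finRange _) ?_
    rw [List.perm_ext_iff_of_nodup (hp.imp fun h => h.ne) (List.nodup_finRange _)]
    intro a
    simp only [List.mem_finRange, iff_true, List.mem_append, List.mem_map, List.mem_singleton]
    by_cases h : slotKind m S K a = .unused
    · right
      refine Finset.card_le_one.mp (by rw [h0]; omega) a ?_ (Fin.last N) ?_
      · simpa using h
      · simpa using hlast
    · exact Or.inl ⟨_, (slotKind_eq_iff h).mp rfl, rfl⟩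
  refine ⟨Fin.last N, ?_⟩
  rw [← h1, List.map_append, List.map_map]
  congr 1
  · conv_rhs => rw [← List.map_id (fullSlots m S K (N + 1))]
    refine List.map_congr_left fun x hx => ?_
    exact Prod.ext (slotKind_of_mem hx) rfl
  · simp [hlast]

/-- Adjoining a new minimum puts one block in front; its length is multiplied by the number of later
blocks, and the contributions of those blocks are unchanged. -/
lemma blockSign_sort {ι : Type*} (B : Fin n → List (ι → ℂ)) (S : Finset (Fin n))
    (hB : ∀ j ∈ S, (B j).length = m j + 1) : blockSign B S.sort = signExp m S := by
  induction S using Finset.induction_on_min with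
  | empty => simp [blockSign, signExp]
  | insert a s ha ih =>
    have has : a ∉ s := fun h => lt_irrefl _ (ha a h)
    rw [Finset.sort_insert _ (fun b hb => (ha b hb).le) has, blockSign, signExp,
      Finset.sum_insert has, ih fun j hj => hB j (Finset.mem_insert_of_mem hj),
      hB a (Finset.mem_insert_self a s), Finset.length_sort, signExp]
    congr 1
    · rw [Finset.filter_insert, if_neg (lt_irrefl a), Finset.filter_true_of_mem ha, mul_comm]
    · refine Finset.sum_congr rfl fun j hj => ?_
      rw [Finset.filter_insert, if_neg (ha j hj).asymm]

lemma mem_reducedSlots {x : SlotKind n × Fin k} (hx : x ∈ reducedSlots m S K k) :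
    x ∈ fullSlots m S K k := by
  rcases List.mem_append.mp hx with h | h
  · obtain ⟨j, hj, h⟩ := List.mem_flatMap.mp h
    obtain ⟨a, ha, rfl⟩ := List.mem_map.mp h
    exact block_mem_fullSlots.mpr ⟨by simpa using hj, by simpa using List.mem_of_mem_tail ha⟩
  · exact List.mem_append_right _ h

end Slots

/-! ### Contraction of a single term with the formal columns. -/

section ReducedRows

variable {n k : ℕ} {m : Fin n → ℕ} {S : Finset (Fin n)} {K : Fin n → ℕ} {E : Type*}

/-- The column of the unused position, if there is one. -/
def extraCols (n : ℕ) (E : Type*) (N k : ℕ) : List (Option (Fin n) ⊕ E) :=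
  if N = k then [] else [Sum.inl none]

/-- The sign of the contraction with the column of the unused position. -/
def extraSign (N k : ℕ) : ℂ := if N = k then 1 else (-1) ^ (k - 1)

/-- The columns of the blocks. -/
def blockCols (E : Type*) (S : Finset (Fin n)) : List (Option (Fin n) ⊕ E) :=
  S.sort.reverse.map fun j => Sum.inl (some j)

/-- The rows of the standard product, those of the blocks being reduced. -/
def reducedRows {ι : Type*} (m : Fin n → ℕ) (S : Finset (Fin n)) (K : Fin n → ℕ)
    (ρ : SlotKind n → Fin k → ι → ℂ) (σ : Equiv.Perm (Fin k)) : List (ι → ℂ) :=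
  (S.sort.flatMap fun j => reduceBlock ((stdBlock m S k j).sort.map fun a => ρ (.block j) (σ a))) ++
    (factorSlots m S K k).map fun x => ρ x.1 (σ x.2)

lemma mem_factorSlots {x : SlotKind n × Fin k} (hx : x ∈ factorSlots m S K k) :
    ∃ l, x.1 = .factor l ∧ x.2 ∈ factorList m S K k l := by
  obtain ⟨l, -, h⟩ := List.mem_flatMap.mp hx
  obtain ⟨a, ha, rfl⟩ := List.mem_map.mp h
  exact ⟨l, rfl, ha⟩

lemma map_reducedSlots {ι : Type*} (ρ : SlotKind n → Fin k → ι → ℂ) (σ : Equiv.Perm (Fin k))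
    (r : SlotKind n × Fin k → ι → ℂ)
    (hb : ∀ j ∈ S, ∀ b C, (stdBlock m S k j).sort = b :: C → ∀ a ∈ C,
      r (.block j, a) = ρ (.block j) (σ a) - ρ (.block j) (σ b))
    (hf : ∀ l, ∀ a ∈ factorList m S K k l, r (.factor l, a) = ρ (.factor l) (σ a)) :
    (reducedSlots m S K k).map r = reducedRows m S K ρ σ := by
  rw [reducedSlots, reducedRows, List.map_append]
  congr 1
  · rw [List.map_flatMap]
    refine List.flatMap_congr fun j hj => ?_
    rw [Finset.mem_sort] at hj
    rcases h : (stdBlock m S k j).sort with _ | ⟨b, C⟩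
    · rw [h]
      rfl
    · rw [h]
      simp only [List.tail_cons, List.map_map, List.map_cons, reduceBlock]
      exact List.map_congr_left fun a ha => hb j hj b C h a ha
  · refine List.map_congr_left fun x hx => ?_
    obtain ⟨l, h1, h2⟩ := mem_factorSlots hx
    obtain ⟨t, a⟩ := x
    obtain rfl : t = .factor l := h1
    exact hf l a h2

/-- The column `none`, if present, is contracted first and meets only the last row, after passing
the k - 1 others. The block columns then subtract the first row of each block from the others. What
remains has the shape of the factors of μ and η, and the accumulated sign does not depend on σ. -/
theorem evalCols_ιMulti_slots (hk : blockSum m S + ∑ i, K i = k ∨ blockSum m S + ∑ i, K i + 1 = k)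
    (ρ : SlotKind n → Fin k → Option (Fin n) ⊕ E → ℂ) (σ : Equiv.Perm (Fin k))
    (hb : ∀ j ∈ S, ∀ a ∈ stdBlock m S k j, ∀ l,
      ρ (.block j) (σ a) (Sum.inl (some l)) = if l = j then 1 else 0)
    (hf : ∀ l i, ∀ j ∈ S, ρ (.factor l) i (Sum.inl (some j)) = 0)
    (hn : ∀ t, t ≠ .unused → ∀ i, ρ t i (Sum.inl none) = 0)
    (hu : ∀ i, ρ .unused i (Sum.inl none) = 1) (w : List (Option (Fin n) ⊕ E)) :
    evalCols (extraCols n E (blockSum m S + ∑ i, K i) k ++ (blockCols E S ++ w))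
        (ExteriorAlgebra.ιMulti ℂ k fun a => ρ (slotKind m S K a) (σ a)) =
      extraSign (blockSum m S + ∑ i, K i) k * (-1) ^ signExp m S *
        evalCols w (wedgeRows (reducedRows m S K ρ σ)) := by
  have hkS : blockSum m S ≤ k := by omega
  have hofn : ExteriorAlgebra.ιMulti ℂ k (fun a => ρ (slotKind m S K a) (σ a)) =
      wedgeRows (((List.finRange k).map fun a => (slotKind m S K a, a)).map
        fun x => ρ x.1 (σ x.2)) := by
    rw [← wedgeRows_ofFn, List.map_map, ← List.ofFn_eq_map]
    rfl
  have hblocks : evalCols (blockCols E S ++ w)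
      (wedgeRows ((fullSlots m S K k).map fun x => ρ x.1 (σ x.2))) =
      (-1) ^ signExp m S * evalCols w (wedgeRows (reducedRows m S K ρ σ)) := by
    have e : (fullSlots m S K k).map (fun x => ρ x.1 (σ x.2)) =
        [] ++ S.sort.flatMap (fun j => (stdBlock m S k j).sort.map fun a => ρ (.block j) (σ a)) ++
          (factorSlots m S K k).map fun x => ρ x.1 (σ x.2) := by
      rw [fullSlots, List.map_append, List.map_flatMap, List.nil_append]
      simp only [List.map_map, Function.comp_def]
    rw [e, blockCols, evalCols_blocks, blockSign_sort (m := m)]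
    · simp [reducedRows]
    · intro j hj
      simp [card_stdBlock hkS hj]
    · exact Finset.sort_nodup _ _
    · intro j hj h
      have := congrArg List.length h
      rw [Finset.mem_sort] at hj
      simp [card_stdBlock hkS hj] at this
    · intro j hj b hb'
      obtain ⟨a, ha, rfl⟩ := List.mem_map.mp hb'
      rw [Finset.mem_sort] at hj ha
      rw [hb j hj a ha, if_pos rfl]
    · intro j _ i hi hij b hb'
      obtain ⟨a, ha, rfl⟩ := List.mem_map.mp hb'
      rw [Finset.mem_sort] at hi ha
      rw [hb i hi a ha, if_neg hij.symm]
    · intro j hj b hb'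
      obtain ⟨x, hx, rfl⟩ := List.mem_map.mp hb'
      obtain ⟨l, h1, h2⟩ := mem_factorSlots hx
      rw [Finset.mem_sort] at hj
      rw [h1, hf l _ j hj]
    · simp
  rcases hk with hk | hk
  · rw [hofn, map_slotKind_finRange hk, extraCols, extraSign, if_pos hk, if_pos hk,
      List.nil_append, hblocks, one_mul]
  · have hne : blockSum m S + ∑ i, K i ≠ k := by omega
    obtain ⟨a, ha⟩ := map_slotKind_finRange_of_succ hk
    have hlen : ((fullSlots m S K k).map fun x => ρ x.1 (σ x.2)).length = k - 1 := by
      have := congrArg List.length ha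
      simp only [List.length_map, List.length_finRange, List.length_append, List.length_cons,
        List.length_nil] at this ⊢
      omega
    rw [hofn, ha, extraCols, extraSign, if_neg hne, if_neg hne, List.map_append,
      wedgeRows_append, List.cons_append, List.nil_append, evalCols_cons, contr_wedgeRows_mul,
      hlen, List.map_cons, List.map_nil, wedgeRows_cons, wedgeRows_nil, contr_ι_mul, contr_one,
      hu, mul_zero, sub_zero, one_smul, mul_one, map_smul, hblocks, smul_eq_mul, mul_assoc]
    intro b hb'
    obtain ⟨x, hx, rfl⟩ := List.mem_map.mp hb'
    refine hn _ ?_ _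
    rintro h
    obtain ⟨t, i⟩ := x
    obtain rfl : t = .unused := h
    exact unused_mem_fullSlots hx

end ReducedRows

/-! ### Pullbacks and logarithmic derivatives. -/

section Pullback

variable {E F G : Type*} [NormedAddCommGroup E] [NormedSpace ℂ E]
  [NormedAddCommGroup F] [NormedSpace ℂ F] [NormedAddCommGroup G] [NormedSpace ℂ G]

lemma wedgeList_compContinuousLinearMap (l : List (F →L[ℂ] ℂ)) (d : ℕ) (A : E →L[ℂ] F) :
    (wedgeList l d).compContinuousLinearMap A = wedgeList (l.map fun a => a.comp A) d := by
  ext v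
  rw [ContinuousAlternatingMap.compContinuousLinearMap_apply, wedgeList_apply, wedgeList_apply,
    List.map_map]
  have := evalCols_wedgeRows_comp (A : E → F) (List.ofFn v) (l.map fun a : F →L[ℂ] ℂ => (a : F → ℂ))
  rw [List.map_map, List.map_ofFn] at this
  rw [← this]
  rfl

lemma dlog_comp {f : F → ℂ} {φ : E → F} {p : E} (hf : DifferentiableAt ℂ f (φ p))
    (hφ : DifferentiableAt ℂ φ p) : (dlog f (φ p)).comp (fderiv ℂ φ p) = dlog (f ∘ φ) p := by
  rw [dlog, dlog, fderiv_comp p hf hφ]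
  rfl

lemma dlog_div {f g : E → ℂ} {p : E} (hf : DifferentiableAt ℂ f p) (hg : DifferentiableAt ℂ g p)
    (hf0 : f p ≠ 0) (hg0 : g p ≠ 0) : dlog (fun x => f x / g x) p = dlog f p - dlog g p := by
  have h := hf.hasFDerivAt.mul ((hasDerivAt_inv hg0).comp_hasFDerivAt p hg.hasFDerivAt)
  have e : (fun x => f x / g x) = f * (fun x => x⁻¹) ∘ g := by
    funext x
    exact div_eq_mul_inv _ _
  rw [dlog, dlog, dlog, e, h.fderiv]
  ext v
  simp
  field_simp
  ring

lemma dlog_const (c : ℂ) (p : E) : dlog (fun _ : E => c) p = 0 := by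
  ext v
  simp [dlog]

lemma pullback_comp {d : ℕ} {f : F → G} {g : E → F} (ω : DForm G d) {p : E}
    (hf : DifferentiableAt ℂ f (g p)) (hg : DifferentiableAt ℂ g p) :
    pullback g (pullback f ω) p = pullback (f ∘ g) ω p := by
  ext v
  simp only [pullback, fderiv_comp p hf hg]
  rfl

lemma pullback_sum_smul {d : ℕ} {α : Type*} (s : Finset α) (c : α → ℂ) (f : E → F)
    (ω : α → DForm F d) (p : E) :
    pullback f (∑ i ∈ s, c i • ω i) p = ∑ i ∈ s, c i • pullback f (ω i) p := by
  ext v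
  simp [pullback, ContinuousAlternatingMap.sum_apply]

lemma pullback_smul {d : ℕ} (c : ℂ) (f : E → F) (ω : DForm F d) :
    pullback f (c • ω) = c • pullback f ω := by
  funext p
  ext v
  simp [pullback]

end Pullback

/-! ### The base form in the charts and its pullbacks. -/

section Charts

variable {n k : ℕ} {m : Fin n → ℕ} {S : Finset (Fin n)}

namespace Label

lemma mem_pull (L : Label k m S) (σ : Equiv.Perm (Fin k)) {a : Fin k} {j : Fin n} :
    a ∈ (L.pull σ).I j ↔ σ a ∈ L.I j := by
  simp only [Label.pull, Finset.mem_map_equiv, Equiv.symm_symm]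

lemma differentiable_hom (L : Label k m S) (i : Fin k) :
    Differentiable ℂ fun y : L.Chart => L.hom y i := by
  by_cases h : L.IsBase i
  · simp only [hom, dif_pos h]
    exact differentiable_const _
  · simp only [hom, dif_neg h]
    fun_prop

lemma hom_permMap_of_inBlock (L : Label k m S) (σ : Equiv.Perm (Fin k)) (y : L.Chart) {a : Fin k}
    (ha : (L.pull σ).InBlock a) (h0 : ∀ i, L.InBlock i → L.hom y i ≠ 0) :
    (L.pull σ).hom (L.permMap σ y) a = L.hom y (σ a) / L.hom y (σ ((L.pull σ).leader a)) := by
  refine (L.pull σ).hom_aff_of_inBlock _ ha (h0 _ ?_)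
  obtain ⟨j, hj⟩ := ha
  exact ⟨j, (L.mem_pull σ).mp ((L.pull σ).leader_mem hj)⟩

lemma hom_permMap_of_not_inBlock (L : Label k m S) (σ : Equiv.Perm (Fin k)) (y : L.Chart)
    {a : Fin k} (ha : ¬ (L.pull σ).InBlock a) :
    (L.pull σ).hom (L.permMap σ y) a = L.hom y (σ a) :=
  (L.pull σ).hom_aff_of_not_inBlock _ ha

lemma differentiableAt_permMap (L : Label k m S) (σ : Equiv.Perm (Fin k)) (y : L.Chart)
    (h0 : ∀ i, L.InBlock i → L.hom y i ≠ 0) : DifferentiableAt ℂ (L.permMap σ) y := by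
  rw [differentiableAt_pi]
  rintro ⟨a, ha⟩
  by_cases h : (L.pull σ).InBlock a
  · simp only [permMap, aff, if_pos h]
    refine ((L.differentiable_hom _ _).mul
      (DifferentiableAt.inv (L.differentiable_hom _ _) (h0 _ ?_))).congr_of_eventuallyEq
      (.of_forall fun y => div_eq_mul_inv _ _)
    obtain ⟨j, hj⟩ := h
    exact ⟨j, (L.mem_pull σ).mp ((L.pull σ).leader_mem hj)⟩
  · simp only [permMap, aff, if_neg h]
    exact L.differentiable_hom _ _

end Label

/-- The function at a position: a homogeneous coordinate for the blocks, `t_a - z_l` for the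
logarithmic factors. -/
def slotFun (z : Fin n → ℂ) (L : Label k m S) : SlotKind n × Fin k → L.Chart → ℂ
  | (.block _, a) => fun y => L.hom y a
  | (.factor l, a) => fun y => L.hom y a - z l
  | (.unused, _) => fun _ => 1

lemma differentiable_slotFun (z : Fin n → ℂ) (L : Label k m S) (x : SlotKind n × Fin k) :
    Differentiable ℂ (slotFun z L x) := by
  obtain ⟨t, a⟩ := x
  cases t with
  | block j => exact L.differentiable_hom a
  | factor l => exact (L.differentiable_hom a).sub_const _
  | unused => exact differentiable_const _

open Classical in
lemma baseForm_eq (z : Fin n → ℂ) (K : Fin n → ℕ) (d : ℕ) (L : Label k m S) (y : L.Chart) :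
    baseForm z S K d L y = if IsStandard L then
      wedgeList ((reducedSlots m S K k).map fun x => dlog (slotFun z L x) y) d else 0 := by
  rw [baseForm]
  by_cases h : IsStandard L
  · rw [if_pos h, if_pos h]
    congr 1
    rw [reducedSlots, factorSlots, List.map_append, List.map_append, List.map_flatMap,
      List.map_flatMap, List.map_flatMap, List.map_flatMap]
    congr 1
    · refine List.flatMap_congr fun j hj => ?_
      rw [Finset.mem_sort] at hj
      have : L.I j = stdBlock m S k j := h j hj
      rw [muFactors, this, List.map_map, List.map_map]
      rfl
    · refine List.flatMap_congr fun l _ => ?_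
      rw [etaFactors, List.map_map, List.map_map]
      rfl
  · rw [if_neg h, if_neg h]

open Classical in
lemma pullback_baseForm {E : Type*} [NormedAddCommGroup E] [NormedSpace ℂ E] (z : Fin n → ℂ)
    (K : Fin n → ℕ) (d : ℕ) (L : Label k m S) {φ : E → L.Chart} {p : E}
    (hφ : DifferentiableAt ℂ φ p) :
    pullback φ (baseForm z S K d L) p = if IsStandard L then
      wedgeList ((reducedSlots m S K k).map fun x => dlog (slotFun z L x ∘ φ) p) d else 0 := by
  rw [pullback, baseForm_eq]
  by_cases h : IsStandard L
  · rw [if_pos h, if_pos h, wedgeList_compContinuousLinearMap, List.map_map]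
    congr 1
    exact List.map_congr_left fun x _ => dlog_comp (differentiable_slotFun z L x _) hφ
  · rw [if_neg h, if_neg h]
    ext v
    simp

lemma inBlock_of_isStandard {L : Label k m S} (h : IsStandard L) {j : Fin n} (hj : j ∈ S)
    {a : Fin k} (ha : a ∈ stdBlock m S k j) : a ∈ L.I j := by
  rw [h j hj]
  exact ha

lemma not_inBlock_of_isStandard {L : Label k m S} (h : IsStandard L) {K : Fin n → ℕ} {l : Fin n}
    {a : Fin k} (ha : a ∈ factorList m S K k l) : ¬ L.InBlock a := by
  rintro ⟨j, hj⟩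
  have hS := L.mem_S hj
  rw [h j hS] at hj
  exact not_mem_stdBlock_of_mem_factorList ha hS hj

lemma leader_of_isStandard {L : Label k m S} (h : IsStandard L) {j : Fin n} (hj : j ∈ S)
    {b : Fin k} {C : List (Fin k)} (hs : (stdBlock m S k j).sort = b :: C) {a : Fin k}
    (ha : a ∈ stdBlock m S k j) : L.leader a = b := by
  have hI : L.I j = stdBlock m S k j := h j hj
  have hb : b ∈ stdBlock m S k j := by
    rw [← Finset.mem_sort (· ≤ ·), hs]
    simp
  have ha' : a ∈ L.I j := hI ▸ ha
  refine le_antisymm (L.leader_le ha' (hI ▸ hb)) ?_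
  have hl := L.leader_mem ha'
  rw [hI, ← Finset.mem_sort (· ≤ ·), hs] at hl
  have hp := Finset.pairwise_sort (stdBlock m S k j) (· ≤ ·)
  -- The head of the sorted list is the minimum of the block.
  rw [hs, List.pairwise_cons] at hp
  rcases List.mem_cons.mp hl with h | h
  · exact h.ge
  · exact hp.1 _ h

end Charts

lemma dlog_congr {E : Type*} [NormedAddCommGroup E] [NormedSpace ℂ E] {f g : E → ℂ} {p : E}
    (h : f =ᶠ[𝓝 p] g) : dlog f p = dlog g p := by
  rw [dlog, dlog, h.fderiv_eq, h.self_of_nhds]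

/-! ### The skew-symmetrized form on a component as an evaluated `skewWedge`. -/

section StratumRows

variable {n k : ℕ} {m : Fin n → ℕ} {S : Finset (Fin n)} {K : Fin n → ℕ}

/-- The rows of the skew-symmetrized product on the component of a label. -/
def stratumRow (z : Fin n → ℂ) (L : Label k m S) (y : L.Chart) :
    SlotKind n → Fin k → Option (Fin n) ⊕ L.Chart → ℂ
  | .block j, i => if i ∈ L.I j then logRow (some j) 1 (dlog (fun y => L.hom y i) y) else 0
  | .factor l, i =>
    open Classical in if L.InBlock i then 0 else logRow none 0 (dlog (fun y => L.hom y i - z l) y)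
  | .unused, _ => logRow none 1 0

lemma logRow_zero_eq {E κ : Type*} [DecidableEq κ] (c c' : κ) (a : E → ℂ) :
    logRow c 0 a = logRow c' 0 a := by
  simp [logRow]

lemma logRow_sub {E κ : Type*} [DecidableEq κ] (c : κ) (ε ε' : ℂ) (a a' : E → ℂ) :
    logRow c ε a - logRow c ε' a' = logRow c (ε - ε') (a - a') := by
  funext x
  rcases x with x | x
  · by_cases h : x = c
    · subst h
      simp [logRow]
    · simp [logRow, h]
  · simp [logRow]

lemma logRow_zero {E κ : Type*} [DecidableEq κ] (c : κ) :
    logRow c 0 (0 : E → ℂ) = 0 := by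
  funext x
  rcases x with x | x <;> simp [logRow]

/-- If σ sent every standard block into the corresponding I_j, equality of cardinalities would make
σ⁻¹ I standard. So each term that is zero by extension acquires a zero block row. -/
lemma exists_not_mem_of_not_isStandard (hk : blockSum m S ≤ k) (L : Label k m S)
    (σ : Equiv.Perm (Fin k)) (h : ¬ IsStandard (L.pull σ)) :
    ∃ j ∈ S, ∃ a ∈ stdBlock m S k j, σ a ∉ L.I j := by
  by_contra hcon
  push Not at hcon
  refine h fun j hj => ?_
  refine (Finset.eq_of_subset_of_card_le (s := stdBlock m S k j) (fun a ha => ?_) ?_).symm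
  · exact (L.mem_pull σ).mpr (hcon j hj a ha)
  · rw [(L.pull σ).card_eq j hj, card_stdBlock hk hj]

lemma eventually_hom_ne_zero (L : Label k m S) {y : L.Chart}
    (h0 : ∀ i, L.InBlock i → L.hom y i ≠ 0) :
    ∀ᶠ y' in 𝓝 y, ∀ i, L.InBlock i → L.hom y' i ≠ 0 := by
  rw [Filter.eventually_all]
  intro i
  by_cases hi : L.InBlock i
  · filter_upwards [(L.differentiable_hom i).continuous.continuousAt.eventually_ne (h0 i hi)]
      with y' hy' _ using hy'
  · exact Eventually.of_forall fun _ h => absurd h hi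

lemma mem_of_sort_eq {α : Type*} [LinearOrder α] {s : Finset α} {b : α} {C : List α}
    (h : s.sort = b :: C) : b ∈ s ∧ ∀ a ∈ C, a ∈ s := by
  constructor
  · rw [← Finset.mem_sort (· ≤ ·), h]
    simp
  · intro a ha
    rw [← Finset.mem_sort (· ≤ ·), h]
    exact List.mem_cons_of_mem _ ha

/-- The skew-symmetrized product on the component of a label. -/
theorem skew_baseForm_apply (z : Fin n → ℂ)
    (hk : blockSum m S + ∑ i, K i = k ∨ blockSum m S + ∑ i, K i + 1 = k) (d : ℕ)
    (L : Label k m S) {y : L.Chart} (h0 : ∀ i, L.InBlock i → L.hom y i ≠ 0)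
    (v : Fin d → L.Chart) :
    extraSign (blockSum m S + ∑ i, K i) k * (-1) ^ signExp m S *
        skew (baseForm z S K d) L y v =
      evalCols (extraCols n L.Chart (blockSum m S + ∑ i, K i) k ++
        (blockCols L.Chart S ++ (List.ofFn v).map Sum.inr))
        (skewWedge (stratumRow z L y) (slotKind m S K)) := by
  have hkS : blockSum m S ≤ k := by omega
  have hskew : skew (baseForm z S K d) L y v = ∑ σ : Equiv.Perm (Fin k),
      ((Equiv.Perm.sign σ : ℤ) : ℂ) *
        pullback (L.permMap σ) (baseForm z S K d (L.pull σ)) y v := by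
    simp [skew, ContinuousAlternatingMap.sum_apply]
  rw [hskew, skewWedge, map_sum, Finset.mul_sum]
  refine Finset.sum_congr rfl fun σ _ => ?_
  rw [map_smul, smul_eq_mul, mul_left_comm]
  congr 1
  have hd := L.differentiableAt_permMap σ y h0
  rw [pullback_baseForm z K d (L.pull σ) hd]
  by_cases hst : IsStandard (L.pull σ)
  · have hmem : ∀ j ∈ S, ∀ a ∈ stdBlock m S k j, σ a ∈ L.I j := fun j hj a ha =>
      (L.mem_pull σ).mp (inBlock_of_isStandard hst hj ha)
    -- Hence the value 0 assigned to factor rows at indices inside blocks does not occur in the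
    -- terms of this case.
    have hnmem : ∀ l, ∀ a ∈ factorList m S K k l, ¬ L.InBlock (σ a) := by
      rintro l a ha ⟨j, hj⟩
      exact not_inBlock_of_isStandard hst ha ⟨j, (L.mem_pull σ).mpr hj⟩
    rw [if_pos hst, evalCols_ιMulti_slots hk (stratumRow z L y) σ, wedgeList_apply]
    · congr 1
      rw [← map_reducedSlots (stratumRow z L y) σ
        (fun x => logRow none 0 (dlog (slotFun z (L.pull σ) x ∘ L.permMap σ) y)),
        ← evalCols_wedgeRows_comp, List.map_map, List.map_map]
      · rfl
      · intro j hj b C hs a ha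
        obtain ⟨hb, hC⟩ := mem_of_sort_eq hs
        have ha := hC a ha
        have hσa := hmem j hj a ha
        have hσb := hmem j hj b hb
        -- After the permutation the coordinate is normalized by the first index of its block. The
        -- identity is needed in a neighbourhood because it is differentiated.
        have e : (slotFun z (L.pull σ) (.block j, a) ∘ L.permMap σ) =ᶠ[𝓝 y]
            fun y => L.hom y (σ a) / L.hom y (σ b) := by
          filter_upwards [eventually_hom_ne_zero L h0] with y' hy'
          rw [← leader_of_isStandard hst hj hs ha]
          exact L.hom_permMap_of_inBlock σ y' ⟨j, inBlock_of_isStandard hst hj ha⟩ hy'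
        rw [dlog_congr e, dlog_div (L.differentiable_hom _ _) (L.differentiable_hom _ _)
          (h0 _ ⟨j, hσa⟩) (h0 _ ⟨j, hσb⟩), stratumRow, stratumRow, if_pos hσa, if_pos hσb,
          logRow_sub, sub_self]
        -- The formal entries 1 - 1 cancel, so it does not matter which formal column carries the
        -- zero.
        exact logRow_zero_eq _ _ _
      · intro l a ha
        have e : slotFun z (L.pull σ) (.factor l, a) ∘ L.permMap σ =
            fun y => L.hom y (σ a) - z l := by
          funext y'
          exact congrArg (· - z l)
            (L.hom_permMap_of_not_inBlock σ y' (not_inBlock_of_isStandard hst ha))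
        rw [e, stratumRow, if_neg (hnmem l a ha)]
    · intro j hj a ha l
      rw [stratumRow, if_pos (hmem j hj a ha)]
      simp [logRow, Pi.single_apply]
    · intro l i j _
      rw [stratumRow]
      split_ifs <;> simp [logRow]
    · intro t ht i
      cases t with
      | block j =>
        rw [stratumRow]
        split_ifs <;> simp [logRow]
      | factor l =>
        rw [stratumRow]
        split_ifs <;> simp [logRow]
      | unused => exact absurd rfl ht
    · intro i
      simp [stratumRow, logRow]
  · rw [if_neg hst]
    obtain ⟨j, hj, a, ha, haj⟩ := exists_not_mem_of_not_isStandard hkS L σ hst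
    rw [(ExteriorAlgebra.ιMulti ℂ k).map_coord_zero a, map_zero]
    · simp
    · rw [slotKind_eq_block_iff.mpr ⟨hj, ha⟩, stratumRow, if_neg haj]

end StratumRows

/-! ### The residue of a single term near the exceptional divisor. -/

section BlowUp

variable {n k : ℕ} {m : Fin n → ℕ} {S : Finset (Fin n)} {K : Fin n → ℕ} {J : Fin n}

/-- Homogeneous coordinates of `blowMap`. -/
def blowHom (z : Fin n → ℂ) (J : Fin n) (L : Label k m (insert J S)) (w : ℂ × L.Chart)
    (i : Fin k) : ℂ :=
  if i ∈ L.I J then z J + w.1 * L.hom w.2 i else L.hom w.2 i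

lemma mem_face (L : Label k m (insert J S)) {i : Fin k} {j : Fin n} :
    i ∈ (L.face J).I j ↔ j ∈ S ∧ i ∈ L.I j := by
  by_cases hj : j ∈ S <;> simp [Label.face, hj]

lemma not_mem_of_inBlock_face (hJ : J ∉ S) (L : Label k m (insert J S)) {i : Fin k}
    (h : (L.face J).InBlock i) : i ∉ L.I J := by
  obtain ⟨j, hj⟩ := h
  obtain ⟨h1, h2⟩ := (mem_face L).mp hj
  intro h
  exact hJ (L.unique h2 h ▸ h1)

lemma isBase_of_face (L : Label k m (insert J S)) {i : Fin k} (h : (L.face J).IsBase i) :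
    L.IsBase i := by
  obtain ⟨⟨j, hj⟩, hl⟩ := h
  obtain ⟨h1, h2⟩ := (mem_face L).mp hj
  refine ⟨⟨j, h2⟩, le_antisymm (L.leader_le h2 h2) ?_⟩
  conv_lhs => rw [← hl]
  exact (L.face J).leader_le hj ((mem_face L).mpr ⟨h1, L.leader_mem h2⟩)

lemma blowHom_of_isBase (hJ : J ∉ S) (z : Fin n → ℂ) (L : Label k m (insert J S))
    (w : ℂ × L.Chart) {i : Fin k} (h : (L.face J).IsBase i) : blowHom z J L w i = 1 := by
  rw [blowHom, if_neg (not_mem_of_inBlock_face hJ L h.1), L.hom_of_isBase _ (isBase_of_face L h)]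

/-- The division in `aff` is by the coordinate of the first index of an old block; blowing up along
I_J leaves it equal to 1. -/
lemma blowMap_eq (hJ : J ∉ S) (z : Fin n → ℂ) (L : Label k m (insert J S)) (w : ℂ × L.Chart) :
    L.blowMap z J w = fun i => blowHom z J L w i.1 := by
  funext ⟨i, hi⟩
  by_cases h : (L.face J).InBlock i
  · have := blowHom_of_isBase hJ z L w ((L.face J).isBase_leader h)
    rw [blowHom] at this
    simp only [Label.blowMap, Label.aff, if_pos h]
    rw [this, div_one]
    rfl
  · simp only [Label.blowMap, Label.aff, if_neg h]
    rfl

lemma hom_blowMap (hJ : J ∉ S) (z : Fin n → ℂ) (L : Label k m (insert J S)) (w : ℂ × L.Chart)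
    (i : Fin k) : (L.face J).hom (L.blowMap z J w) i = blowHom z J L w i := by
  by_cases h : (L.face J).IsBase i
  · rw [(L.face J).hom_of_isBase _ h, blowHom_of_isBase hJ z L w h]
  · rw [blowMap_eq hJ]
    simp only [Label.hom, dif_neg h]

lemma analyticAt_hom_snd (L : Label k m S) (i : Fin k) (p : ℂ × L.Chart) :
    AnalyticAt ℂ (fun w : ℂ × L.Chart => L.hom w.2 i) p := by
  by_cases h : L.IsBase i
  · simp only [Label.hom, dif_pos h]
    exact analyticAt_const
  · simp only [Label.hom, dif_neg h]
    exact ((ContinuousLinearMap.proj (R := ℂ) (φ := fun _ : {i : Fin k // ¬ L.IsBase i} => ℂ)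
      ⟨i, h⟩).comp (ContinuousLinearMap.snd ℂ ℂ L.Chart)).analyticAt p

lemma analyticAt_blowHom (z : Fin n → ℂ) (L : Label k m (insert J S)) (i : Fin k)
    (p : ℂ × L.Chart) : AnalyticAt ℂ (fun w => blowHom z J L w i) p := by
  by_cases h : i ∈ L.I J
  · simp only [blowHom, if_pos h]
    exact analyticAt_const.fun_add (analyticAt_fst.fun_mul (analyticAt_hom_snd L i p))
  · simp only [blowHom, if_neg h]
    exact analyticAt_hom_snd L i p

lemma differentiableAt_blowMap (hJ : J ∉ S) (z : Fin n → ℂ) (L : Label k m (insert J S))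
    (p : ℂ × L.Chart) : DifferentiableAt ℂ (L.blowMap z J) p := by
  have : L.blowMap z J = fun w i => blowHom z J L w i.1 := funext (blowMap_eq hJ z L)
  rw [this, differentiableAt_pi]
  exact fun i => (analyticAt_blowHom z L i p).differentiableAt

/-- The rows of the residue of the skew-symmetrized product. -/
def residueRow (z : Fin n → ℂ) (J : Fin n) (L : Label k m (insert J S)) (y : L.Chart)
    (t : SlotKind n) (i : Fin k) : Option (Fin n) ⊕ L.Chart → ℂ :=
  if t = .factor J then stratumRow z L y t i + stratumRow z L y (.block J) i
  else stratumRow z L y t i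

lemma eventually_blowHom_ne_zero (hJ : J ∉ S) (z : Fin n → ℂ) (L : Label k m (insert J S))
    {y : L.Chart} (h0 : ∀ i, L.InBlock i → L.hom y i ≠ 0) :
    ∀ᶠ w in 𝓝 ((0 : ℂ), y), ∀ i, (L.face J).InBlock i →
      (L.face J).hom (L.blowMap z J w) i ≠ 0 := by
  have h := (continuous_snd.tendsto ((0 : ℂ), y)).eventually (eventually_hom_ne_zero L h0)
  filter_upwards [h] with w hw i hi
  rw [hom_blowMap hJ, blowHom, if_neg (not_mem_of_inBlock_face hJ L hi)]
  obtain ⟨j, hj⟩ := hi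
  exact hw i ⟨j, ((mem_face L).mp hj).2⟩

/-- The order of vanishing along the divisor of the function at a position. -/
def slotOrder (J : Fin n) (L : Label k m (insert J S)) (σ : Equiv.Perm (Fin k)) :
    SlotKind n × Fin k → ℕ
  | (.factor l, a) => if l = J ∧ σ a ∈ L.I J then 1 else 0
  | _ => 0

/-- The nonvanishing part of the function at a position. -/
def slotUnit (z : Fin n → ℂ) (J : Fin n) (L : Label k m (insert J S)) (σ : Equiv.Perm (Fin k)) :
    SlotKind n × Fin k → ℂ × L.Chart → ℂ
  | (.block _, a) => fun w => L.hom w.2 (σ a) / L.hom w.2 (σ (((L.face J).pull σ).leader a))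
  | (.factor l, a) => fun w =>
    if l = J ∧ σ a ∈ L.I J then L.hom w.2 (σ a) else blowHom z J L w (σ a) - z l
  | (.unused, _) => 1

/-- The residue of a term of the skew-symmetrization. -/
theorem exists_residue_term (hJ : J ∉ S) {z : Fin n → ℂ} (hz : Function.Injective z)
    (hk : blockSum m S + ∑ i, K i = k ∨ blockSum m S + ∑ i, K i + 1 = k) (d : ℕ)
    (L : Label k m (insert J S)) {y : L.Chart} (hy : y ∈ L.compl z) (σ : Equiv.Perm (Fin k)) :
    ∃ (β : DForm (ℂ × L.Chart) d) (γ : DForm (ℂ × L.Chart) (d + 1)),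
      AnalyticAt ℂ β (0, y) ∧ AnalyticAt ℂ γ (0, y) ∧
      (∀ᶠ w in 𝓝 ((0 : ℂ), y), w.1 ≠ 0 →
        pullback ((L.face J).permMap σ ∘ L.blowMap z J)
          (baseForm z S K (d + 1) ((L.face J).pull σ)) w =
          w.1⁻¹ • wedgeOne (ContinuousLinearMap.fst ℂ ℂ L.Chart) (β w) + γ w) ∧
      ∀ v : Fin d → L.Chart, extraSign (blockSum m S + ∑ i, K i) k * (-1) ^ signExp m S *
          pullback (fun y : L.Chart => ((0 : ℂ), y)) β y v =
        evalCols (extraCols n L.Chart (blockSum m S + ∑ i, K i) k ++ (blockCols L.Chart S ++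
          (Sum.inl (some J) :: (List.ofFn v).map Sum.inr)))
          (ExteriorAlgebra.ιMulti ℂ k fun a => residueRow z J L y (slotKind m S K a) (σ a)) := by
  have hkS : blockSum m S ≤ k := by omega
  obtain ⟨h0, -, -, hfree⟩ := hy
  have hne := eventually_blowHom_ne_zero hJ z L h0
  have hdiff : ∀ᶠ w in 𝓝 ((0 : ℂ), y),
      DifferentiableAt ℂ ((L.face J).permMap σ ∘ L.blowMap z J) w := by
    filter_upwards [hne] with w hw
    exact ((L.face J).differentiableAt_permMap σ _ hw).comp w (differentiableAt_blowMap hJ z L w)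
  by_cases hst : IsStandard ((L.face J).pull σ)
  swap
  -- A term extended by zero has residue zero, and on the other side a block row is zero.
  · refine ⟨0, 0, analyticAt_const, analyticAt_const, ?_, fun v => ?_⟩
    · filter_upwards [hdiff] with w hw _
      rw [pullback_baseForm z K (d + 1) _ hw, if_neg hst]
      ext v
      simp [wedgeOne_apply]
    · obtain ⟨j, hj, a, ha, haj⟩ := exists_not_mem_of_not_isStandard hkS (L.face J) σ hst
      rw [(ExteriorAlgebra.ιMulti ℂ k).map_coord_zero a, map_zero]
      · simp [pullback]
      · have : σ a ∉ L.I j := fun h => haj ((mem_face L).mpr ⟨hj, h⟩)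
        rw [slotKind_eq_block_iff.mpr ⟨hj, ha⟩, residueRow, if_neg (by simp), stratumRow,
          if_neg this]
  have hmemF : ∀ j ∈ S, ∀ a ∈ stdBlock m S k j, σ a ∈ (L.face J).I j := fun j hj a ha =>
    ((L.face J).mem_pull σ).mp (inBlock_of_isStandard hst hj ha)
  have hmem : ∀ j ∈ S, ∀ a ∈ stdBlock m S k j, σ a ∈ L.I j := fun j hj a ha =>
    ((mem_face L).mp (hmemF j hj a ha)).2
  have hnmem : ∀ l, ∀ a ∈ factorList m S K k l, σ a ∉ L.I J → ¬ L.InBlock (σ a) := by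
    rintro l a ha haJ ⟨j, hj⟩
    rcases Finset.mem_insert.mp (L.mem_S hj) with rfl | hjS
    · exact haJ hj
    · exact not_inBlock_of_isStandard hst ha
        ⟨j, ((L.face J).mem_pull σ).mpr ((mem_face L).mpr ⟨hjS, hj⟩)⟩
  have hlead : ∀ j ∈ S, ∀ a ∈ stdBlock m S k j,
      ((L.face J).pull σ).leader a ∈ stdBlock m S k j := by
    intro j hj a ha
    have h1 := ((L.face J).pull σ).leader_mem (inBlock_of_isStandard hst hj ha)
    rw [hst j hj] at h1
    exact h1
  have hfg : ∀ x ∈ reducedSlots m S K k, ∀ᶠ w in 𝓝 ((0 : ℂ), y),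
      (slotFun z ((L.face J).pull σ) x ∘ ((L.face J).permMap σ ∘ L.blowMap z J)) w =
        w.1 ^ slotOrder J L σ x * slotUnit z J L σ x w := by
    intro x hx
    have hx := mem_reducedSlots hx
    obtain ⟨t, a⟩ := x
    cases t with
    | block j =>
      obtain ⟨hj, ha⟩ := block_mem_fullSlots.mp hx
      filter_upwards [hne] with w hw
      have h1 := (L.face J).hom_permMap_of_inBlock σ (L.blowMap z J w)
        ⟨j, inBlock_of_isStandard hst hj ha⟩ hw
      have e : ∀ a ∈ stdBlock m S k j, blowHom z J L w (σ a) = L.hom w.2 (σ a) := fun a ha => by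
        rw [blowHom, if_neg (not_mem_of_inBlock_face hJ L ⟨j, hmemF j hj a ha⟩)]
      rw [hom_blowMap hJ, hom_blowMap hJ, e a ha, e _ (hlead j hj a ha)] at h1
      simp only [slotOrder, slotUnit, pow_zero, one_mul]
      exact h1
    | factor l =>
      have ha := factor_mem_fullSlots.mp hx
      refine Eventually.of_forall fun w => ?_
      have h1 := (L.face J).hom_permMap_of_not_inBlock σ (L.blowMap z J w)
        (not_inBlock_of_isStandard hst ha)
      rw [hom_blowMap hJ] at h1
      have h2 : slotFun z ((L.face J).pull σ) (.factor l, a)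
          ((L.face J).permMap σ (L.blowMap z J w)) = blowHom z J L w (σ a) - z l :=
        congrArg (· - z l) h1
      rw [Function.comp_apply, Function.comp_apply, h2]
      by_cases hl : l = J ∧ σ a ∈ L.I J
      -- This is where the pole arises: t_i - z_J = r u_i for i ∈ I_J.
      · obtain ⟨rfl, haJ⟩ := hl
        simp [slotOrder, slotUnit, haJ, blowHom]
      · simp only [slotOrder, slotUnit, if_neg hl, pow_zero, one_mul]
    | unused => exact absurd hx unused_mem_fullSlots
  have hg : ∀ x ∈ reducedSlots m S K k, AnalyticAt ℂ (slotUnit z J L σ x) (0, y) := by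
    intro x hx
    have hx := mem_reducedSlots hx
    obtain ⟨t, a⟩ := x
    cases t with
    | block j =>
      obtain ⟨hj, ha⟩ := block_mem_fullSlots.mp hx
      exact (analyticAt_hom_snd L _ _).fun_div (analyticAt_hom_snd L _ _)
        (h0 _ ⟨j, hmem j hj _ (hlead j hj a ha)⟩)
    | factor l =>
      by_cases hl : l = J ∧ σ a ∈ L.I J
      · simp only [slotUnit, if_pos hl]
        exact analyticAt_hom_snd L _ _
      · simp only [slotUnit, if_neg hl]
        exact (analyticAt_blowHom z L _ _).fun_sub analyticAt_const
    | unused => exact absurd hx unused_mem_fullSlots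
  have hg0 : ∀ x ∈ reducedSlots m S K k, slotUnit z J L σ x (0, y) ≠ 0 := by
    intro x hx
    have hx := mem_reducedSlots hx
    obtain ⟨t, a⟩ := x
    cases t with
    | block j =>
      obtain ⟨hj, ha⟩ := block_mem_fullSlots.mp hx
      exact div_ne_zero (h0 _ ⟨j, hmem j hj a ha⟩) (h0 _ ⟨j, hmem j hj _ (hlead j hj a ha)⟩)
    | factor l =>
      have ha := factor_mem_fullSlots.mp hx
      by_cases hl : l = J ∧ σ a ∈ L.I J
      · simp only [slotUnit, if_pos hl]
        exact h0 _ ⟨J, hl.2⟩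
      · simp only [slotUnit, if_neg hl, blowHom]
        -- On the divisor t_i equals z_J for i ∈ I_J, and z_J ≠ z_l by distinctness; a free t_i
        -- differs from every z_l on the complement of the arrangement.
        by_cases haJ : σ a ∈ L.I J
        · have hlJ : J ≠ l := fun h => hl ⟨h.symm, haJ⟩
          simpa [haJ, sub_eq_zero] using fun h => hlJ (hz h)
        · rw [if_neg haJ, sub_ne_zero]
          exact hfree _ (hnmem l a ha haJ) l
    | unused => exact absurd hx unused_mem_fullSlots
  obtain ⟨β, γ, hβ, hγ, hβγ, hres⟩ := exists_logResidue (some J) (reducedSlots m S K k)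
    (fun x => slotFun z ((L.face J).pull σ) x ∘ ((L.face J).permMap σ ∘ L.blowMap z J))
    (slotUnit z J L σ) (slotOrder J L σ) y d hfg hg hg0
  refine ⟨β, γ, hβ, hγ, ?_, fun v => ?_⟩
  · filter_upwards [hdiff, hβγ] with w hw h hr
    rw [pullback_baseForm z K (d + 1) _ hw, if_pos hst]
    exact h hr
  · rw [evalCols_ιMulti_slots hk (residueRow z J L y) σ, hres]
    · congr 2
      rw [← map_reducedSlots (residueRow z J L y) σ]
      · intro j hj b C hs a ha
        obtain ⟨hb, hC⟩ := mem_of_sort_eq hs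
        have ha := hC a ha
        have hσa := hmem j hj a ha
        have hσb := hmem j hj b hb
        simp only [slotUnit, slotOrder, Nat.cast_zero, leader_of_isStandard hst hj hs ha]
        rw [dlog_div (L.differentiable_hom _ _) (L.differentiable_hom _ _)
          (h0 _ ⟨j, hσa⟩) (h0 _ ⟨j, hσb⟩), residueRow, if_neg (by simp), residueRow,
          if_neg (by simp), stratumRow, stratumRow, if_pos hσa, if_pos hσb,
          logRow_sub, sub_self]
        exact logRow_zero_eq _ _ _
      · intro l a ha
        -- For i ∈ I_J the factor row of the next stratum is 0. If l = J, the block row dr/r + d log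
        -- u_i remains; if l ≠ J, the function restricts to the constant z_J - z_l and has no
        -- logarithmic derivative. For i ∉ I_J the block row of J is 0 and the factor row remains.
        by_cases haJ : σ a ∈ L.I J
        · by_cases hl : l = J
          · subst hl
            simp only [slotUnit, slotOrder, haJ, and_self, if_true, Nat.cast_one]
            rw [residueRow, if_pos rfl, stratumRow, stratumRow, if_pos ⟨l, haJ⟩, if_pos haJ,
              zero_add]
          · simp only [slotUnit, slotOrder, hl, false_and, if_false, Nat.cast_zero, blowHom,
              haJ, if_true, zero_mul, add_zero]
            rw [residueRow, if_neg (by simpa using hl), stratumRow, if_pos ⟨J, haJ⟩, dlog_const]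
            exact logRow_zero _
        · simp only [slotUnit, slotOrder, haJ, and_false, if_false, Nat.cast_zero, blowHom]
          have e : stratumRow z L y (.block J) (σ a) = 0 := by
            rw [stratumRow, if_neg haJ]
          rw [residueRow, e, add_zero, ite_self, stratumRow, if_neg (hnmem l a ha haJ)]
          exact logRow_zero_eq _ _ _
    · intro j hj a ha l
      rw [residueRow, if_neg (by simp), stratumRow, if_pos (hmem j hj a ha)]
      simp [logRow, Pi.single_apply]
    · intro l i j hj
      -- The column of J is not among those of the old blocks, so the added block row does not
      -- disturb their contraction.
      have hjJ : j ≠ J := fun h => hJ (h ▸ hj)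
      rw [residueRow, stratumRow, stratumRow]
      split_ifs <;> simp [logRow, hjJ]
    · intro t ht i
      cases t with
      | block j =>
        rw [residueRow, if_neg (by simp), stratumRow]
        split_ifs <;> simp [logRow]
      | factor l =>
        rw [residueRow, stratumRow, stratumRow]
        split_ifs <;> simp [logRow]
      | unused => exact absurd rfl ht
    · intro i
      simp [residueRow, stratumRow, logRow]

end BlowUp

/-! ### Comparison of the total residue with the form on the next stratum. -/

section OrbitResidue

variable {n k : ℕ} {m : Fin n → ℕ} {S : Finset (Fin n)} {K : Fin n → ℕ} {J : Fin n}

/-- The residue of the skew-symmetrized product. -/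
theorem exists_residue_skew (hJ : J ∉ S) {z : Fin n → ℂ} (hz : Function.Injective z)
    (hk : blockSum m S + ∑ i, K i = k ∨ blockSum m S + ∑ i, K i + 1 = k) (d : ℕ)
    (L : Label k m (insert J S)) {y : L.Chart} (hy : y ∈ L.compl z) :
    ∃ (β : DForm (ℂ × L.Chart) d) (γ : DForm (ℂ × L.Chart) (d + 1)),
      AnalyticAt ℂ β (0, y) ∧ AnalyticAt ℂ γ (0, y) ∧
      (∀ᶠ w in 𝓝 ((0 : ℂ), y), w.1 ≠ 0 →
        pullback (L.blowMap z J) (skew (baseForm z S K (d + 1)) (L.face J)) w =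
          w.1⁻¹ • wedgeOne (ContinuousLinearMap.fst ℂ ℂ L.Chart) (β w) + γ w) ∧
      ∀ v : Fin d → L.Chart, extraSign (blockSum m S + ∑ i, K i) k * (-1) ^ signExp m S *
          pullback (fun y : L.Chart => ((0 : ℂ), y)) β y v =
        evalCols (extraCols n L.Chart (blockSum m S + ∑ i, K i) k ++ (blockCols L.Chart S ++
          (Sum.inl (some J) :: (List.ofFn v).map Sum.inr)))
          (skewWedge (residueRow z J L y) (slotKind m S K)) := by
  choose β γ hβ hγ hβγ hres using
    fun σ => exists_residue_term (K := K) hJ hz hk d L hy σ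
  refine ⟨∑ σ : Equiv.Perm (Fin k), ((Equiv.Perm.sign σ : ℤ) : ℂ) • β σ,
    ∑ σ : Equiv.Perm (Fin k), ((Equiv.Perm.sign σ : ℤ) : ℂ) • γ σ, ?_, ?_, ?_, fun v => ?_⟩
  · exact Finset.analyticAt_sum _ fun σ _ => analyticAt_const.smul (hβ σ)
  · exact Finset.analyticAt_sum _ fun σ _ => analyticAt_const.smul (hγ σ)
  · filter_upwards [Filter.eventually_all.mpr hβγ, eventually_blowHom_ne_zero hJ z L hy.1]
      with w hw hne hr
    rw [skew]
    have hsum : pullback (L.blowMap z J) (∑ σ : Equiv.Perm (Fin k),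
        ((Equiv.Perm.sign σ : ℤ) : ℂ) • pullback ((L.face J).permMap σ)
          (baseForm z S K (d + 1) ((L.face J).pull σ))) w =
        ∑ σ : Equiv.Perm (Fin k), ((Equiv.Perm.sign σ : ℤ) : ℂ) •
          (w.1⁻¹ • wedgeOne (ContinuousLinearMap.fst ℂ ℂ L.Chart) (β σ w) + γ σ w) := by
      rw [pullback_sum_smul]
      refine Finset.sum_congr rfl fun σ _ => ?_
      rw [pullback_comp _ ((L.face J).differentiableAt_permMap σ _ hne)
        (differentiableAt_blowMap hJ z L w), hw σ hr]
    rw [hsum]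
    simp only [Finset.sum_apply, Pi.smul_apply, wedgeOne_sum_right, wedgeOne_smul_right,
      smul_add, Finset.sum_add_distrib, Finset.smul_sum]
    congr 1
    exact Finset.sum_congr rfl fun σ _ => smul_comm _ _ _
  · rw [pullback_sum_smul, skewWedge, map_sum, ContinuousAlternatingMap.sum_apply, Finset.mul_sum]
    refine Finset.sum_congr rfl fun σ _ => ?_
    rw [map_smul, smul_eq_mul, ← hres σ v, ContinuousAlternatingMap.smul_apply, smul_eq_mul,
      mul_left_comm]

lemma extraCols_cons_of_unused (hk : blockSum m S + ∑ i, K i ≤ k) {E : Type*}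
    (h : ∃ a : Fin k, slotKind m S K a = .unused) (w : List (Option (Fin n) ⊕ E)) :
    extraCols n E (blockSum m S + ∑ i, K i) k ++ w = Sum.inl none :: w := by
  have hne : blockSum m S + ∑ i, K i ≠ k := by
    intro he
    obtain ⟨a, ha⟩ := h
    have h0 := card_slotKind_unused (m := m) (S := S) (K := K) hk
    rw [he, Nat.sub_self, Finset.card_eq_zero] at h0
    exact Finset.notMem_empty a (h0 ▸ by simpa using ha)
  rw [extraCols, if_neg hne]
  rfl

/-- In the reversed order the columns after that of J belong to the j < J, so there are q of them.
-/
lemma blockCols_insert (hJ : J ∉ S) (E : Type*) :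
    ∃ w₁ w₂ : List (Option (Fin n) ⊕ E), blockCols E S = w₁ ++ w₂ ∧
      blockCols E (insert J S) = w₁ ++ Sum.inl (some J) :: w₂ ∧
      w₂.length = (S.filter (· < J)).card := by
  have h1 : S.sort = (S.filter (· < J)).sort ++ (S.filter (J < ·)).sort := by
    refine List.Perm.eq_of_pairwise (le := (· < ·)) (fun a b _ _ h h' => absurd h' h.asymm)
      (Finset.sortedLT_sort S).pairwise ?_ ?_
    · refine List.pairwise_append.mpr ⟨(Finset.sortedLT_sort _).pairwise,
        (Finset.sortedLT_sort _).pairwise, fun a ha b hb => ?_⟩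
      simp only [Finset.mem_sort, Finset.mem_filter] at ha hb
      exact ha.2.trans hb.2
    · rw [List.perm_ext_iff_of_nodup (Finset.sort_nodup _ _)]
      · intro a
        simp only [List.mem_append, Finset.mem_sort, Finset.mem_filter, ← and_or_left]
        refine ⟨fun h => ⟨h, lt_or_gt_of_ne fun e => hJ (e ▸ h)⟩, fun h => h.1⟩
      · refine List.Nodup.append (Finset.sort_nodup _ _) (Finset.sort_nodup _ _) ?_
        intro a ha hb
        simp only [Finset.mem_sort, Finset.mem_filter] at ha hb
        exact absurd hb.2 ha.2.asymm
  have h2 : (insert J S).sort = (S.filter (· < J)).sort ++ J :: (S.filter (J < ·)).sort := by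
    have hp : ((S.filter (· < J)).sort ++ J :: (S.filter (J < ·)).sort).Pairwise (· < ·) := by
      refine List.pairwise_append.mpr ⟨(Finset.sortedLT_sort _).pairwise, ?_, fun a ha b hb => ?_⟩
      · refine List.pairwise_cons.mpr ⟨fun b hb => ?_, (Finset.sortedLT_sort _).pairwise⟩
        simp only [Finset.mem_sort, Finset.mem_filter] at hb
        exact hb.2
      · simp only [Finset.mem_sort, Finset.mem_filter, List.mem_cons] at ha hb
        rcases hb with rfl | hb
        · exact ha.2
        · exact ha.2.trans hb.2
    refine List.Perm.eq_of_pairwise (le := (· < ·)) (fun a b _ _ h h' => absurd h' h.asymm)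
      (Finset.sortedLT_sort _).pairwise hp ?_
    rw [List.perm_ext_iff_of_nodup (Finset.sort_nodup _ _) (hp.imp fun h => h.ne)]
    intro a
    simp only [List.mem_append, Finset.mem_sort, Finset.mem_filter, List.mem_cons,
      Finset.mem_insert]
    constructor
    · rintro (rfl | h)
      · exact Or.inr (Or.inl rfl)
      · rcases lt_or_gt_of_ne (fun e => hJ (e ▸ h) : a ≠ J) with h' | h'
        · exact Or.inl ⟨h, h'⟩
        · exact Or.inr (Or.inr ⟨h, h'⟩)
    · rintro (h | rfl | h)
      · exact Or.inr h.1
      · exact Or.inl rfl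
      · exact Or.inr h.1
  refine ⟨(S.filter (J < ·)).sort.reverse.map fun j => Sum.inl (some j),
    (S.filter (· < J)).sort.reverse.map fun j => Sum.inl (some j), ?_, ?_, ?_⟩
  · rw [blockCols, h1, List.reverse_append, List.map_append]
  · rw [blockCols, h2]
    simp
  · simp

/-- Comparison of the residue with the skew-symmetrized product of the next stratum. -/
theorem evalCols_residueRow (hJ : J ∉ S) {z : Fin n → ℂ}
    (hk : blockSum m S + ∑ i, K i = k ∨ blockSum m S + ∑ i, K i + 1 = k)
    (L : Label k m (insert J S)) (y : L.Chart) (w : List L.Chart) :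
    (K J < m J + 1 →
      evalCols (extraCols n L.Chart (blockSum m S + ∑ i, K i) k ++ (blockCols L.Chart S ++
        (Sum.inl (some J) :: w.map Sum.inr)))
        (skewWedge (residueRow z J L y) (slotKind m S K)) = 0) ∧
    (m J + 1 ≤ K J → ∀ K' : Fin n → ℕ, K' J + (m J + 1) = K J → (∀ i, i ≠ J → K' i = K i) →
      blockSum m (insert J S) + ∑ i, K' i = blockSum m S + ∑ i, K i →
      evalCols (extraCols n L.Chart (blockSum m S + ∑ i, K i) k ++ (blockCols L.Chart S ++
        (Sum.inl (some J) :: w.map Sum.inr)))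
        (skewWedge (residueRow z J L y) (slotKind m S K)) =
      ((K J).choose (m J + 1) : ℂ) * ((-1) ^ (S.filter (· < J)).card *
        evalCols (extraCols n L.Chart (blockSum m S + ∑ i, K i) k ++
          (blockCols L.Chart (insert J S) ++ w.map Sum.inr))
          (skewWedge (stratumRow z L y) (slotKind m (insert J S) K')))) := by
  have hkle : blockSum m S + ∑ i, K i ≤ k := by omega
  have hcard := L.card_eq J (mem_insert_self J S)
  -- The kind to be split is `factor J`, the new kind is `block J`, and D is I_J. Rows of other
  -- blocks vanish on D by disjointness, and factor rows vanish on every block.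
  obtain ⟨h1, h2⟩ := evalCols_skewWedge_split (stratumRow z L y) (residueRow z J L y)
    (slotKind m S K) (.factor J) (.block J) .unused (by simp) (by simp) (L.I J) (Sum.inl none)
    (Sum.inl (some J))
    (fun i => by rw [residueRow, if_pos rfl])
    (fun t ht => by
      funext i
      rw [residueRow, if_neg ht])
    (fun i => by simp [stratumRow, logRow])
    (fun t ht i => by
      cases t with
      | block j =>
        rw [stratumRow]
        split_ifs <;> simp [logRow]
      | factor l =>
        rw [stratumRow]
        split_ifs <;> simp [logRow]
      | unused => exact absurd rfl ht)
    (fun i hi => by simp [stratumRow, logRow, hi])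
    (fun i hi => by rw [stratumRow, if_neg hi])
    (fun t ht i => by
      cases t with
      | block j =>
        have hj : J ≠ j := fun h => ht (by rw [h])
        rw [stratumRow]
        split_ifs <;> simp [logRow, hj]
      | factor l =>
        rw [stratumRow]
        split_ifs <;> simp [logRow]
      | unused => simp [stratumRow, logRow])
    (fun t ht hu i hi => by
      cases t with
      | block j =>
        have hj : j ≠ J := fun h => ht (by rw [h])
        rw [stratumRow, if_neg fun h => hj (L.unique h hi)]
      | factor l => rw [stratumRow, if_pos ⟨J, hi⟩]
      | unused => exact absurd rfl hu)
    (fun a h => hJ (slotKind_eq_block_iff.mp h).1)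
    (by rw [card_slotKind_unused hkle]; omega)
    (extraCols n L.Chart (blockSum m S + ∑ i, K i) k ++ (blockCols L.Chart S ++
        (Sum.inl (some J) :: w.map Sum.inr)))
    (fun h => ⟨_, extraCols_cons_of_unused hkle h _, by simp⟩)
  rw [hcard, card_slotKind_factor hkle] at h1 h2
  refine ⟨h1, fun hle K' hKJ hK hsum => ?_⟩
  have hkle' : blockSum m (insert J S) + ∑ i, K' i ≤ k := by omega
  have hkb : blockSum m S ≤ k := by omega
  have hkb' : blockSum m (insert J S) ≤ k := by omega
  rw [h2 (slotKind m (insert J S) K')]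
  -- The residue contracts the column of J after all old blocks, whereas the new form contracts it
  -- in its sorted place; the two differ by passing the q columns of the j < J.
  · obtain ⟨w₁, w₂, e1, e2, e3⟩ := blockCols_insert hJ L.Chart
    have := evalCols_move (extraCols n L.Chart (blockSum m S + ∑ i, K i) k ++ w₁) w₂
      (w.map Sum.inr) (Sum.inl (some J))
      (skewWedge (stratumRow z L y) (slotKind (k := k) m (insert J S) K'))
    rw [e3] at this
    rw [e1, e2]
    simp only [List.append_assoc, List.cons_append] at this ⊢
    rw [this, ← mul_assoc ((-1 : ℂ) ^ _), ← pow_add, ← two_mul, pow_mul]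
    simp
  · rw [card_slotKind_factor hkle', hKJ]
  · rw [card_slotKind_block hkb', if_pos (mem_insert_self J S)]
  · intro t hts htt
    cases t with
    | block j =>
      have hj : j ≠ J := fun h => htt (by rw [h])
      rw [card_slotKind_block hkb, card_slotKind_block hkb']
      simp [hj]
    | factor l =>
      have hl : l ≠ J := fun h => hts (by rw [h])
      rw [card_slotKind_factor hkle, card_slotKind_factor hkle', hK l hl]
    | unused => rw [card_slotKind_unused hkle, card_slotKind_unused hkle', hsum]

/-- The coefficient of the base form in `omega`. -/
def omegaCoeff (κ : ℂ) (k : ℕ) (m : Fin n → ℕ) (S : Finset (Fin n)) (K : Fin n → ℕ) : ℂ :=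
  (if blockSum m S + ∑ i, K i = k then (κ ^ k)⁻¹
    else (-1) ^ (k - S.card) * (κ ^ (k - 1))⁻¹) * alpha m S K

lemma omega_eq (z : Fin n → ℂ) (κ : ℂ) (d : ℕ) :
    (omega z κ S K d : OrbitForm k m S d) =
      fun L => omegaCoeff κ k m S K • skew (baseForm z S K d) L := by
  funext L
  rw [omega, skew, skew, Finset.smul_sum]
  refine Finset.sum_congr rfl fun σ _ => ?_
  rw [smul_comm, ← pullback_smul]
  rfl

lemma extraSign_ne_zero (N k : ℕ) : extraSign N k ≠ 0 := by
  rw [extraSign]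
  split_ifs <;> simp

lemma neg_one_pow_mul_self (e : ℕ) : (-1 : ℂ) ^ e * (-1) ^ e = 1 := by
  rw [← pow_add, ← two_mul, pow_mul]
  simp

/-- The residue of a multiple of the skew-symmetrized product, from its evaluation. -/
theorem hasResidue_smul_skew (hJ : J ∉ S) {z : Fin n → ℂ} (hz : Function.Injective z)
    (hk : blockSum m S + ∑ i, K i = k ∨ blockSum m S + ∑ i, K i + 1 = k) (d : ℕ)
    (L : Label k m (insert J S)) (c : ℂ) (ρ : DForm L.Chart d)
    (hρ : ∀ y ∈ L.compl z, ∀ v : Fin d → L.Chart,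
      extraSign (blockSum m S + ∑ i, K i) k * (-1) ^ signExp m S * ρ y v =
      c * evalCols (extraCols n L.Chart (blockSum m S + ∑ i, K i) k ++ (blockCols L.Chart S ++
          (Sum.inl (some J) :: (List.ofFn v).map Sum.inr)))
          (skewWedge (residueRow z J L y) (slotKind m S K))) :
    HasResidue z J L (c • skew (baseForm z S K (d + 1)) (L.face J)) ρ := by
  intro q hq
  have hy := BlowupPoint.coord_mem_compl hq
  obtain ⟨β, γ, hβ, hγ, hβγ, hres⟩ := exists_residue_skew (K := K) hJ hz hk d L hy
  refine ⟨c • β, c • γ, analyticAt_const.smul hβ, analyticAt_const.smul hγ, ?_, ?_⟩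
  · filter_upwards [hβγ] with w hw hr
    rw [pullback_smul, Pi.smul_apply, hw hr, Pi.smul_apply, Pi.smul_apply, wedgeOne_smul_right,
      smul_add, smul_comm]
  · ext v
    have h := hρ _ hy v
    rw [← hres v, mul_left_comm c] at h
    have hne : extraSign (blockSum m S + ∑ i, K i) k * (-1) ^ signExp m S ≠ 0 :=
      mul_ne_zero (extraSign_ne_zero _ _) (pow_ne_zero _ (by simp))
    rw [pullback_smul]
    -- The sign of the formal contractions is common to both sides and nonzero.
    exact mul_left_cancel₀ hne h

lemma blockSum_insert (hJ : J ∉ S) : blockSum m (insert J S) = m J + 1 + blockSum m S := by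
  rw [blockSum, Finset.sum_insert hJ, blockSum]

/-- It ensures that k - p is not a truncated subtraction, so that its parity changes when p grows by
one. -/
lemma card_le_blockSum (m : Fin n → ℕ) (S : Finset (Fin n)) : S.card ≤ blockSum m S := by
  rw [Finset.card_eq_sum_ones, blockSum]
  exact Finset.sum_le_sum fun j _ => Nat.le_add_left _ _

lemma sum_update_sub (hle : m J + 1 ≤ K J) :
    ∑ i, Function.update K J (K J - (m J + 1)) i + (m J + 1) = ∑ i, K i := by
  rw [Finset.sum_update_of_mem (mem_univ J), ← Finset.add_sum_erase univ K (mem_univ J),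
    Finset.sdiff_singleton_eq_erase]
  omega

/-- The left sides of both sign factors cancel the signs inside α; the rest is k_J! = binom(k_J, m_J
+ 1) (m_J + 1)! (k_J - m_J - 1)!. -/
lemma signed_alpha_update (hJ : J ∉ S) (hle : m J + 1 ≤ K J) :
    (-1 : ℂ) ^ signExp m S * alpha m S K * ((K J).choose (m J + 1) : ℂ) =
      (-1) ^ signExp m (insert J S) *
        alpha m (insert J S) (Function.update K J (K J - (m J + 1))) := by
  rw [alpha, alpha, ← mul_assoc, ← mul_assoc, neg_one_pow_mul_self, neg_one_pow_mul_self, one_mul,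
    one_mul, Finset.prod_insert hJ, ← Finset.mul_prod_erase univ _ (mem_univ J),
    ← Finset.mul_prod_erase univ (fun i =>
      ((Function.update K J (K J - (m J + 1)) i).factorial : ℂ)) (mem_univ J),
    Function.update_self]
  have e : ∏ i ∈ univ.erase J, ((Function.update K J (K J - (m J + 1)) i).factorial : ℂ) =
      ∏ i ∈ univ.erase J, ((K i).factorial : ℂ) :=
    Finset.prod_congr rfl fun i hi => by rw [Function.update_of_ne (Finset.ne_of_mem_erase hi)]
  have hc : ((K J).choose (m J + 1) : ℂ) * ((m J + 1).factorial : ℂ) *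
      ((K J - (m J + 1)).factorial : ℂ) = ((K J).factorial : ℂ) := by
    exact_mod_cast Nat.choose_mul_factorial_mul_factorial hle
  have f : ∀ a : ℕ, (a.factorial : ℂ) ≠ 0 := fun a => Nat.cast_ne_zero.mpr a.factorial_ne_zero
  have p1 : ∏ j ∈ S, ((m j + 1).factorial : ℂ) ≠ 0 := Finset.prod_ne_zero_iff.mpr fun j _ => f _
  have p2 : ∏ i ∈ univ.erase J, ((K i).factorial : ℂ) ≠ 0 :=
    Finset.prod_ne_zero_iff.mpr fun j _ => f _
  have hch : ((K J).choose (m J + 1) : ℂ) ≠ 0 := Nat.cast_ne_zero.mpr (Nat.choose_pos hle).ne'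
  rw [e, ← hc]
  have f1 := f (m J + 1)
  have f2 := f (K J - (m J + 1))
  field_simp

/-- The residue of `omega`, up to the comparison of the powers of `κ`. -/
theorem hasOrbitResidue_omega (hJ : J ∉ S) {z : Fin n → ℂ} (hz : Function.Injective z) (κ : ℂ)
    (hk : blockSum m S + ∑ i, K i = k ∨ blockSum m S + ∑ i, K i + 1 = k) (d : ℕ)
    (hle : m J + 1 ≤ K J) (c : ℂ)
    (hc : c * omegaCoeff κ k m (insert J S) (Function.update K J (K J - (m J + 1))) *
        (-1) ^ signExp m (insert J S) =
      omegaCoeff κ k m S K * (-1) ^ signExp m S * ((K J).choose (m J + 1) : ℂ) *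
        (-1) ^ (S.filter (· < J)).card) :
    HasOrbitResidue (k := k) (m := m) z J (omega z κ S K (d + 1))
      (c • omega z κ (insert J S) (Function.update K J (K J - (m J + 1))) d) := by
  set K' := Function.update K J (K J - (m J + 1)) with hK'
  have hsum : blockSum m (insert J S) + ∑ i, K' i = blockSum m S + ∑ i, K i := by
    have := sum_update_sub (K := K) hle
    rw [blockSum_insert hJ, ← this]
    ring
  intro L
  rw [omega_eq, omega_eq]
  refine hasResidue_smul_skew hJ hz hk d L _ _ fun y hy v => ?_
  rw [(evalCols_residueRow hJ hk L y (List.ofFn v)).2 hle K' (by simp [hK']; omega)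
    (fun i hi => by simp [hK', hi]) hsum]
  have h := skew_baseForm_apply z (K := K') (by rw [hsum]; exact hk) d L hy.1 v
  rw [hsum] at h
  rw [← h]
  change _ * (c * (_ * skew (baseForm z (insert J S) K' d) L y v)) = _
  have hs := neg_one_pow_mul_self (signExp m S)
  have hs' := neg_one_pow_mul_self (signExp m (insert J S))
  set A := skew (baseForm z (insert J S) K' d) L y v
  set e := extraSign (blockSum m S + ∑ i, K i) k
  -- Signs are moved across `hc` by using that each of them squares to 1.
  linear_combination (e * A * (-1) ^ signExp m S * (-1) ^ signExp m (insert J S)) * hc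
    - (e * A * (-1) ^ signExp m S * c * omegaCoeff κ k m (insert J S) K') * hs'
    + (e * A * (-1) ^ signExp m (insert J S) * omegaCoeff κ k m S K *
      ((K J).choose (m J + 1) : ℂ) * (-1) ^ (S.filter (· < J)).card) * hs

end OrbitResidue

end

end SkewRes

/-! ### The vanishing case and the two sign cases. -/

theorem lemma6 {n k : ℕ} (m : Fin n → ℕ) (hm : ∀ j, 0 < m j)
    (z : Fin n → ℂ) (hz : Function.Injective z) (κ : ℂ) (hκ : κ ≠ 0)
    (S : Finset (Fin n)) (J : Fin n) (hJ : J ∉ S)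
    (hk : SkewRes.blockSum m (insert J S) ≤ k)
    (K : Fin n → ℕ) (d : ℕ) :
    ((SkewRes.blockSum m S + ∑ i, K i = k ∨ SkewRes.blockSum m S + ∑ i, K i + 1 = k) →
      K J < m J + 1 →
        SkewRes.HasOrbitResidue (k := k) (m := m) z J
          (SkewRes.omega z κ S K (d + 1)) 0) ∧
    (SkewRes.blockSum m S + ∑ i, K i = k → m J + 1 ≤ K J →
      SkewRes.HasOrbitResidue (k := k) (m := m) z J
        (SkewRes.omega z κ S K (d + 1))
        ((-1 : ℂ) ^ (S.filter (· < J)).card •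
          SkewRes.omega z κ (insert J S)
            (Function.update K J (K J - (m J + 1))) d)) ∧
    (SkewRes.blockSum m S + ∑ i, K i + 1 = k → m J + 1 ≤ K J →
      SkewRes.HasOrbitResidue (k := k) (m := m) z J
        (SkewRes.omega z κ S K (d + 1))
        ((-1 : ℂ) ^ ((S.filter (· < J)).card + 1) •
          SkewRes.omega z κ (insert J S)
            (Function.update K J (K J - (m J + 1))) d)) := by
  -- The J-factors that disappear are exactly the positions of the new block. The number of occupied
  -- positions is unchanged, and so is the branch taken in the coefficient of ω.
  have hsum : m J + 1 ≤ K J → SkewRes.blockSum m (insert J S) +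
      ∑ i, Function.update K J (K J - (m J + 1)) i = SkewRes.blockSum m S + ∑ i, K i := by
    intro hle
    have := SkewRes.sum_update_sub (K := K) hle
    rw [SkewRes.blockSum_insert hJ, ← this]
    ring
  refine ⟨fun hkS hlt L => ?_, fun hkS hle => ?_, fun hkS hle => ?_⟩
  · rw [SkewRes.omega_eq]
    refine SkewRes.hasResidue_smul_skew hJ hz hkS d L _ _ fun y _ v => ?_
    rw [(SkewRes.evalCols_residueRow hJ hkS L y (List.ofFn v)).1 hlt]
    simp
  · refine SkewRes.hasOrbitResidue_omega hJ hz κ (Or.inl hkS) d hle _ ?_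
    have h := SkewRes.signed_alpha_update hJ hle
    rw [SkewRes.omegaCoeff, SkewRes.omegaCoeff, hsum hle, if_pos hkS, if_pos hkS]
    linear_combination (-(κ ^ k)⁻¹ * (-1) ^ (S.filter (· < J)).card) * h
  · refine SkewRes.hasOrbitResidue_omega hJ hz κ (Or.inr hkS) d hle _ ?_
    have h := SkewRes.signed_alpha_update hJ hle
    have hne : SkewRes.blockSum m S + ∑ i, K i ≠ k := by omega
    -- The exponent k - p drops by one on passing to the larger index set, which is the source of
    -- the additional minus sign.
    have hcard : k - S.card = k - (insert J S).card + 1 := by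
      have h1 := (SkewRes.card_le_blockSum m (insert J S)).trans hk
      rw [Finset.card_insert_of_notMem hJ] at h1 ⊢
      omega
    rw [SkewRes.omegaCoeff, SkewRes.omegaCoeff, hsum hle, if_neg hne, if_neg hne, hcard, pow_succ,
      pow_succ]
    linear_combination ((-1) ^ (k - (insert J S).card) * (κ ^ (k - 1))⁻¹ *
      (-1) ^ (S.filter (· < J)).card) * h
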